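/- Let $\mathbb{K}=\mathbb{Q}(q,t)$. Let $k,n\geq 1$ be integers and let $m\in\mathbb{Z}$ be coprime to $n$; put $N=kn$. For a rational function $R\in\mathbb{K}(z_1,\dots,z_N)$ write $\mathrm{Sym}(R)=\sum_{\sigma\in S(N)}R(z_{\sigma(1)},\dots,z_{\sigma(N)})$, and set $$\omega(x)=\frac{(1-xq)(t-x)}{(1-x)(t-xq)},\qquad r_{m/n}(i)=\left\lceil\frac{mi}{n}\right\rceil-\left\lceil\frac{m(i-1)}{n}\right\rceil .$$ Let $P_k^{m/n}\in\mathbb{K}(z_1,\dots,z_N)$ be the shuffle element $$P_k^{m/n}=\left[\frac{(1-t)(1-q)}{t-q}\right]^N\mathrm{Sym}\left[\frac{\prod_{i=1}^N z_i^{r_{m/n}(i)}\;\sum_{i=0}^{k-1}\frac{t^i z_nz_{2n}\cdots z_{in}}{q^i z_{n+1}z_{2n+1}\cdots z_{in+1}}}{(1-t^k)\left(1-\frac{tz_1}{qz_2}\right)\cdots\left(1-\frac{tz_{N-1}}{qz_N}\right)}\prod_{1\leq i<j\leq N}\omega\left(\frac{z_i}{z_j}\right)\right].$$ For a partition $\mu$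 of $N$, let $P_k^{m/n}(\mu)$ denote the value of $P_k^{m/n}$ at the tuple of the weights $\chi_\square=q^xt^{-y}$ of the boxes $\square$ of the Young diagram of $\mu$, where $(x,y)$, with $x,y\geq 0$, are the column and row coordinates of $\square$ (the row $y=0$ being the longest). Then, for every integer $1\leq l\leq kn$ and the hook partition $\mu_l=(nk-l+1,1,\dots,1)$ with $l$ terms, the rational function $P_k^{m/n}$ is regular at the weights of $\mu_l$ (taken in any order), and $$P_k^{m/n}(\mu_l)=\left(\sum_{i=0}^{n-1}q^{\sum_{j=1}^{nk-l}\left\lfloor\frac{mj+i}{n}\right\rfloor}\,t^{-\sum_{j=1}^{l-1}\left\lceil\frac{mj-i}{n}\right\rceil}\right)\cdot\frac{1-q^{-k}}{1-tq^{-1}}\;\prod_{i=1}^{nk-l}\frac{1-q^{-i}}{1-q^{-i-1}t}\;\prod_{i=1}^{l-1}\frac{1-t^i}{1-t^{i+1}q^{-1}} .$$ -/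

import Mathlib

namespace PieriShuffle

/-- The field `𝕂 = ℚ(q, t)` of rational functions in two parameters. -/
abbrev K : Type := FractionRing (MvPolynomial (Fin 2) ℚ)

/-- The parameter `q ∈ 𝕂`. -/
noncomputable def q : K := algebraMap (MvPolynomial (Fin 2) ℚ) K (MvPolynomial.X 0)

/-- The parameter `t ∈ 𝕂`. -/
noncomputable def t : K := algebraMap (MvPolynomial (Fin 2) ℚ) K (MvPolynomial.X 1)

/-- The field `𝕂(z₁, …, z_N)` of rational functions in `N` variables. -/
abbrev RatFun (N : ℕ) : Type := FractionRing (MvPolynomial (Fin N) K)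

/-- A scalar of `𝕂`, seen as a constant rational function. -/
noncomputable def const (N : ℕ) (c : K) : RatFun N := algebraMap K (RatFun N) c

/-- The variable `z_j`, with the `1`-based index `1 ≤ j ≤ N`
(the value for other `j` plays no role). -/
noncomputable def z (N j : ℕ) : RatFun N :=
  if h : 1 ≤ j ∧ j ≤ N then
    algebraMap (MvPolynomial (Fin N) K) (RatFun N) (MvPolynomial.X ⟨j - 1, by omega⟩)
  else 1

/-- The automorphism `R(z₁, …, z_N) ↦ R(z_{σ(1)}, …, z_{σ(N)})` of `𝕂(z₁, …, z_N)`. -/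
noncomputable def permute (N : ℕ) (σ : Equiv.Perm (Fin N)) : RatFun N ≃+* RatFun N :=
  IsFractionRing.ringEquivOfRingEquiv
    (MvPolynomial.renameEquiv K σ).toRingEquiv

/-- `Sym R = ∑_{σ ∈ S(N)} R(z_{σ(1)}, …, z_{σ(N)})`. -/
noncomputable def Sym (N : ℕ) (R : RatFun N) : RatFun N :=
  ∑ σ : Equiv.Perm (Fin N), permute N σ R

/-- `ω(x) = (1 - x q) (t - x) / ((1 - x) (t - x q))`. -/
noncomputable def omega (N : ℕ) (x : RatFun N) : RatFun N :=
  ((1 - x * const N q) * (const N t - x)) / ((1 - x) * (const N t - x * const N q))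

/-- `r_{m/n}(i) = ⌈m i / n⌉ - ⌈m (i - 1) / n⌉`. -/
def expo (m : ℤ) (n : ℕ) (i : ℕ) : ℤ :=
  ⌈(m * i : ℚ) / n⌉ - ⌈(m * ((i : ℚ) - 1)) / n⌉

/-- The shuffle element `P_k^{m/n}(z₁, …, z_N)`, with `N = k n`. -/
noncomputable def P (k : ℕ) (m : ℤ) (n : ℕ) : RatFun (k * n) :=
  let N := k * n
  const N (((1 - t) * (1 - q)) / (t - q)) ^ N *
    Sym N
      (((∏ i ∈ Finset.Icc 1 N, z N i ^ expo m n i) *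
          (∑ i ∈ Finset.range k,
            (const N t ^ i * ∏ a ∈ Finset.Icc 1 i, z N (a * n)) /
              (const N q ^ i * ∏ a ∈ Finset.Icc 1 i, z N (a * n + 1)))) /
        ((1 - const N t ^ k) *
          ∏ i ∈ Finset.Icc 1 (N - 1), (1 - (const N t * z N i) / (const N q * z N (i + 1)))) *
        ∏ i ∈ Finset.Icc 1 N, ∏ j ∈ Finset.Icc (i + 1) N, omega N (z N i / z N j))

/-- The rational function `R` is regular at the point `x ∈ 𝕂^N`, and its value there is `v`. -/
def HasValueAt {N : ℕ} (R : RatFun N) (x : Fin N → K) (v : K) : Prop :=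
  ∃ a b : MvPolynomial (Fin N) K,
    R = algebraMap _ (RatFun N) a / algebraMap _ (RatFun N) b ∧
      MvPolynomial.eval x b ≠ 0 ∧ v = MvPolynomial.eval x a / MvPolynomial.eval x b

/-- The weight `χ_□ = q^x t^{-y}` of a box; a cell of a `YoungDiagram` is the pair
`(row, column) = (y, x)`. -/
noncomputable def weight (c : ℕ × ℕ) : K := q ^ c.2 * t ^ (-(c.1 : ℤ))

/-- `R(μ) = v`: the diagram `μ` has as many boxes as `R` has variables, and, for every
enumeration of the boxes, `R` is regular at the tuple of their weights, with value `v`. -/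
def HasValueAtDiagram {N : ℕ} (R : RatFun N) (μ : YoungDiagram) (v : K) : Prop :=
  μ.card = N ∧ ∀ e : Fin N ≃ {c // c ∈ μ.cells}, HasValueAt R (fun i => weight (e i).1) v

/-- The hook partition `(N - l + 1, 1, …, 1)` with `l` terms (for `1 ≤ l ≤ N`). -/
def hook (N l : ℕ) : YoungDiagram :=
  YoungDiagram.ofRowLens ((N - l + 1) :: List.replicate (l - 1) 1) (by
    refine List.Pairwise.sortedGE (List.pairwise_cons.2 ⟨fun b hb => ?_, ?_⟩)
    · rw [List.eq_of_mem_replicate hb]; omega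
    · exact List.pairwise_replicate.2 (Or.inr le_rfl))

section Telescope

variable {F : Type*} [Field F]

/-- Telescoping along a finite totally ordered family of factors. -/
lemma sum_one_sub_mul_prod_lt {ι : Type*} (S : Finset ι) (f : ι → ℚ) (g : ι → F)
    (hf : Set.InjOn f S) :
    ∑ i ∈ S, (1 - g i) * ∏ i' ∈ S with f i' < f i, g i' = 1 - ∏ i ∈ S, g i := by
  classical
  induction S using Finset.induction_on_max_value f with
  | empty => simp
  | insert a s has hmax ih =>
    have hlt : ∀ x ∈ s, f x < f a := fun x hx =>
      lt_of_le_of_ne (hmax x hx) fun h => has (by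
        have := hf (Finset.mem_coe.2 (Finset.mem_insert_of_mem hx))
          (Finset.mem_coe.2 (Finset.mem_insert_self a s)) h
        rwa [this] at hx)
    have h1 : (insert a s).filter (fun i' => f i' < f a) = s := by
      ext x
      simp only [Finset.mem_filter, Finset.mem_insert]
      constructor
      · rintro ⟨rfl | h, h'⟩
        · exact absurd h' (lt_irrefl _)
        · exact h
      · exact fun h => ⟨Or.inr h, hlt x h⟩
    have h2 : ∀ i ∈ s, (insert a s).filter (fun i' => f i' < f i)
        = s.filter (fun i' => f i' < f i) := by
      intro i hi
      rw [Finset.filter_insert, if_neg (not_lt.2 (hmax i hi))]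
    rw [Finset.sum_insert has, Finset.prod_insert has, h1,
      Finset.sum_congr rfl (fun i hi => by rw [h2 i hi]),
      ih (hf.mono (by simp))]
    ring

/-- The number, as an integer, of the first `a` terms of `x` that are below `w`. -/
def countBelow (a : ℕ) (x : ℕ → ℚ) (w : ℚ) : ℤ :=
  ∑ u ∈ Finset.range a, if x u < w then 1 else 0

lemma prod_const_filter_lt (q : F) (a : ℕ) (x : ℕ → ℚ) (w : ℚ) :
    (∏ _i ∈ Finset.range a with x _i < w, q) = q ^ countBelow a x w := by
  rw [Finset.prod_const, countBelow, Finset.sum_boole, zpow_natCast]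

/-- Telescoping along two merged families of points, one with factor `q`, one with factor `t`. -/
lemma telescope_two (q t : F) (a b : ℕ) (x y : ℕ → ℚ) (z : ℚ)
    (hx : Set.InjOn x (Finset.range a)) (hy : Set.InjOn y (Finset.range b))
    (hxy : ∀ i < a, ∀ j < b, x i ≠ y j) :
    (1 - q) * ∑ j ∈ Finset.range a with x j < z,
        q ^ countBelow a x (x j) * t ^ countBelow b y (x j) +
      (1 - t) * ∑ j ∈ Finset.range b with y j < z,
        q ^ countBelow a x (y j) * t ^ countBelow b y (y j) =
      1 - q ^ countBelow a x z * t ^ countBelow b y z := by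
  classical
  set f : ℕ ⊕ ℕ → ℚ := Sum.elim x y with hfdef
  set g : ℕ ⊕ ℕ → F := Sum.elim (fun _ => q) (fun _ => t) with hgdef
  have key : ∀ w ≤ z, ∏ i' ∈ (((Finset.range a).filter (x · < z)).disjSum
      ((Finset.range b).filter (y · < z))) with f i' < w, g i' =
      q ^ countBelow a x w * t ^ countBelow b y w := by
    intro w hw
    rw [← prod_const_filter_lt, ← prod_const_filter_lt, Finset.prod_filter,
      Finset.prod_disjSum, ← Finset.prod_filter, ← Finset.prod_filter]
    simp only [hfdef, hgdef, Sum.elim_inl, Sum.elim_inr, Finset.filter_filter]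
    congr 2 <;>
    · ext i
      simp only [Finset.mem_filter]
      exact ⟨fun h => ⟨h.1, h.2.2⟩, fun h => ⟨h.1, lt_of_lt_of_le h.2 hw, h.2⟩⟩
  have h := sum_one_sub_mul_prod_lt (((Finset.range a).filter (x · < z)).disjSum
      ((Finset.range b).filter (y · < z))) f g (by
    rintro (i | i) hi (j | j) hj hij <;>
      simp only [Finset.mem_coe, Finset.inl_mem_disjSum, Finset.inr_mem_disjSum,
        Finset.mem_filter, Finset.mem_range, hfdef, Sum.elim_inl, Sum.elim_inr] at hi hj hij
    · rw [hx (by simpa using hi.1) (by simpa using hj.1) hij]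
    · exact absurd hij (hxy i hi.1 j hj.1)
    · exact absurd hij.symm (hxy j hj.1 i hi.1)
    · rw [hy (by simpa using hi.1) (by simpa using hj.1) hij])
  have hall := key z le_rfl
  rw [Finset.filter_true_of_mem] at hall
  · rw [hall] at h
    rw [← h, Finset.sum_disjSum, Finset.mul_sum, Finset.mul_sum]
    congr 1
    · refine Finset.sum_congr rfl fun i hi => ?_
      rw [key _ (by simpa [hfdef] using (Finset.mem_filter.1 hi).2.le)]
      simp [hfdef, hgdef]
    · refine Finset.sum_congr rfl fun i hi => ?_
      rw [key _ (by simpa [hfdef] using (Finset.mem_filter.1 hi).2.le)]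
      simp [hfdef, hgdef]
  · rintro (i | i) hi <;> simp [hfdef] at hi ⊢ <;> exact hi.2

lemma ite_lt_eq_ceil {x y : ℚ} (h1 : y - x < 1) (h2 : -1 < y - x) :
    (if x < y then 1 else 0 : ℤ) = ⌈y - x⌉ := by
  split_ifs with h
  · exact (Int.ceil_eq_iff.2 ⟨by push_cast; linarith, by push_cast; linarith⟩).symm
  · exact (Int.ceil_eq_iff.2 ⟨by push_cast; linarith, by push_cast; linarith⟩).symm

end Telescope

section ClosedForm

variable {F : Type*} [Field F]

/-- `∑_{v=1}^a (h i - h (i - v))`. -/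
def dropSum (h : ℤ → ℤ) (a : ℕ) (i : ℤ) : ℤ :=
  ∑ v ∈ Finset.range a, (h i - h (i - (v + 1)))

/-- The weighted sum over the orderings of the hook `(a, b)` that follow the arm box `a + 1`,
for the exponents `h (j + 1) - h j`. -/
def armSum (q t : F) (h : ℤ → ℤ) (θ : ℚ) (a b : ℕ) : F :=
  ∑ j ∈ Finset.range (a + 1),
    q ^ (((a : ℤ) + 1) * (h (a + b + 1) - h (a + b + 1 - j)) +
      ∑ u ∈ Finset.range (a + 1), ⌈θ * ((u : ℚ) - j)⌉) * t ^ (-dropSum h b (a + b + 1 - j))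

/-- The weighted sum over the orderings of the hook `(a, b)` that follow the leg box `b + 1`,
for the exponents `h (j + 1) - h j`. -/
def legSum (q t : F) (h : ℤ → ℤ) (θ : ℚ) (a b : ℕ) : F :=
  ∑ j ∈ Finset.range (b + 1),
    q ^ ((a : ℤ) + dropSum h a (a + b + 1 - j)) *
      t ^ (-(((b : ℤ) + 1) * (h (a + b + 1) - h (a + b + 1 - j)) +
        ∑ u ∈ Finset.range (b + 1), ⌊θ * ((u : ℚ) - j)⌋))

/-- The part of the hook sum where the last arm box comes first. -/
def armStep (q t : F) (h : ℤ → ℤ) (θ : ℚ) (a b : ℕ) : F :=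
  ∑ j ∈ Finset.range a,
    q ^ ((a : ℤ) * (h (a + b + 1) - h (a + b - j)) +
      ∑ u ∈ Finset.range a, ⌈θ * ((u : ℚ) - j)⌉) * t ^ (-dropSum h b (a + b - j))

/-- The part of the hook sum where the last leg box comes first. -/
def legStep (q t : F) (h : ℤ → ℤ) (θ : ℚ) (a b : ℕ) : F :=
  ∑ j ∈ Finset.range b,
    q ^ ((a : ℤ) + dropSum h a (a + b - j)) *
      t ^ (-((b : ℤ) * (h (a + b + 1) - h (a + b - j)) +
        ∑ u ∈ Finset.range b, ⌊θ * ((u : ℚ) - j)⌋))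

lemma armStep_zero (q t : F) (h : ℤ → ℤ) (θ : ℚ) (b : ℕ) : armStep q t h θ 0 b = 0 := by
  simp [armStep]

lemma legStep_zero (q t : F) (h : ℤ → ℤ) (θ : ℚ) (a : ℕ) : legStep q t h θ a 0 = 0 := by
  simp [legStep]

lemma armStep_succ {q : F} (hq : q ≠ 0) (t : F) (h : ℤ → ℤ) (θ : ℚ) (a b : ℕ) :
    armStep q t h θ (a + 1) b =
      q ^ (((a : ℤ) + 1) * (h (a + b + 2) - h (a + b + 1))) * armSum q t h θ a b := by
  rw [armStep, armSum, Finset.mul_sum]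
  refine Finset.sum_congr rfl fun j _ => ?_
  rw [← mul_assoc, ← zpow_add₀ hq]
  have e1 : ((a + 1 : ℕ) : ℤ) + b - j = a + b + 1 - j := by push_cast; ring
  have e2 : ((a + 1 : ℕ) : ℤ) + b + 1 = a + b + 2 := by push_cast; ring
  rw [e1, e2]
  push_cast
  congr 2
  ring

lemma legStep_succ (q : F) {t : F} (ht : t ≠ 0) (h : ℤ → ℤ) (θ : ℚ) (a b : ℕ) :
    legStep q t h θ a (b + 1) =
      t ^ (-(((b : ℤ) + 1) * (h (a + b + 2) - h (a + b + 1)))) * legSum q t h θ a b := by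
  rw [legStep, legSum, Finset.mul_sum]
  refine Finset.sum_congr rfl fun j _ => ?_
  rw [mul_left_comm, ← zpow_add₀ ht]
  have e1 : (a : ℤ) + (b + 1 : ℕ) - j = a + b + 1 - j := by push_cast; ring
  have e2 : (a : ℤ) + (b + 1 : ℕ) + 1 = a + b + 2 := by push_cast; ring
  rw [e1, e2]
  push_cast
  congr 2
  ring

lemma ceil_eq_floor_add_one {x : ℚ} (hx : ∀ n : ℤ, x ≠ n) : ⌈x⌉ = ⌊x⌋ + 1 := by
  rw [Int.ceil_eq_iff]
  push_cast
  refine ⟨?_, (Int.lt_floor_add_one x).le⟩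
  have := lt_of_le_of_ne (Int.floor_le x) (hx _).symm
  linarith

lemma armSum_legSum_rec {q t : F} (hq : q ≠ 0) (ht : t ≠ 0) (h : ℤ → ℤ) (θ δ : ℚ) (a b : ℕ)
    (hh : ∀ i : ℤ, 1 ≤ i → i ≤ a + b + 1 → h i = ⌊θ * i + δ⌋)
    (hθ : ∀ s : ℤ, 1 ≤ s → s ≤ a + b → ∀ n : ℤ, θ * s ≠ n)
    (hψ : ∀ i : ℤ, 1 ≤ i → i ≤ a + b → ∀ n : ℤ, θ * i + δ ≠ n) :
    (1 - q ^ a * t ^ b) * armSum q t h θ a b =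
        (1 - q * (q ^ a * t ^ b)) * armStep q t h θ a b + (1 - t) * legStep q t h θ a b ∧
      (1 - q ^ a * t ^ b) * legSum q t h θ a b =
        (1 - t * (q ^ a * t ^ b)) * legStep q t h θ a b +
          q ^ a * t ^ b * (1 - q) * armStep q t h θ a b := by
  set M : ℤ := a + b with hM
  set x : ℕ → ℚ := fun j => -(θ * (j + 1)) + ⌈θ * ((j : ℚ) + 1)⌉ with hxdef
  set y : ℕ → ℚ := fun j => -(θ * ((M - j : ℤ) : ℚ) + δ) + h (M - j) + 1 with hydef
  set z : ℚ := 1 - (θ * ((M + 1 : ℤ) : ℚ) + δ) + h (M + 1) with hzdef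
  have hθ' : ∀ j : ℕ, (j : ℤ) < M → ∀ n : ℤ, θ * ((j : ℚ) + 1) ≠ n := by
    intro j hj n
    have := hθ (j + 1) (by omega) (by omega) n
    push_cast at this; exact this
  have hx0 : ∀ j < a, 0 < x j ∧ x j < 1 := by
    intro j hj
    have h1 := Int.le_ceil (θ * ((j : ℚ) + 1))
    have h2 := Int.ceil_lt_add_one (θ * ((j : ℚ) + 1))
    have h3 := hθ' j (by omega) ⌈θ * ((j : ℚ) + 1)⌉
    refine ⟨?_, by simp only [hxdef]; linarith⟩
    have := lt_of_le_of_ne h1 h3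
    simp only [hxdef]; linarith
  have hy0 : ∀ j < b, 0 < y j ∧ y j < 1 := by
    intro j hj
    have h1 := Int.floor_le (θ * ((M - j : ℤ) : ℚ) + δ)
    have h2 := Int.lt_floor_add_one (θ * ((M - j : ℤ) : ℚ) + δ)
    have h3 := hψ (M - j) (by omega) (by omega) ⌊θ * ((M - j : ℤ) : ℚ) + δ⌋
    have h4 := lt_of_le_of_ne h1 h3.symm
    simp only [hydef]
    rw [hh (M - j) (by omega) (by omega)]
    constructor <;> linarith
  have hz0 : 0 < z ∧ z ≤ 1 := by
    have h1 := Int.floor_le (θ * ((M + 1 : ℤ) : ℚ) + δ)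
    have h2 := Int.lt_floor_add_one (θ * ((M + 1 : ℤ) : ℚ) + δ)
    simp only [hzdef]
    rw [hh (M + 1) (by omega) (by omega)]
    constructor <;> linarith
  -- indicator identities
  have ixx : ∀ u < a, ∀ j < a, (if x u < x j then 1 else 0 : ℤ) =
      ⌈θ * ((u : ℚ) - j)⌉ + ⌈θ * ((j : ℚ) + 1)⌉ - ⌈θ * ((u : ℚ) + 1)⌉ := by
    intro u hu j hj
    have h1 := hx0 u hu; have h2 := hx0 j hj
    rw [ite_lt_eq_ceil (by linarith) (by linarith),
      ← Int.ceil_add_intCast, ← Int.ceil_sub_intCast]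
    congr 1
    simp only [hxdef]; ring
  have iyx : ∀ v < b, ∀ j < a, (if y v < x j then 1 else 0 : ℤ) =
      h (M - j - (v + 1)) + ⌈θ * ((j : ℚ) + 1)⌉ - h (M - v) := by
    intro v hv j hj
    have h1 := hy0 v hv; have h2 := hx0 j hj
    have h3 := ceil_eq_floor_add_one (hψ (M - j - (v + 1)) (by omega) (by omega))
    rw [← hh _ (by omega) (by omega)] at h3
    have h4 : h (M - j - (v + 1)) = ⌈θ * ((M - j - (v + 1) : ℤ) : ℚ) + δ⌉ - 1 := by omega
    rw [ite_lt_eq_ceil (by linarith) (by linarith), h4]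
    have h5 : x j - y v = θ * ((M - j - (v + 1) : ℤ) : ℚ) + δ +
        ((⌈θ * ((j : ℚ) + 1)⌉ - h (M - v) - 1 : ℤ) : ℚ) := by
      simp only [hxdef, hydef]; push_cast; ring
    rw [h5, Int.ceil_add_intCast]; ring
  have iyy : ∀ v < b, ∀ j < b, (if y v < y j then 1 else 0 : ℤ) =
      -⌊θ * ((v : ℚ) - j)⌋ + h (M - j) - h (M - v) := by
    intro v hv j hj
    have h1 := hy0 v hv; have h2 := hy0 j hj
    rw [ite_lt_eq_ceil (by linarith) (by linarith), ← Int.ceil_neg,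
      ← Int.ceil_add_intCast, ← Int.ceil_sub_intCast]
    congr 1
    simp only [hydef]; push_cast; ring
  have ixy : ∀ v < a, ∀ j < b, (if x v < y j then 1 else 0 : ℤ) =
      1 + h (M - j) - h (M - j - (v + 1)) - ⌈θ * ((v : ℚ) + 1)⌉ := by
    intro v hv j hj
    have h1 := hx0 v hv; have h2 := hy0 j hj
    rw [ite_lt_eq_ceil (by linarith) (by linarith), hh (M - j - (v + 1)) (by omega) (by omega)]
    have h5 : y j - x v = -(θ * ((M - j - (v + 1) : ℤ) : ℚ) + δ) +
        ((1 + h (M - j) - ⌈θ * ((v : ℚ) + 1)⌉ : ℤ) : ℚ) := by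
      simp only [hxdef, hydef]; push_cast; ring
    rw [h5, Int.ceil_add_intCast, Int.ceil_neg]; ring
  have ixz : ∀ v < a, (if x v < z then 1 else 0 : ℤ) =
      1 + h (M + 1) - h (M - v) - ⌈θ * ((v : ℚ) + 1)⌉ := by
    intro v hv
    have h1 := hx0 v hv
    rw [ite_lt_eq_ceil (by linarith) (by linarith), hh (M - v) (by omega) (by omega)]
    have h5 : z - x v = -(θ * ((M - v : ℤ) : ℚ) + δ) +
        ((1 + h (M + 1) - ⌈θ * ((v : ℚ) + 1)⌉ : ℤ) : ℚ) := by
      simp only [hxdef, hzdef]; push_cast; ring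
    rw [h5, Int.ceil_add_intCast, Int.ceil_neg]; ring
  have iyz : ∀ v < b, (if y v < z then 1 else 0 : ℤ) =
      -⌊θ * ((v : ℚ) + 1)⌋ + h (M + 1) - h (M - v) := by
    intro v hv
    have h1 := hy0 v hv
    rw [ite_lt_eq_ceil (by linarith) (by linarith), ← Int.ceil_neg,
      ← Int.ceil_add_intCast, ← Int.ceil_sub_intCast]
    congr 1
    simp only [hydef, hzdef]; push_cast; ring
  have hxinj : Set.InjOn x (Finset.range a) := by
    intro u hu j hj huj
    simp only [Finset.coe_range, Set.mem_Iio] at hu hj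
    have aux : ∀ u j : ℕ, u < a → j < a → x u = x j → u ≤ j := by
      intro u j hu hj huj
      by_contra hlt
      refine hθ (u - j) (by omega) (by omega)
        (⌈θ * ((u : ℚ) + 1)⌉ - ⌈θ * ((j : ℚ) + 1)⌉) ?_
      simp only [hxdef] at huj
      push_cast; linarith
    exact le_antisymm (aux u j hu hj huj) (aux j u hj hu huj.symm)
  have hyinj : Set.InjOn y (Finset.range b) := by
    intro u hu j hj huj
    simp only [Finset.coe_range, Set.mem_Iio] at hu hj
    have aux : ∀ u j : ℕ, u < b → j < b → y u = y j → u ≤ j := by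
      intro u j hu hj huj
      by_contra hlt
      refine hθ (u - j) (by omega) (by omega) (h (M - j) - h (M - u)) ?_
      simp only [hydef] at huj
      push_cast at huj ⊢; linarith
    exact le_antisymm (aux u j hu hj huj) (aux j u hj hu huj.symm)
  have hxyne : ∀ i < a, ∀ j < b, x i ≠ y j := by
    intro i hi j hj hij
    refine hψ (M - i - (j + 1)) (by omega) (by omega)
      (h (M - j) + 1 - ⌈θ * ((i : ℚ) + 1)⌉) ?_
    simp only [hxdef, hydef] at hij
    push_cast at hij ⊢; linarith
  set D : ℚ → F := fun w => q ^ countBelow a x w * t ^ countBelow b y w with hD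
  have tel := telescope_two q t a b x y
  set α₀ : F := q ^ (∑ u ∈ Finset.range a, ⌈θ * ((u : ℚ) + 1)⌉) * t ^ (-dropSum h b (M + 1))
    with hα₀
  set β₀ : F := q ^ ((a : ℤ) + dropSum h a (M + 1)) *
    t ^ (-∑ u ∈ Finset.range b, ⌊θ * ((u : ℚ) + 1)⌋) with hβ₀
  set pT : ℕ → F := fun j => q ^ ((a : ℤ) * (h (M + 1) - h (M - j)) +
      ∑ u ∈ Finset.range a, ⌈θ * ((u : ℚ) - j)⌉) * t ^ (-dropSum h b (M - j)) with hpT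
  set sT : ℕ → F := fun j => q ^ ((a : ℤ) + dropSum h a (M - j)) *
      t ^ (-((b : ℤ) * (h (M + 1) - h (M - j)) +
        ∑ u ∈ Finset.range b, ⌊θ * ((u : ℚ) - j)⌋)) with hsT
  have hdrop : ∀ c : ℕ, ∀ i : ℤ, dropSum h c i = c * h i - ∑ v ∈ Finset.range c, h (i - (v + 1)) := by
    intro c i
    simp [dropSum, Finset.sum_sub_distrib]
  have hdropM : ∀ c : ℕ, dropSum h c (M + 1) =
      c * h (M + 1) - ∑ v ∈ Finset.range c, h (M - v) := by
    intro c
    rw [hdrop]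
    congr 1
    refine Finset.sum_congr rfl fun v _ => ?_
    congr 1; ring
  have mulD : ∀ w, α₀ * D w =
      q ^ (∑ u ∈ Finset.range a, ⌈θ * ((u : ℚ) + 1)⌉ + countBelow a x w) *
        t ^ (-dropSum h b (M + 1) + countBelow b y w) := by
    intro w
    simp only [hα₀, hD]
    rw [mul_mul_mul_comm, ← zpow_add₀ hq, ← zpow_add₀ ht]
  have hX : q ^ a * t ^ b = q ^ (a : ℤ) * t ^ (b : ℤ) := by simp
  have cxx : ∀ j < a, countBelow a x (x j) = ∑ u ∈ Finset.range a, ⌈θ * ((u : ℚ) - j)⌉ +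
      a * ⌈θ * ((j : ℚ) + 1)⌉ - ∑ u ∈ Finset.range a, ⌈θ * ((u : ℚ) + 1)⌉ := by
    intro j hj
    rw [countBelow, Finset.sum_congr rfl fun u hu => ixx u (Finset.mem_range.1 hu) j hj]
    simp [Finset.sum_add_distrib, Finset.sum_sub_distrib]
  have cyx : ∀ j < a, countBelow b y (x j) = ∑ v ∈ Finset.range b, h (M - j - (v + 1)) +
      b * ⌈θ * ((j : ℚ) + 1)⌉ - ∑ v ∈ Finset.range b, h (M - v) := by
    intro j hj
    rw [countBelow, Finset.sum_congr rfl fun u hu => iyx u (Finset.mem_range.1 hu) j hj]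
    simp [Finset.sum_add_distrib, Finset.sum_sub_distrib]
  have cyy : ∀ j < b, countBelow b y (y j) = -∑ u ∈ Finset.range b, ⌊θ * ((u : ℚ) - j)⌋ +
      b * h (M - j) - ∑ v ∈ Finset.range b, h (M - v) := by
    intro j hj
    rw [countBelow, Finset.sum_congr rfl fun u hu => iyy u (Finset.mem_range.1 hu) j hj]
    simp [Finset.sum_add_distrib, Finset.sum_sub_distrib]
  have cxy : ∀ j < b, countBelow a x (y j) = a + a * h (M - j) -
      ∑ v ∈ Finset.range a, h (M - j - (v + 1)) -
      ∑ u ∈ Finset.range a, ⌈θ * ((u : ℚ) + 1)⌉ := by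
    intro j hj
    rw [countBelow, Finset.sum_congr rfl fun u hu => ixy u (Finset.mem_range.1 hu) j hj]
    simp [Finset.sum_sub_distrib, mul_add]
  have cxz : countBelow a x z = a + a * h (M + 1) - ∑ v ∈ Finset.range a, h (M - v) -
      ∑ u ∈ Finset.range a, ⌈θ * ((u : ℚ) + 1)⌉ := by
    rw [countBelow, Finset.sum_congr rfl fun u hu => ixz u (Finset.mem_range.1 hu)]
    simp [Finset.sum_sub_distrib, mul_add]
  have cyz : countBelow b y z = -∑ u ∈ Finset.range b, ⌊θ * ((u : ℚ) + 1)⌋ + b * h (M + 1) -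
      ∑ v ∈ Finset.range b, h (M - v) := by
    rw [countBelow, Finset.sum_congr rfl fun u hu => iyz u (Finset.mem_range.1 hu)]
    simp [Finset.sum_add_distrib, Finset.sum_sub_distrib]
  have hs : ∀ j < b, sT j = α₀ * D (y j) := by
    intro j hj
    rw [mulD, cyy j hj, cxy j hj, hdropM]
    simp only [hsT]
    rw [hdrop]
    congr 2 <;> ring
  have hβ : β₀ = α₀ * D z := by
    rw [mulD, cxz, cyz, hdropM]
    simp only [hβ₀]
    rw [hdropM]
    congr 2 <;> ring
  have hp1 : ∀ j < a, x j < z → pT j = α₀ * D (x j) := by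
    intro j hj hlt
    have hi := ixz j hj
    rw [if_pos hlt] at hi
    have hc : ⌈θ * ((j : ℚ) + 1)⌉ = h (M + 1) - h (M - j) := by omega
    rw [mulD, cxx j hj, cyx j hj, hdropM, hc]
    simp only [hpT]
    rw [hdrop]
    congr 2 <;> ring
  have hp0 : ∀ j < a, ¬ x j < z → q ^ a * t ^ b * pT j = α₀ * D (x j) := by
    intro j hj hlt
    have hi := ixz j hj
    rw [if_neg hlt] at hi
    have hc : ⌈θ * ((j : ℚ) + 1)⌉ = h (M + 1) - h (M - j) + 1 := by omega
    rw [mulD, cxx j hj, cyx j hj, hdropM, hc, hX]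
    simp only [hpT]
    rw [hdrop, mul_mul_mul_comm, ← zpow_add₀ hq, ← zpow_add₀ ht]
    congr 2 <;> ring
  have hD1 : D 1 = q ^ a * t ^ b := by
    have e1 : countBelow a x 1 = a := by
      rw [countBelow, Finset.sum_congr rfl fun u hu =>
        if_pos (hx0 u (Finset.mem_range.1 hu)).2]
      simp
    have e2 : countBelow b y 1 = b := by
      rw [countBelow, Finset.sum_congr rfl fun u hu =>
        if_pos (hy0 u (Finset.mem_range.1 hu)).2]
      simp
    simp only [hD]
    rw [e1, e2, hX]
  have tel1 := tel 1 hxinj hyinj hxyne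
  rw [Finset.filter_true_of_mem fun j hj => (hx0 j (Finset.mem_range.1 hj)).2,
    Finset.filter_true_of_mem fun j hj => (hy0 j (Finset.mem_range.1 hj)).2] at tel1
  have telz := tel z hxinj hyinj hxyne
  change (1 - q) * ∑ j ∈ Finset.range a, D (x j) + (1 - t) * ∑ j ∈ Finset.range b, D (y j) =
    1 - D 1 at tel1
  change (1 - q) * ∑ j ∈ Finset.range a with x j < z, D (x j) +
    (1 - t) * ∑ j ∈ Finset.range b with y j < z, D (y j) = 1 - D z at telz
  set p1 := ∑ j ∈ Finset.range a with x j < z, pT j with hp1def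
  set p0 := ∑ j ∈ Finset.range a with ¬ x j < z, pT j with hp0def
  set s1 := ∑ j ∈ Finset.range b with y j < z, sT j with hs1def
  set s0 := ∑ j ∈ Finset.range b with ¬ y j < z, sT j with hs0def
  have hP : armStep q t h θ a b = p1 + p0 :=
    (Finset.sum_filter_add_sum_filter_not _ _ _).symm
  have hS : legStep q t h θ a b = s1 + s0 :=
    (Finset.sum_filter_add_sum_filter_not _ _ _).symm
  have hp1' : p1 = α₀ * ∑ j ∈ Finset.range a with x j < z, D (x j) := by
    rw [Finset.mul_sum]
    refine Finset.sum_congr rfl fun j hj => ?_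
    rw [Finset.mem_filter, Finset.mem_range] at hj
    exact hp1 j hj.1 hj.2
  have hp0' : q ^ a * t ^ b * p0 = α₀ * ∑ j ∈ Finset.range a with ¬ x j < z, D (x j) := by
    rw [Finset.mul_sum, Finset.mul_sum]
    refine Finset.sum_congr rfl fun j hj => ?_
    rw [Finset.mem_filter, Finset.mem_range] at hj
    exact hp0 j hj.1 hj.2
  have hs1' : s1 = α₀ * ∑ j ∈ Finset.range b with y j < z, D (y j) := by
    rw [Finset.mul_sum]
    refine Finset.sum_congr rfl fun j hj => ?_
    rw [Finset.mem_filter, Finset.mem_range] at hj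
    exact hs j hj.1
  have hs0' : s0 = α₀ * ∑ j ∈ Finset.range b with ¬ y j < z, D (y j) := by
    rw [Finset.mul_sum]
    refine Finset.sum_congr rfl fun j hj => ?_
    rw [Finset.mem_filter, Finset.mem_range] at hj
    exact hs j hj.1
  have hA : armSum q t h θ a b = α₀ + q * p1 + p0 := by
    have hterm : ∀ j < a, q ^ (((a : ℤ) + 1) * (h (M + 1) - h (M + 1 - (j + 1 : ℕ))) +
        ∑ u ∈ Finset.range (a + 1), ⌈θ * ((u : ℚ) - (j + 1 : ℕ))⌉) *
        t ^ (-dropSum h b (M + 1 - (j + 1 : ℕ))) = (if x j < z then q else 1) * pT j := by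
      intro j hj
      have hi := ixz j hj
      have e1 : M + 1 - (j + 1 : ℕ) = M - j := by push_cast; ring
      have e2 : ∑ u ∈ Finset.range (a + 1), ⌈θ * ((u : ℚ) - (j + 1 : ℕ))⌉ =
          ∑ u ∈ Finset.range a, ⌈θ * ((u : ℚ) - j)⌉ + (1 - ⌈θ * ((j : ℚ) + 1)⌉) := by
        rw [Finset.sum_range_succ', ceil_eq_floor_add_one (hθ' j (by omega))]
        congr 1
        · refine Finset.sum_congr rfl fun u _ => ?_
          push_cast; congr 1; ring
        · rw [show θ * (((0 : ℕ) : ℚ) - (j + 1 : ℕ)) = -(θ * ((j : ℚ) + 1)) by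
            push_cast; ring, Int.ceil_neg]
          ring
      rw [e1, e2]
      have e3 : (if x j < z then q else 1) = q ^ (if x j < z then 1 else 0 : ℤ) := by
        split_ifs <;> simp
      rw [e3, hi]
      simp only [hpT]
      rw [← mul_assoc, ← zpow_add₀ hq]
      congr 2
      ring
    rw [armSum, Finset.sum_range_succ', Finset.sum_congr rfl fun j hj =>
      hterm j (Finset.mem_range.1 hj), ← Finset.sum_filter_add_sum_filter_not _ (fun j => x j < z),
      Finset.sum_congr rfl (fun j hj => by rw [if_pos (Finset.mem_filter.1 hj).2]),
      Finset.sum_congr (s₁ := (Finset.range a).filter fun j => ¬ x j < z) rfl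
        (fun j hj => by rw [if_neg (Finset.mem_filter.1 hj).2, one_mul]),
      ← Finset.mul_sum, ← hp1def, ← hp0def]
    have e4 : q ^ (((a : ℤ) + 1) * (h (M + 1) - h (M + 1 - (0 : ℕ))) +
        ∑ u ∈ Finset.range (a + 1), ⌈θ * ((u : ℚ) - (0 : ℕ))⌉) *
        t ^ (-dropSum h b (M + 1 - (0 : ℕ))) = α₀ := by
      rw [Finset.sum_range_succ']
      simp [hα₀]
    rw [e4]; ring
  have hB : legSum q t h θ a b = β₀ + s1 + t * s0 := by
    have hterm : ∀ j < b, q ^ ((a : ℤ) + dropSum h a (M + 1 - (j + 1 : ℕ))) *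
      t ^ (-(((b : ℤ) + 1) * (h (M + 1) - h (M + 1 - (j + 1 : ℕ))) +
        ∑ u ∈ Finset.range (b + 1), ⌊θ * ((u : ℚ) - (j + 1 : ℕ))⌋)) =
        (if y j < z then 1 else t) * sT j := by
      intro j hj
      have hi := iyz j hj
      have e1 : M + 1 - (j + 1 : ℕ) = M - j := by push_cast; ring
      have e2 : ∑ u ∈ Finset.range (b + 1), ⌊θ * ((u : ℚ) - (j + 1 : ℕ))⌋ =
          ∑ u ∈ Finset.range b, ⌊θ * ((u : ℚ) - j)⌋ + (-⌊θ * ((j : ℚ) + 1)⌋ - 1) := by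
        rw [Finset.sum_range_succ']
        congr 1
        · refine Finset.sum_congr rfl fun u _ => ?_
          push_cast; congr 1; ring
        · rw [show θ * (((0 : ℕ) : ℚ) - (j + 1 : ℕ)) = -(θ * ((j : ℚ) + 1)) by
            push_cast; ring, Int.floor_neg, ceil_eq_floor_add_one (hθ' j (by omega))]
          ring
      rw [e1, e2]
      have e3 : (if y j < z then 1 else t) = t ^ (1 - (if y j < z then 1 else 0) : ℤ) := by
        split_ifs <;> simp
      rw [e3, hi]
      simp only [hsT]
      rw [mul_left_comm, ← zpow_add₀ ht]
      congr 2
      ring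
    rw [legSum, Finset.sum_range_succ', Finset.sum_congr rfl fun j hj =>
      hterm j (Finset.mem_range.1 hj), ← Finset.sum_filter_add_sum_filter_not _ (fun j => y j < z),
      Finset.sum_congr rfl (fun j hj => by rw [if_pos (Finset.mem_filter.1 hj).2, one_mul]),
      Finset.sum_congr (s₁ := (Finset.range b).filter fun j => ¬ y j < z) rfl
        (fun j hj => by rw [if_neg (Finset.mem_filter.1 hj).2]),
      ← Finset.mul_sum, ← hs1def, ← hs0def]
    have e4 : q ^ ((a : ℤ) + dropSum h a (M + 1 - (0 : ℕ))) *
      t ^ (-(((b : ℤ) + 1) * (h (M + 1) - h (M + 1 - (0 : ℕ))) +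
        ∑ u ∈ Finset.range (b + 1), ⌊θ * ((u : ℚ) - (0 : ℕ))⌋)) = β₀ := by
      rw [Finset.sum_range_succ']
      simp [hβ₀]
    rw [e4]; ring
  rw [← Finset.sum_filter_add_sum_filter_not (Finset.range a) (fun j => x j < z) (fun j => D (x j)),
    ← Finset.sum_filter_add_sum_filter_not (Finset.range b) (fun j => y j < z) (fun j => D (y j)),
    hD1] at tel1
  have r1 : (1 - q) * (p1 + q ^ a * t ^ b * p0) + (1 - t) * (s1 + s0) =
      (1 - q ^ a * t ^ b) * α₀ := by
    rw [hp1', hp0', hs1', hs0']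
    linear_combination α₀ * tel1
  have r2 : (1 - q) * p1 + (1 - t) * s1 = α₀ - β₀ := by
    rw [hp1', hs1', hβ]
    linear_combination α₀ * telz
  rw [hA, hB, hP, hS]
  constructor
  · linear_combination -r1
  · linear_combination -r1 + (1 - q ^ a * t ^ b) * r2

end ClosedForm

section Orderings

variable {F : Type*} [Field F]

/-- The value of `ω` at `x`, for parameters `q`, `t` in a field. -/
def omegaVal (q t x : F) : F := ((1 - x * q) * (t - x)) / ((1 - x) * (t - x * q))

/-- The factor `1 / (1 - t x / (q y))` attached to consecutive variables `x`, `y`. -/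
def link (q t x y : F) : F := (1 - (t * x) / (q * y))⁻¹

/-- The contribution of the first `N` terms of `w` to the shuffle sum, where the `i`-th term has
the exponent `e (N - 1 - i)`. -/
def seqWeight (q t : F) (e : ℕ → ℤ) (N : ℕ) (w : ℕ → F) : F :=
  (∏ i ∈ Finset.range N, w i ^ e (N - 1 - i)) *
    (∏ i ∈ Finset.range (N - 1), link q t (w i) (w (i + 1))) *
    ∏ i ∈ Finset.range N, ∏ j ∈ Finset.Ico (i + 1) N, omegaVal q t (w i / w j)

lemma seqWeight_succ_succ (q t : F) (e : ℕ → ℤ) (n : ℕ) (w : ℕ → F) :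
    seqWeight q t e (n + 2) w = w 0 ^ e (n + 1) * link q t (w 0) (w 1) *
      (∏ j ∈ Finset.range (n + 1), omegaVal q t (w 0 / w (j + 1))) *
      seqWeight q t e (n + 1) (fun i => w (i + 1)) := by
  rw [seqWeight, seqWeight, Finset.prod_range_succ', show n + 2 - 1 = n + 1 from rfl,
    Finset.prod_range_succ' (fun i => link q t (w i) (w (i + 1))),
    Finset.prod_range_succ' (fun i => ∏ j ∈ Finset.Ico (i + 1) (n + 2), omegaVal q t (w i / w j))]
  have e1 : ∀ i ∈ Finset.range (n + 1), w (i + 1) ^ e (n + 1 - (i + 1)) =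
      w (i + 1) ^ e (n + 1 - 1 - i) := by
    intro i _
    congr 2
    omega
  have e2 : ∀ i, ∏ j ∈ Finset.Ico (i + 1 + 1) (n + 2), omegaVal q t (w (i + 1) / w j) =
      ∏ j ∈ Finset.Ico (i + 1) (n + 1), omegaVal q t (w (i + 1) / w (j + 1)) := by
    intro i
    rw [Finset.prod_Ico_add' (fun j => omegaVal q t (w (i + 1) / w j)) (i + 1) (n + 1) 1]
  have e3 : ∏ j ∈ Finset.Ico (0 + 1) (n + 2), omegaVal q t (w 0 / w j) =
      ∏ j ∈ Finset.range (n + 1), omegaVal q t (w 0 / w (j + 1)) := by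
    rw [Finset.range_eq_Ico, Finset.prod_Ico_add' (fun j => omegaVal q t (w 0 / w j)) 0 (n + 1) 1]
  rw [Finset.prod_congr rfl e1, Finset.prod_congr rfl (fun i _ => e2 i), e3]
  simp only [Nat.sub_zero, zero_add, Nat.add_sub_cancel]
  ring

lemma seqWeight_one (q t : F) (e : ℕ → ℤ) (w : ℕ → F) :
    seqWeight q t e 1 w = w 0 ^ e 0 := by
  simp [seqWeight]

/-- A finite sequence, extended by `1`. -/
def extendOne {N : ℕ} (v : Fin N → F) (i : ℕ) : F := if h : i < N then v ⟨i, h⟩ else 1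

lemma extendOne_coe {N : ℕ} (v : Fin N → F) (i : Fin N) : extendOne v i = v i :=
  dif_pos i.2

lemma extendOne_zero {N : ℕ} (v : Fin (N + 1) → F) : extendOne v 0 = v 0 := by
  simp [extendOne]

lemma extendOne_succ {N : ℕ} (v : Fin (N + 1) → F) (i : ℕ) :
    extendOne v (i + 1) = extendOne (fun j => v j.succ) i := by
  simp [extendOne, Fin.succ]

/-- The sum of `seqWeight` over the orderings of a set of `n + 1` elements, with an extra factor
`G x` for the first element `x`. -/
def orderSum [DecidableEq F] (q t : F) (e : ℕ → ℤ) : ℕ → (F → F) → Finset F → F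
  | 0, G, S => ∑ x ∈ S, G x * x ^ e 0
  | n + 1, G, S => ∑ x ∈ S, G x * x ^ e (n + 1) *
      (∏ y ∈ S.erase x, omegaVal q t (x / y)) * orderSum q t e n (link q t x) (S.erase x)

lemma sum_perm_seqWeight [DecidableEq F] (q t : F) (e : ℕ → ℤ) (n : ℕ) :
    ∀ (G : F → F) (v : Fin (n + 1) → F), Function.Injective v →
    ∑ σ : Equiv.Perm (Fin (n + 1)), G (v (σ 0)) * seqWeight q t e (n + 1) (extendOne (v ∘ σ)) =
      orderSum q t e n G (Finset.univ.image v) := by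
  induction n with
  | zero =>
    intro G v hv
    simp [orderSum, seqWeight_one, extendOne_zero]
  | succ n ih =>
    intro G v hv
    rw [orderSum, Finset.sum_image (fun _ _ _ _ h => hv h),
      ← Equiv.sum_comp Equiv.Perm.decomposeFin.symm, Fintype.sum_prod_type]
    refine Finset.sum_congr rfl fun p _ => ?_
    set v' : Fin (n + 1) → F := fun j => v (Equiv.swap 0 p j.succ) with hv'
    have hinj : Function.Injective v' := fun i j hij =>
      Fin.succ_injective _ ((Equiv.swap 0 p).injective (hv hij))
    have himg : (Finset.univ.image v).erase (v p) = Finset.univ.image v' := by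
      ext y
      simp only [Finset.mem_erase, Finset.mem_image, Finset.mem_univ, true_and]
      constructor
      · rintro ⟨hne, i, rfl⟩
        have hi : Equiv.swap 0 p i ≠ 0 := by
          intro h0
          apply hne
          have : i = p := by
            have := congrArg (Equiv.swap 0 p) h0
            rwa [Equiv.swap_apply_self, Equiv.swap_apply_left] at this
          rw [this]
        obtain ⟨j, hj⟩ := Fin.exists_succ_eq.2 hi
        exact ⟨j, by rw [hv']; simp [hj]⟩
      · rintro ⟨j, rfl⟩
        refine ⟨fun h => ?_, _, rfl⟩
        have h1 := hv h
        have h2 := congrArg (Equiv.swap 0 p) h1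
        rw [Equiv.swap_apply_self, Equiv.swap_apply_right] at h2
        exact Fin.succ_ne_zero j h2
    rw [himg, ← ih (link q t (v p)) v' hinj, Finset.mul_sum]
    refine Finset.sum_congr rfl fun τ _ => ?_
    have hz : (Equiv.Perm.decomposeFin.symm (p, τ)) 0 = p := by simp
    have hs : (fun i => extendOne (v ∘ (Equiv.Perm.decomposeFin.symm (p, τ))) (i + 1)) =
        extendOne (v' ∘ τ) := by
      funext i
      rw [extendOne_succ]
      congr 1
      funext j
      simp [hv']
    have hs' : ∀ i, extendOne (v ∘ (Equiv.Perm.decomposeFin.symm (p, τ))) (i + 1) =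
        extendOne (v' ∘ τ) i := fun i => congrFun hs i
    have h1 : extendOne (v ∘ (Equiv.Perm.decomposeFin.symm (p, τ))) 1 = v' (τ 0) := by
      rw [hs' 0, extendOne_zero]; rfl
    rw [seqWeight_succ_succ, hs, extendOne_zero, h1, Finset.prod_image (fun _ _ _ _ h => hinj h),
      Function.comp_apply, hz]
    have hp : ∏ j ∈ Finset.range (n + 1), omegaVal q t
        (v p / extendOne (v ∘ (Equiv.Perm.decomposeFin.symm (p, τ))) (j + 1)) =
        ∏ j : Fin (n + 1), omegaVal q t (v p / v' j) := by
      rw [← Equiv.prod_comp τ, Finset.prod_range]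
      refine Finset.prod_congr rfl fun j _ => ?_
      rw [hs', extendOne_coe]
      rfl
    rw [hp]
    ring

end Orderings

section Hook

variable {F : Type*} [Field F]

/-- The parameters `q`, `t` are multiplicatively independent. -/
structure Independent (q t : F) : Prop where
  q_ne_zero : q ≠ 0
  t_ne_zero : t ≠ 0
  eq_zero : ∀ i j : ℤ, q ^ i * t ^ j = 1 → i = 0 ∧ j = 0

namespace Independent

variable {q t : F}

lemma mul_pow_ne_one (H : Independent q t) {i j : ℕ} (h : i ≠ 0 ∨ j ≠ 0) : q ^ i * t ^ j ≠ 1 := by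
  intro h1
  have := H.eq_zero i j (by simpa using h1)
  omega

lemma one_sub_ne (H : Independent q t) {i j : ℕ} (h : i ≠ 0 ∨ j ≠ 0) : 1 - q ^ i * t ^ j ≠ 0 :=
  fun h1 => H.mul_pow_ne_one h (sub_eq_zero.1 h1).symm

lemma one_sub_q_pow (H : Independent q t) {i : ℕ} (h : i ≠ 0) : 1 - q ^ i ≠ 0 := by
  simpa using H.one_sub_ne (j := 0) (Or.inl h)

lemma one_sub_t_pow (H : Independent q t) {i : ℕ} (h : i ≠ 0) : 1 - t ^ i ≠ 0 := by
  simpa using H.one_sub_ne (i := 0) (Or.inr h)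

lemma one_sub_q (H : Independent q t) : 1 - q ≠ 0 := by simpa using H.one_sub_q_pow one_ne_zero

lemma one_sub_t (H : Independent q t) : 1 - t ≠ 0 := by simpa using H.one_sub_t_pow one_ne_zero

lemma t_pow_sub_q_pow (H : Independent q t) {i j : ℕ} (h : i ≠ 0 ∨ j ≠ 0) : t ^ j - q ^ i ≠ 0 := by
  intro h1
  have := H.eq_zero i (-j) (by
    rw [zpow_neg, zpow_natCast, zpow_natCast, ← sub_eq_zero.1 h1]
    exact mul_inv_cancel₀ (pow_ne_zero _ H.t_ne_zero))
  omega

lemma t_sub_q_pow (H : Independent q t) (i : ℕ) : t - q ^ i ≠ 0 := by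
  simpa using H.t_pow_sub_q_pow (i := i) (j := 1) (Or.inr one_ne_zero)

lemma t_pow_sub_q (H : Independent q t) (j : ℕ) : t ^ j - q ≠ 0 := by
  simpa using H.t_pow_sub_q_pow (i := 1) (j := j) (Or.inl one_ne_zero)

lemma t_sub_q (H : Independent q t) : t - q ≠ 0 := by simpa using H.t_pow_sub_q 1

lemma q_pow_ne_t_pow (H : Independent q t) {i j : ℕ} (h : i ≠ 0 ∨ j ≠ 0) : q ^ i ≠ t⁻¹ ^ j := by
  intro h1
  refine H.mul_pow_ne_one h ?_
  rw [h1, inv_pow]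
  exact inv_mul_cancel₀ (pow_ne_zero _ H.t_ne_zero)

lemma q_pow_injective (H : Independent q t) : Function.Injective (fun i : ℕ => q ^ i) := by
  intro i j hij
  have := H.eq_zero (i - j) 0 (by
    rw [zpow_sub₀ H.q_ne_zero, zpow_natCast, zpow_natCast]
    simp only at hij
    rw [hij, div_self (pow_ne_zero _ H.q_ne_zero)]; simp)
  omega

lemma t_inv_pow_injective (H : Independent q t) : Function.Injective (fun i : ℕ => t⁻¹ ^ i) := by
  intro i j hij
  have := H.eq_zero 0 (i - j) (by
    rw [zpow_sub₀ H.t_ne_zero, zpow_natCast, zpow_natCast]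
    simp only [inv_pow, inv_inj] at hij
    rw [hij, div_self (pow_ne_zero _ H.t_ne_zero)]; simp)
  omega

end Independent

/-- The constant common to all orderings of the hook with arm `a` and leg `b`. -/
def hookConst (q t : F) (a b : ℕ) : F :=
  (∏ i ∈ Finset.range a,
      ((t - q) * (1 - q ^ (i + 1))) / ((1 - q) * (t - q ^ (i + 2)) * (1 - t))) *
    ∏ i ∈ Finset.range b,
      ((t - q) * (1 - t ^ (i + 1))) / ((1 - t) * (t ^ (i + 2) - q) * (1 - q⁻¹))

lemma hookConst_succ_left (q t : F) (a b : ℕ) : hookConst q t (a + 1) b = hookConst q t a b *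
    (((t - q) * (1 - q ^ (a + 1))) / ((1 - q) * (t - q ^ (a + 2)) * (1 - t))) := by
  rw [hookConst, hookConst, Finset.prod_range_succ]; ring

lemma hookConst_succ_right (q t : F) (a b : ℕ) : hookConst q t a (b + 1) = hookConst q t a b *
    (((t - q) * (1 - t ^ (b + 1))) / ((1 - t) * (t ^ (b + 2) - q) * (1 - q⁻¹))) := by
  rw [hookConst, hookConst, Finset.prod_range_succ (n := b)]; ring

lemma omegaVal_q_inv (q t : F) (hq : q ≠ 0) : omegaVal q t q⁻¹ = 0 := by
  simp [omegaVal, hq]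

lemma omegaVal_t (q t : F) : omegaVal q t t = 0 := by
  simp [omegaVal]

variable [DecidableEq F]

/-- The weights of the boxes of the hook with arm `a` and leg `b`. -/
def hookSet (q t : F) (a b : ℕ) : Finset F :=
  (Finset.range (a + 1)).image (fun i => q ^ i) ∪ (Finset.range (b + 1)).image (fun i => t⁻¹ ^ i)

lemma mem_hookSet {q t : F} {a b : ℕ} {x : F} :
    x ∈ hookSet q t a b ↔ (∃ i ≤ a, q ^ i = x) ∨ ∃ i ≤ b, t⁻¹ ^ i = x := by
  simp [hookSet]

lemma hookSet_succ_left (q t : F) (a b : ℕ) :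
    hookSet q t (a + 1) b = insert (q ^ (a + 1)) (hookSet q t a b) := by
  rw [hookSet, hookSet, Finset.range_add_one (n := a + 1), Finset.image_insert,
    Finset.insert_union]

lemma hookSet_succ_right (q t : F) (a b : ℕ) :
    hookSet q t a (b + 1) = insert (t⁻¹ ^ (b + 1)) (hookSet q t a b) := by
  rw [hookSet, hookSet, Finset.range_add_one (n := b + 1), Finset.image_insert,
    Finset.union_insert]

lemma q_pow_notMem_hookSet {q t : F} (H : Independent q t) (a b : ℕ) :
    q ^ (a + 1) ∉ hookSet q t a b := by
  rw [mem_hookSet]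
  rintro (⟨i, hi, h⟩ | ⟨i, hi, h⟩)
  · have := H.q_pow_injective h
    omega
  · exact H.q_pow_ne_t_pow (Or.inl (by omega)) h.symm

lemma t_pow_notMem_hookSet {q t : F} (H : Independent q t) (a b : ℕ) :
    t⁻¹ ^ (b + 1) ∉ hookSet q t a b := by
  rw [mem_hookSet]
  rintro (⟨i, hi, h⟩ | ⟨i, hi, h⟩)
  · exact H.q_pow_ne_t_pow (Or.inr (by omega)) h
  · have := H.t_inv_pow_injective h
    omega

lemma hookSet_zero_zero (q t : F) : hookSet q t 0 0 = {1} := by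
  simp [hookSet]

lemma prod_omegaVal_arm {q t : F} (H : Independent q t) (a b : ℕ) :
    ∏ y ∈ hookSet q t a b, omegaVal q t (q ^ (a + 1) / y) =
      ((t - q) * (1 - q ^ (a + 1)) * (1 - q ^ (a + 2) * t ^ b)) /
        ((1 - q) * (t - q ^ (a + 2)) * (1 - q ^ (a + 1) * t ^ b)) := by
  have hq := H.q_ne_zero
  have ht := H.t_ne_zero
  induction b with
  | zero =>
    have h0 : hookSet q t a 0 = (Finset.range (a + 1)).image (fun i => q ^ i) := by
      simp [hookSet]
      exact ⟨0, Nat.zero_le _, pow_zero _⟩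
    have h1 : ∀ n : ℕ, ∏ s ∈ Finset.range n, omegaVal q t (q ^ (s + 1)) =
        ((t - q) * (1 - q ^ (n + 1))) / ((1 - q) * (t - q ^ (n + 1))) := by
      intro n
      induction n with
      | zero =>
        have := H.one_sub_q
        have := H.t_sub_q
        simp; field_simp
      | succ n ih =>
        rw [Finset.prod_range_succ, ih, omegaVal]
        have e1 := H.one_sub_q
        have e2 := H.one_sub_q_pow (Nat.succ_ne_zero n)
        have e3 := H.t_sub_q_pow (n + 1)
        have e4 := H.t_sub_q_pow (n + 2)
        rw [show q ^ (n + 1) * q = q ^ (n + 2) by ring]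
        field_simp
    rw [h0, Finset.prod_image (fun _ _ _ _ h => H.q_pow_injective h),
      ← Finset.prod_range_reflect,
      Finset.prod_congr rfl (g := fun s => omegaVal q t (q ^ (s + 1))), h1]
    · have e1 := H.one_sub_q
      have e2 := H.one_sub_q_pow (Nat.succ_ne_zero a)
      have e4 := H.t_sub_q_pow (a + 2)
      simp only [pow_zero, mul_one]
      field_simp
    · intro s hs
      rw [Finset.mem_range] at hs
      congr 1
      rw [div_eq_iff (pow_ne_zero _ hq), ← pow_add]
      congr 1
      omega
  | succ b ih =>
    rw [hookSet_succ_right, Finset.prod_insert (t_pow_notMem_hookSet H a b), ih, omegaVal]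
    have e0 : q ^ (a + 1) / t⁻¹ ^ (b + 1) = q ^ (a + 1) * t ^ (b + 1) := by
      rw [inv_pow, div_inv_eq_mul]
    rw [e0, show q ^ (a + 1) * t ^ (b + 1) * q = q ^ (a + 2) * t ^ (b + 1) by ring,
      show t - q ^ (a + 1) * t ^ (b + 1) = t * (1 - q ^ (a + 1) * t ^ b) by ring,
      show t - q ^ (a + 2) * t ^ (b + 1) = t * (1 - q ^ (a + 2) * t ^ b) by ring]
    have e1 := H.one_sub_q
    have e2 := H.one_sub_ne (i := a + 1) (j := b) (by omega)
    have e3 := H.one_sub_ne (i := a + 2) (j := b) (by omega)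
    have e5 := H.one_sub_ne (i := a + 1) (j := b + 1) (by omega)
    have e4 := H.t_sub_q_pow (a + 2)
    field_simp

lemma prod_omegaVal_leg {q t : F} (H : Independent q t) (a b : ℕ) :
    ∏ y ∈ hookSet q t a b, omegaVal q t (t⁻¹ ^ (b + 1) / y) =
      ((t - q) * (1 - t ^ (b + 1)) * (1 - q ^ a * t ^ (b + 2))) /
        ((1 - t) * (t ^ (b + 2) - q) * (1 - q ^ a * t ^ (b + 1))) := by
  have hq := H.q_ne_zero
  have ht := H.t_ne_zero
  induction a with
  | zero =>
    have h0 : hookSet q t 0 b = (Finset.range (b + 1)).image (fun i => t⁻¹ ^ i) := by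
      simp [hookSet]
      exact ⟨0, Nat.zero_le _, pow_zero _⟩
    have h1 : ∀ n : ℕ, ∏ s ∈ Finset.range n, omegaVal q t (t⁻¹ ^ (s + 1)) =
        ((t - q) * (1 - t ^ (n + 1))) / ((1 - t) * (t ^ (n + 1) - q)) := by
      intro n
      induction n with
      | zero =>
        have := H.one_sub_t
        have := H.t_sub_q
        simp; field_simp
      | succ n ih =>
        rw [Finset.prod_range_succ, ih]
        have e1 := H.one_sub_t
        have e2 := H.one_sub_t_pow (Nat.succ_ne_zero n)
        have e3 := H.t_pow_sub_q (n + 1)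
        have e4 := H.t_pow_sub_q (n + 2)
        have e5 : t ^ (n + 1) ≠ 0 := pow_ne_zero _ ht
        have e6 : omegaVal q t (t⁻¹ ^ (n + 1)) = ((t ^ (n + 1) - q) * (1 - t ^ (n + 2))) /
            ((1 - t ^ (n + 1)) * (t ^ (n + 2) - q)) := by
          rw [omegaVal, div_eq_div_iff, inv_pow]
          · field_simp
            ring
          · rw [show (1 - t⁻¹ ^ (n + 1)) * (t - t⁻¹ ^ (n + 1) * q) =
              -((1 - t ^ (n + 1)) * (t ^ (n + 2) - q)) / (t ^ (n + 1)) ^ 2 by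
                rw [inv_pow]; field_simp; ring]
            exact div_ne_zero (neg_ne_zero.2 (mul_ne_zero e2 e4)) (pow_ne_zero _ e5)
          · exact mul_ne_zero e2 e4
        rw [e6]
        field_simp
    rw [h0, Finset.prod_image (fun _ _ _ _ h => H.t_inv_pow_injective h),
      ← Finset.prod_range_reflect,
      Finset.prod_congr rfl (g := fun s => omegaVal q t (t⁻¹ ^ (s + 1))), h1]
    · have e1 := H.one_sub_t
      have e2 := H.one_sub_t_pow (Nat.succ_ne_zero b)
      have e4 := H.t_pow_sub_q (b + 2)
      simp only [pow_zero, one_mul]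
      field_simp
    · intro s hs
      rw [Finset.mem_range] at hs
      congr 1
      rw [div_eq_iff (pow_ne_zero _ (inv_ne_zero ht)), ← pow_add]
      congr 1
      omega
  | succ a ih =>
    rw [hookSet_succ_left, Finset.prod_insert (q_pow_notMem_hookSet H a b), ih]
    have e1 := H.one_sub_t
    have e2 := H.one_sub_ne (i := a) (j := b + 1) (by omega)
    have e3 := H.one_sub_ne (i := a) (j := b + 2) (by omega)
    have e5 := H.one_sub_ne (i := a + 1) (j := b + 1) (by omega)
    have e6 := H.one_sub_ne (i := a + 1) (j := b + 2) (by omega)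
    have e4 := H.t_pow_sub_q (b + 2)
    have e7 : q ^ (a + 1) * t ^ (b + 1) ≠ 0 := mul_ne_zero (pow_ne_zero _ hq) (pow_ne_zero _ ht)
    have e8 : omegaVal q t (t⁻¹ ^ (b + 1) / q ^ (a + 1)) =
        ((1 - q ^ a * t ^ (b + 1)) * (1 - q ^ (a + 1) * t ^ (b + 2))) /
          ((1 - q ^ (a + 1) * t ^ (b + 1)) * (1 - q ^ a * t ^ (b + 2))) := by
      rw [show t⁻¹ ^ (b + 1) / q ^ (a + 1) = (q ^ (a + 1) * t ^ (b + 1))⁻¹ by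
        rw [inv_pow]; field_simp]
      set w := q ^ (a + 1) * t ^ (b + 1) with hw
      have w1 : q ^ a * t ^ (b + 1) = w / q := by rw [hw]; field_simp; ring
      have w2 : q ^ (a + 1) * t ^ (b + 2) = w * t := by rw [hw]; ring
      have w3 : q ^ a * t ^ (b + 2) = w * t / q := by rw [hw]; field_simp; ring
      rw [w3] at e3
      rw [w1, w2, w3, omegaVal]
      have k1 : 1 - w⁻¹ ≠ 0 := by
        rw [show 1 - w⁻¹ = -(1 - w) / w by field_simp; ring]
        exact div_ne_zero (neg_ne_zero.2 e5) e7
      have k2 : t - w⁻¹ * q = -(1 - w * t / q) * q / w := by field_simp; ring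
      have k3 : t - w⁻¹ * q ≠ 0 := by
        rw [k2]
        exact div_ne_zero (mul_ne_zero (neg_ne_zero.2 e3) hq) e7
      rw [div_eq_div_iff (mul_ne_zero k1 k3) (mul_ne_zero e5 e3)]
      field_simp
      ring
    rw [e8]
    field_simp

lemma prod_omegaVal_eq_zero {q t : F} (H : Independent q t) {a b : ℕ} {x : F}
    (hx : x ∈ hookSet q t a b) (h1 : a ≠ 0 → x ≠ q ^ a) (h2 : b ≠ 0 → x ≠ t⁻¹ ^ b)
    (hab : a + b ≠ 0) :
    ∏ y ∈ (hookSet q t a b).erase x, omegaVal q t (x / y) = 0 := by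
  have hq := H.q_ne_zero
  have ht := H.t_ne_zero
  have arm : ∀ i < a, x = q ^ i →
      ∏ y ∈ (hookSet q t a b).erase x, omegaVal q t (x / y) = 0 := by
    intro i hi hxi
    refine Finset.prod_eq_zero (i := q ^ (i + 1)) (Finset.mem_erase.2 ⟨?_, ?_⟩) ?_
    · rw [hxi]
      intro h
      have := H.q_pow_injective h
      omega
    · exact mem_hookSet.2 (Or.inl ⟨i + 1, hi, rfl⟩)
    · rw [hxi, show q ^ i / q ^ (i + 1) = q⁻¹ by rw [pow_succ]; field_simp,
        omegaVal_q_inv q t hq]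
  have leg : ∀ i < b, x = t⁻¹ ^ i →
      ∏ y ∈ (hookSet q t a b).erase x, omegaVal q t (x / y) = 0 := by
    intro i hi hxi
    refine Finset.prod_eq_zero (i := t⁻¹ ^ (i + 1)) (Finset.mem_erase.2 ⟨?_, ?_⟩) ?_
    · rw [hxi]
      intro h
      have := H.t_inv_pow_injective h
      omega
    · exact mem_hookSet.2 (Or.inr ⟨i + 1, hi, rfl⟩)
    · rw [hxi, show t⁻¹ ^ i / t⁻¹ ^ (i + 1) = t by
        rw [pow_succ, inv_pow]; field_simp, omegaVal_t]
  rcases mem_hookSet.1 hx with ⟨i, hi, rfl⟩ | ⟨i, hi, rfl⟩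
  · rcases hi.lt_or_eq with hlt | rfl
    · exact arm i hlt rfl
    · have hi0 : i = 0 := by
        by_contra h0
        exact h1 h0 rfl
      subst hi0
      exact leg 0 (by omega) (by simp)
  · rcases hi.lt_or_eq with hlt | rfl
    · exact leg i hlt rfl
    · have hi0 : i = 0 := by
        by_contra h0
        exact h2 h0 rfl
      subst hi0
      exact arm 0 (by omega) (by simp)

/-- One step of the recursion: the first box is the last arm box or the last leg box. -/
lemma orderSum_hookSet_step {q t : F} (H : Independent q t) (h : ℤ → ℤ) (θ : ℚ) (a b n : ℕ)
    (hn : n + 1 = a + b) (G : F → F)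
    (IHarm : ∀ a', a' + 1 = a → orderSum q t (fun j => h (j + 1) - h j) n
      (link q t (q ^ (a' + 1))) (hookSet q t a' b) =
        hookConst q t a' b / (1 - t) * armSum q t h θ a' b)
    (IHleg : ∀ b', b' + 1 = b → orderSum q t (fun j => h (j + 1) - h j) n
      (link q t (t⁻¹ ^ (b' + 1))) (hookSet q t a b') =
        hookConst q t a b' / (1 - q⁻¹) * legSum q t h θ a b') :
    orderSum q t (fun j => h (j + 1) - h j) (n + 1) G (hookSet q t a b) =
      hookConst q t a b / (1 - q ^ a * t ^ b) *
        (G (q ^ a) * (1 - q * (q ^ a * t ^ b)) * armStep q t h θ a b +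
          G (t⁻¹ ^ b) * (1 - t * (q ^ a * t ^ b)) * legStep q t h θ a b) := by
  have hq := H.q_ne_zero
  have ht := H.t_ne_zero
  have q1 := H.one_sub_q
  have t1 := H.one_sub_t
  have q2 : 1 - q⁻¹ ≠ 0 := by
    rw [show 1 - q⁻¹ = -(1 - q) / q by field_simp; ring]
    exact div_ne_zero (neg_ne_zero.2 q1) hq
  have X1 := H.one_sub_ne (i := a) (j := b) (by omega)
  rw [orderSum]
  set f : F → F := fun x => G x * x ^ (h ((n + 1 : ℕ) + 1) - h (n + 1 : ℕ)) *
    (∏ y ∈ (hookSet q t a b).erase x, omegaVal q t (x / y)) *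
    orderSum q t (fun j => h (j + 1) - h j) n (link q t x) ((hookSet q t a b).erase x) with hf
  have harm : ∀ a', a' + 1 = a → f (q ^ a) = hookConst q t a b / (1 - q ^ a * t ^ b) *
        (G (q ^ a) * (1 - q * (q ^ a * t ^ b)) * armStep q t h θ a b) := by
    rintro a' rfl
    have he : (hookSet q t (a' + 1) b).erase (q ^ (a' + 1)) = hookSet q t a' b := by
      rw [hookSet_succ_left, Finset.erase_insert (q_pow_notMem_hookSet H a' b)]
    have e4 := H.t_sub_q_pow (a' + 2)
    simp only [hf]
    rw [he, prod_omegaVal_arm H, IHarm a' rfl, armStep_succ hq,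
      show ((n + 1 : ℕ) : ℤ) + 1 = a' + b + 2 by rw [hn]; push_cast; ring,
      show ((n + 1 : ℕ) : ℤ) = a' + b + 1 by rw [hn]; push_cast; ring,
      ← zpow_natCast q (a' + 1), ← zpow_mul, zpow_natCast]
    push_cast
    rw [hookConst_succ_left, show q * (q ^ (a' + 1) * t ^ b) = q ^ (a' + 2) * t ^ b by ring]
    field_simp
  have hleg : ∀ b', b' + 1 = b → f (t⁻¹ ^ b) = hookConst q t a b / (1 - q ^ a * t ^ b) *
        (G (t⁻¹ ^ b) * (1 - t * (q ^ a * t ^ b)) * legStep q t h θ a b) := by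
    rintro b' rfl
    have he : (hookSet q t a (b' + 1)).erase (t⁻¹ ^ (b' + 1)) = hookSet q t a b' := by
      rw [hookSet_succ_right, Finset.erase_insert (t_pow_notMem_hookSet H a b')]
    have e4 := H.t_pow_sub_q (b' + 2)
    simp only [hf]
    rw [he, prod_omegaVal_leg H, IHleg b' rfl, legStep_succ q ht,
      show ((n + 1 : ℕ) : ℤ) + 1 = a + b' + 2 by rw [hn]; push_cast; ring,
      show ((n + 1 : ℕ) : ℤ) = a + b' + 1 by rw [hn]; push_cast; ring]
    have e5 : (t⁻¹ ^ (b' + 1)) ^ (h (a + b' + 2) - h (a + b' + 1)) =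
        t ^ (-(((b' : ℤ) + 1) * (h (a + b' + 2) - h (a + b' + 1)))) := by
      rw [← zpow_natCast t⁻¹ (b' + 1), ← zpow_mul, inv_zpow, ← zpow_neg]
      push_cast; rfl
    rw [e5, hookConst_succ_right, show t * (q ^ a * t ^ (b' + 1)) = q ^ a * t ^ (b' + 2) by ring]
    generalize 1 - q⁻¹ = c at q2
    generalize G (t⁻¹ ^ (b' + 1)) = g
    field_simp
  have hzero : ∀ x ∈ hookSet q t a b, (a ≠ 0 → x ≠ q ^ a) → (b ≠ 0 → x ≠ t⁻¹ ^ b) → f x = 0 := by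
    intro x hx h1 h2
    simp only [hf]
    rw [prod_omegaVal_eq_zero H hx h1 h2 (by omega)]
    ring
  have hma : q ^ a ∈ hookSet q t a b := mem_hookSet.2 (Or.inl ⟨a, le_rfl, rfl⟩)
  have hmb : t⁻¹ ^ b ∈ hookSet q t a b := mem_hookSet.2 (Or.inr ⟨b, le_rfl, rfl⟩)
  change ∑ x ∈ hookSet q t a b, f x = _
  rcases Nat.eq_zero_or_pos a with ha | ha
  · rw [Finset.sum_eq_single_of_mem _ hmb (fun x hx hne =>
      hzero x hx (fun h0 => absurd ha h0) (fun _ => hne)), hleg (b - 1) (by omega)]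
    subst ha
    rw [armStep_zero]; ring
  · rcases Nat.eq_zero_or_pos b with hb | hb
    · rw [Finset.sum_eq_single_of_mem _ hma (fun x hx hne =>
        hzero x hx (fun _ => hne) (fun h0 => absurd hb h0)), harm (a - 1) (by omega)]
      subst hb
      rw [legStep_zero]; ring
    · rw [← Finset.add_sum_erase _ _ hma, Finset.sum_eq_single_of_mem (t⁻¹ ^ b)
        (Finset.mem_erase.2 ⟨(H.q_pow_ne_t_pow (Or.inl ha.ne')).symm, hmb⟩)
        (fun x hx hne => hzero x (Finset.mem_erase.1 hx).2
          (fun _ => (Finset.mem_erase.1 hx).1) (fun _ => hne)),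
        harm (a - 1) (by omega), hleg (b - 1) (by omega)]
      ring

lemma orderSum_hookSet {q t : F} (H : Independent q t) (h : ℤ → ℤ) (θ δ : ℚ) (n : ℕ)
    (hh : ∀ i : ℤ, 1 ≤ i → i ≤ n + 1 → h i = ⌊θ * i + δ⌋)
    (hθ : ∀ s : ℤ, 1 ≤ s → s ≤ n → ∀ c : ℤ, θ * s ≠ c)
    (hψ : ∀ i : ℤ, 1 ≤ i → i ≤ n → ∀ c : ℤ, θ * i + δ ≠ c) :
    ∀ a b : ℕ, a + b = n →
    orderSum q t (fun j => h (j + 1) - h j) n (link q t (q ^ (a + 1))) (hookSet q t a b) =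
        hookConst q t a b / (1 - t) * armSum q t h θ a b ∧
    orderSum q t (fun j => h (j + 1) - h j) n (link q t (t⁻¹ ^ (b + 1))) (hookSet q t a b) =
        hookConst q t a b / (1 - q⁻¹) * legSum q t h θ a b := by
  have hq := H.q_ne_zero
  have ht := H.t_ne_zero
  have q1 := H.one_sub_q
  have t1 := H.one_sub_t
  have q2 : 1 - q⁻¹ ≠ 0 := by
    rw [show 1 - q⁻¹ = -(1 - q) / q by field_simp; ring]
    exact div_ne_zero (neg_ne_zero.2 q1) hq
  induction n with
  | zero =>
    intro a b hab
    obtain ⟨rfl, rfl⟩ : a = 0 ∧ b = 0 := by omega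
    rw [orderSum, orderSum, hookSet_zero_zero]
    simp only [Finset.sum_singleton, one_zpow, mul_one, link, hookConst, Finset.range_zero,
      Finset.prod_empty, armSum, legSum, dropSum]
    simp [ht, hq]
  | succ n ih =>
    intro a b hab
    have IH := ih (fun i h1 h2 => hh i h1 (by push_cast; omega))
      (fun s h1 h2 => hθ s h1 (by push_cast; omega)) (fun i h1 h2 => hψ i h1 (by push_cast; omega))
    have step := fun G => orderSum_hookSet_step H h θ a b n hab.symm G
      (fun a' ha' => (IH a' b (by omega)).1) (fun b' hb' => (IH a b' (by omega)).2)
    obtain ⟨r1, r2⟩ := armSum_legSum_rec hq ht h θ δ a b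
      (fun i h1 h2 => hh i h1 (by push_cast; omega))
      (fun s h1 h2 => hθ s h1 (by push_cast; omega)) (fun i h1 h2 => hψ i h1 (by push_cast; omega))
    have X0 := H.one_sub_ne (i := a) (j := b) (by omega)
    have X1 := H.one_sub_ne (i := a) (j := b + 1) (by omega)
    have X2 := H.one_sub_ne (i := a + 1) (j := b) (by omega)
    have tb : t ^ b ≠ 0 := pow_ne_zero _ ht
    have qa : q ^ a ≠ 0 := pow_ne_zero _ hq
    rw [step, step]
    have l1 : link q t (q ^ (a + 1)) (q ^ a) = (1 - t)⁻¹ := by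
      rw [link]; congr 2; rw [pow_succ]; field_simp
    have l2 : link q t (q ^ (a + 1)) (t⁻¹ ^ b) = (1 - q ^ a * t ^ (b + 1))⁻¹ := by
      rw [link]; congr 2; rw [pow_succ, pow_succ, inv_pow]; field_simp
    have l3 : link q t (t⁻¹ ^ (b + 1)) (t⁻¹ ^ b) = (1 - q⁻¹)⁻¹ := by
      rw [link]; congr 2; rw [pow_succ, inv_pow]; field_simp
    have l4 : link q t (t⁻¹ ^ (b + 1)) (q ^ a) =
        -(q ^ (a + 1) * t ^ b) * (1 - q ^ (a + 1) * t ^ b)⁻¹ := by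
      rw [link, show (t * t⁻¹ ^ (b + 1)) / (q * q ^ a) = (q ^ (a + 1) * t ^ b)⁻¹ by
        rw [pow_succ, pow_succ, inv_pow]; field_simp]
      have : q ^ (a + 1) * t ^ b ≠ 0 := mul_ne_zero (pow_ne_zero _ hq) tb
      rw [show 1 - (q ^ (a + 1) * t ^ b)⁻¹ =
        -(1 - q ^ (a + 1) * t ^ b) / (q ^ (a + 1) * t ^ b) by field_simp; ring]
      rw [inv_div, div_neg, neg_mul, div_eq_mul_inv]
    rw [l1, l2, l3, l4, show t * (q ^ a * t ^ b) = q ^ a * t ^ (b + 1) by ring,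
      show q * (q ^ a * t ^ b) = q ^ (a + 1) * t ^ b by ring]
    rw [show t * (q ^ a * t ^ b) = q ^ a * t ^ (b + 1) by ring] at r2
    rw [show q * (q ^ a * t ^ b) = q ^ (a + 1) * t ^ b by ring] at r1
    constructor
    · have r1' : armSum q t h θ a b = ((1 - q ^ (a + 1) * t ^ b) * armStep q t h θ a b +
          (1 - t) * legStep q t h θ a b) / (1 - q ^ a * t ^ b) := by
        rw [eq_div_iff X0, ← r1]; ring
      rw [r1']
      field_simp
    · have r2' : legSum q t h θ a b = ((1 - q ^ a * t ^ (b + 1)) * legStep q t h θ a b +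
          q ^ a * t ^ b * (1 - q) * armStep q t h θ a b) / (1 - q ^ a * t ^ b) := by
        rw [eq_div_iff X0, ← r2]; ring
      rw [mul_assoc (-(q ^ (a + 1) * t ^ b)), inv_mul_cancel₀ X2, mul_one, r2', show 1 - q⁻¹ = -(1 - q) / q by field_simp; ring]
      field_simp
      ring

/-- The total hook sum. The last value of `h` may be arbitrary. -/
lemma orderSum_hookSet_total {q t : F} (H : Independent q t) (h : ℤ → ℤ) (θ δ : ℚ) (a b : ℕ)
    (hh : ∀ i : ℤ, 1 ≤ i → i ≤ a + b → h i = ⌊θ * i + δ⌋)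
    (hθ : ∀ s : ℤ, 1 ≤ s → s ≤ a + b → ∀ c : ℤ, θ * s ≠ c)
    (hψ : ∀ i : ℤ, 1 ≤ i → i ≤ a + b → ∀ c : ℤ, θ * i + δ ≠ c) (hab : a + b ≠ 0) :
    orderSum q t (fun j => h (j + 1) - h j) (a + b) (fun _ => 1) (hookSet q t a b) =
      hookConst q t a b / (1 - q ^ a * t ^ b) *
        ((1 - q * (q ^ a * t ^ b)) * armStep q t h θ a b +
          (1 - t * (q ^ a * t ^ b)) * legStep q t h θ a b) := by
  obtain ⟨n, hn⟩ := Nat.exists_eq_succ_of_ne_zero hab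
  have IH := orderSum_hookSet H h θ δ n (fun i h1 h2 => hh i h1 (by omega))
      (fun s h1 h2 => hθ s h1 (by omega)) (fun i h1 h2 => hψ i h1 (by omega))
  rw [hn, Nat.succ_eq_add_one, orderSum_hookSet_step H h θ a b n hn.symm _
      (fun a' ha' => (IH a' b (by omega)).1) (fun b' hb' => (IH a b' (by omega)).2),
    one_mul, one_mul]

end Hook

section Cluster

variable {F : Type*} [Field F]

lemma sum_ratio_pow {q t : F} (hq : q ≠ 0) (hqt : q - t ≠ 0) (n : ℕ) :
    ∑ i ∈ Finset.range n, (t / q) ^ i = (1 - t ^ n * q⁻¹ ^ n) * q / (q - t) := by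
  induction n with
  | zero => simp
  | succ n ih =>
    rw [Finset.sum_range_succ, ih, div_pow, inv_pow, inv_pow, pow_succ, pow_succ]
    field_simp
    ring

lemma sum_ratio_pow_Ico {q t : F} (hq : q ≠ 0) (hqt : q - t ≠ 0) (c n : ℕ) :
    ∑ i ∈ Finset.range n, (t / q) ^ (c + i) =
      t ^ c * q⁻¹ ^ c * ((1 - t ^ n * q⁻¹ ^ n) * q / (q - t)) := by
  simp only [pow_add]
  rw [← Finset.mul_sum, sum_ratio_pow hq hqt, div_pow, inv_pow, inv_pow, div_eq_mul_inv]

lemma sum_pow' {q : F} (hq : 1 - q ≠ 0) (n : ℕ) :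
    ∑ i ∈ Finset.range n, q ^ i = (1 - q ^ n) / (1 - q) := by
  induction n with
  | zero => simp
  | succ n ih =>
    rw [Finset.sum_range_succ, ih, pow_succ]
    field_simp
    ring

lemma sum_inv_pow {q : F} (hq : q ≠ 0) (hq1 : 1 - q ≠ 0) (n : ℕ) :
    ∑ i ∈ Finset.range n, q⁻¹ ^ i = q * (q⁻¹ ^ n - 1) / (1 - q) := by
  induction n with
  | zero => simp
  | succ n ih =>
    rw [Finset.sum_range_succ, ih, pow_succ]
    field_simp
    ring

/-- The `k`-fold sum `∑_{u < k} ∑_{i < u} tⁱ q⁻ᵘ`. -/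
def triangleSum (q t : F) (k : ℕ) : F :=
  ∑ u ∈ Finset.range k, ∑ i ∈ Finset.range u, t ^ i * q⁻¹ ^ u

/-- The product `q^{1-k} [k]_q [k]_t`. -/
def squareSum (q t : F) (k : ℕ) : F :=
  q * q⁻¹ ^ k * (∑ i ∈ Finset.range k, q ^ i) * ∑ i ∈ Finset.range k, t ^ i

lemma triangleSum_eq {q t : F} (H : Independent q t) (k : ℕ) :
    triangleSum q t k = (q * (q⁻¹ ^ k - 1) / (1 - q) -
      (1 - t ^ k * q⁻¹ ^ k) * q / (q - t)) / (1 - t) := by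
  have hqt : q - t ≠ 0 := by
    have := H.t_sub_q
    rwa [← neg_sub, neg_ne_zero]
  have t1 := H.one_sub_t
  rw [← sum_inv_pow H.q_ne_zero H.one_sub_q, ← sum_ratio_pow H.q_ne_zero hqt,
    ← Finset.sum_sub_distrib, Finset.sum_div, triangleSum]
  refine Finset.sum_congr rfl fun u _ => ?_
  rw [← Finset.sum_mul, sum_pow' t1, div_pow, inv_pow]
  field_simp

/-- The arm terms of a cluster, for fixed `r`. -/
lemma sum_cluster_arm {q t : F} (H : Independent q t) (r l d : ℕ) :
    ∑ i ∈ Finset.range (r + (l + d)), (t / q) ^ i * (q ^ r * t ^ (l - (i - r))) =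
      t ^ l * (q * (q ^ r - t ^ r) / (q - t)) + t ^ r * (t ^ l * (q * (q⁻¹ ^ l - 1) / (1 - q))) +
        (t ^ r * t ^ l * q⁻¹ ^ l * q / (q - t) - t ^ r * t ^ l * t ^ d * q⁻¹ ^ l * q⁻¹ ^ d * q / (q - t)) := by
  have hqt : q - t ≠ 0 := by
    have := H.t_sub_q
    rwa [← neg_sub, neg_ne_zero]
  have hq := H.q_ne_zero
  have ht := H.t_ne_zero
  have qr : q ^ r ≠ 0 := pow_ne_zero _ hq
  rw [Finset.sum_range_add, Finset.sum_range_add, ← add_assoc]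
  congr 1
  · congr 1
    · rw [Finset.sum_congr rfl (g := fun i => (t / q) ^ i * (q ^ r * t ^ l)) (fun i hi => by
        rw [Finset.mem_range] at hi
        rw [show l - (i - r) = l by omega]), ← Finset.sum_mul, sum_ratio_pow hq hqt, inv_pow]
      field_simp
    · rw [← sum_inv_pow hq H.one_sub_q, Finset.mul_sum, Finset.mul_sum]
      refine Finset.sum_congr rfl fun c hc => ?_
      rw [Finset.mem_range] at hc
      rw [Nat.add_sub_cancel_left, div_pow, inv_pow, pow_add, pow_add,
        show t ^ l = t ^ (l - c) * t ^ c by rw [← pow_add]; congr 1; omega]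
      field_simp
  · rw [Finset.sum_congr rfl (g := fun i => (t / q) ^ (r + l + i) * (q ^ r)) (fun i hi => by
        rw [show l - (r + (l + i) - r) = 0 by omega, pow_zero, mul_one, add_assoc]),
      ← Finset.sum_mul, sum_ratio_pow_Ico hq hqt]
    rw [pow_add, pow_add, inv_pow, inv_pow, inv_pow]
    field_simp

/-- The leg terms of a cluster, for fixed `y`. -/
lemma sum_cluster_leg {q t : F} (H : Independent q t) (y κ d : ℕ) :
    ∑ i ∈ Finset.range (y + (κ + d)), (t / q) ^ i * (q ^ (min κ (i - y))) =
      (1 - t ^ y * q⁻¹ ^ y) * q / (q - t) + t ^ y * q⁻¹ ^ y * ((1 - t ^ κ) / (1 - t)) +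
        t ^ y * t ^ κ * q⁻¹ ^ y * ((1 - t ^ d * q⁻¹ ^ d) * q / (q - t)) := by
  have hqt : q - t ≠ 0 := by
    have := H.t_sub_q
    rwa [← neg_sub, neg_ne_zero]
  have hq := H.q_ne_zero
  have ht := H.t_ne_zero
  rw [Finset.sum_range_add, Finset.sum_range_add, ← add_assoc]
  congr 1
  · congr 1
    · rw [← sum_ratio_pow hq hqt]
      refine Finset.sum_congr rfl fun i hi => ?_
      rw [Finset.mem_range] at hi
      rw [show min κ (i - y) = 0 by omega, pow_zero, mul_one]
    · rw [← sum_pow' H.one_sub_t, Finset.mul_sum]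
      refine Finset.sum_congr rfl fun c hc => ?_
      rw [Finset.mem_range] at hc
      rw [show min κ (y + c - y) = c by omega, div_pow, pow_add, pow_add, inv_pow]
      field_simp
  · rw [Finset.sum_congr rfl (g := fun i => (t / q) ^ (y + κ + i) * (q ^ κ)) (fun i hi => by
        rw [show min κ (y + (κ + i) - y) = κ by omega, add_assoc]),
      ← Finset.sum_mul, sum_ratio_pow_Ico hq hqt]
    rw [pow_add, pow_add, inv_pow, inv_pow, inv_pow]
    field_simp

lemma cluster_arm_eq {q t : F} (H : Independent q t) (κ l : ℕ) :
    ∑ i ∈ Finset.range (κ + l), (t / q) ^ i * ∑ r ∈ Finset.range κ, q ^ r * t ^ (l - (i - r)) =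
      t ^ l * q / (q - t) * ((1 - q ^ κ) / (1 - q) - (1 - t ^ κ) / (1 - t)) +
        t ^ l * (q * (q⁻¹ ^ l - 1) / (1 - q)) * ((1 - t ^ κ) / (1 - t)) +
        q / (q - t) * (t ^ l * q⁻¹ ^ l * ((1 - t ^ κ) / (1 - t)) -
          t ^ l * t ^ κ * q⁻¹ ^ l * q⁻¹ ^ κ * ((1 - q ^ κ) / (1 - q))) := by
  have hq := H.q_ne_zero
  have ht := H.t_ne_zero
  simp only [Finset.mul_sum]
  rw [Finset.sum_comm, Finset.sum_congr rfl (g := fun r => t ^ l * q / (q - t) * (q ^ r - t ^ r) +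
    t ^ l * (q * (q⁻¹ ^ l - 1) / (1 - q)) * t ^ r +
    q / (q - t) * (t ^ l * q⁻¹ ^ l * t ^ r - t ^ l * t ^ κ * q⁻¹ ^ l * q⁻¹ ^ κ * q ^ r))]
  · simp only [Finset.sum_add_distrib, ← Finset.mul_sum, Finset.sum_sub_distrib,
      sum_pow' H.one_sub_q, sum_pow' H.one_sub_t]
  · intro r hr
    rw [Finset.mem_range] at hr
    obtain ⟨d, rfl⟩ := Nat.exists_eq_add_of_lt hr
    rw [show r + d + 1 + l = r + (l + (d + 1)) by ring, sum_cluster_arm H]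
    have e1 : q⁻¹ ^ (r + d + 1) * q ^ r = q⁻¹ ^ (d + 1) := by
      rw [show r + d + 1 = (d + 1) + r by ring, pow_add, mul_assoc, ← mul_pow,
        inv_mul_cancel₀ hq, one_pow, mul_one]
    have e2 : t ^ (r + d + 1) = t ^ r * t ^ (d + 1) := by rw [← pow_add]; congr 1
    rw [mul_assoc _ (q⁻¹ ^ (r + d + 1)) (q ^ r), e1, e2]
    ring

lemma cluster_leg_eq {q t : F} (H : Independent q t) (κ l : ℕ) :
    ∑ i ∈ Finset.range (κ + l), (t / q) ^ i *
      ∑ y ∈ Finset.range l, t ^ (l - 1 - y) * q ^ (min κ (i - y)) =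
      q / (q - t) * ((1 - t ^ l) / (1 - t) - t ^ l * t⁻¹ * (q * (q⁻¹ ^ l - 1) / (1 - q))) +
        t ^ l * t⁻¹ * (q * (q⁻¹ ^ l - 1) / (1 - q)) * ((1 - t ^ κ) / (1 - t)) +
        q / (q - t) * (t ^ κ * t ^ l * t⁻¹ * (q * (q⁻¹ ^ l - 1) / (1 - q)) -
          t ^ κ * t ^ l * q⁻¹ ^ l * ((1 - t ^ l) / (1 - t))) := by
  have hq := H.q_ne_zero
  have ht := H.t_ne_zero
  simp only [Finset.mul_sum]
  have key : ∀ y ∈ Finset.range l, ∑ i ∈ Finset.range (κ + l),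
      (t / q) ^ i * (t ^ (l - 1 - y) * q ^ (min κ (i - y))) =
      q / (q - t) * (t ^ (l - 1 - y) - t ^ l * t⁻¹ * q⁻¹ ^ y) +
        t ^ l * t⁻¹ * q⁻¹ ^ y * ((1 - t ^ κ) / (1 - t)) +
        q / (q - t) * (t ^ κ * t ^ l * t⁻¹ * q⁻¹ ^ y -
          t ^ κ * t ^ l * q⁻¹ ^ l * t ^ (l - 1 - y)) := by
    intro y hy
    rw [Finset.mem_range] at hy
    obtain ⟨d, rfl⟩ := Nat.exists_eq_add_of_lt hy
    have e0 : ∀ i, (t / q) ^ i * (t ^ (y + d + 1 - 1 - y) * q ^ (min κ (i - y))) =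
        t ^ d * ((t / q) ^ i * q ^ (min κ (i - y))) := by
      intro i
      rw [show y + d + 1 - 1 - y = d by omega]; ring
    simp only [e0]
    rw [← Finset.mul_sum, show κ + (y + d + 1) = y + (κ + (d + 1)) by ring, sum_cluster_leg H,
      show y + d + 1 - 1 - y = d by omega]
    simp only [inv_pow, pow_add, pow_one]
    field_simp
  rw [Finset.sum_comm, Finset.sum_congr rfl key]
  simp only [Finset.sum_add_distrib, ← Finset.mul_sum, Finset.sum_sub_distrib, ← Finset.sum_mul,
    Finset.sum_range_reflect (fun i => t ^ i), sum_pow' H.one_sub_t, sum_inv_pow hq H.one_sub_q]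

/-- The contribution of a full cluster of `κ` arm points and `l` leg points. -/
lemma cluster_identity {q t : F} (H : Independent q t) (κ l : ℕ) (X : F) :
    (1 - q * X) * ∑ i ∈ Finset.range (κ + l), (t / q) ^ i *
        ∑ r ∈ Finset.range κ, q ^ r * t ^ (l - (i - r)) +
      (1 - t * X) * ∑ i ∈ Finset.range (κ + l), (t / q) ^ i *
        ∑ y ∈ Finset.range l, t ^ (l - 1 - y) * q ^ (min κ (i - y)) =
    (1 - X) * squareSum q t (κ + l) + (q ^ κ * t ^ l - 1) *
      ((1 - X) * triangleSum q t (κ + l) - X * ∑ i ∈ Finset.range (κ + l), (t / q) ^ i) := by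
  have hqt : q - t ≠ 0 := by
    have := H.t_sub_q
    rwa [← neg_sub, neg_ne_zero]
  have hq := H.q_ne_zero
  have ht := H.t_ne_zero
  have q1 := H.one_sub_q
  have t1 := H.one_sub_t
  rw [cluster_arm_eq H, cluster_leg_eq H, triangleSum_eq H, squareSum, sum_ratio_pow hq hqt,
    sum_pow' q1, sum_pow' t1]
  simp only [pow_add, inv_pow]
  have h1 : q ^ κ ≠ 0 := pow_ne_zero _ hq
  have h2 : q ^ l ≠ 0 := pow_ne_zero _ hq
  generalize q ^ κ = Q1 at *
  generalize q ^ l = Q2 at *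
  generalize t ^ κ = T1 at *
  generalize t ^ l = T2 at *
  field_simp
  ring

lemma broken_cluster_arm_eq {q t : F} (H : Independent q t) (κ l : ℕ) (X : F) :
    ∑ i ∈ Finset.range (κ + l + 1), (t / q) ^ i * ∑ r ∈ Finset.range κ,
        (if r + 1 ≤ i then X else 1) * (q ^ r * t ^ (l - (i - (r + 1)))) =
      t ^ l / (q - t) * (q * ((1 - q ^ κ) / (1 - q)) - t * ((1 - t ^ κ) / (1 - t))) +
        X * t * q⁻¹ * (t ^ l * (q * (q⁻¹ ^ l - 1) / (1 - q)) + q / (q - t) * (t ^ l * q⁻¹ ^ l)) *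
          ((1 - t ^ κ) / (1 - t)) -
        X * t / (q - t) * (t ^ l * t ^ κ * q⁻¹ ^ l * q⁻¹ ^ κ) * ((1 - q ^ κ) / (1 - q)) := by
  have hqt : q - t ≠ 0 := by
    have := H.t_sub_q
    rwa [← neg_sub, neg_ne_zero]
  have hq := H.q_ne_zero
  have ht := H.t_ne_zero
  have q1 := H.one_sub_q
  simp only [Finset.mul_sum]
  have key : ∀ r ∈ Finset.range κ, ∑ i ∈ Finset.range (κ + l + 1),
      (t / q) ^ i * ((if r + 1 ≤ i then X else 1) * (q ^ r * t ^ (l - (i - (r + 1))))) =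
      t ^ l / (q - t) * (q * q ^ r - t * t ^ r) +
        X * t * q⁻¹ * (t ^ l * (q * (q⁻¹ ^ l - 1) / (1 - q)) + q / (q - t) * (t ^ l * q⁻¹ ^ l)) *
          t ^ r -
        X * t / (q - t) * (t ^ l * t ^ κ * q⁻¹ ^ l * q⁻¹ ^ κ) * q ^ r := by
    intro r hr
    rw [Finset.mem_range] at hr
    obtain ⟨d, rfl⟩ := Nat.exists_eq_add_of_lt hr
    rw [show r + d + 1 + l + 1 = (r + 1) + (0 + (l + (d + 1))) by ring, Finset.sum_range_add]
    have h1 : ∑ i ∈ Finset.range (r + 1),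
        (t / q) ^ i * ((if r + 1 ≤ i then X else 1) * (q ^ r * t ^ (l - (i - (r + 1))))) =
        (1 - t ^ (r + 1) * q⁻¹ ^ (r + 1)) * q / (q - t) * (q ^ r * t ^ l) := by
      rw [← sum_ratio_pow hq hqt, Finset.sum_mul]
      refine Finset.sum_congr rfl fun i hi => ?_
      rw [Finset.mem_range] at hi
      rw [if_neg (by omega), one_mul, show l - (i - (r + 1)) = l by omega]
    have h2 : ∑ i ∈ Finset.range (0 + (l + (d + 1))), (t / q) ^ (r + 1 + i) *
        ((if r + 1 ≤ r + 1 + i then X else 1) * (q ^ r * t ^ (l - (r + 1 + i - (r + 1))))) =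
        X * (t / q) ^ (r + 1) * q ^ r * ∑ i ∈ Finset.range (0 + (l + (d + 1))),
          (t / q) ^ i * (q ^ 0 * t ^ (l - (i - 0))) := by
      rw [Finset.mul_sum]
      refine Finset.sum_congr rfl fun i _ => ?_
      rw [if_pos (by omega), Nat.add_sub_cancel_left, pow_add, Nat.sub_zero]
      ring
    rw [h1, h2, sum_cluster_arm H]
    simp only [inv_pow, pow_add, pow_one, div_pow, pow_zero, sub_self]
    field_simp
    ring
  rw [Finset.sum_comm, Finset.sum_congr rfl key]
  simp only [Finset.sum_add_distrib, ← Finset.mul_sum, Finset.sum_sub_distrib,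
      sum_pow' H.one_sub_q, sum_pow' H.one_sub_t]

lemma broken_cluster_leg_eq {q t : F} (H : Independent q t) (κ l : ℕ) (X : F) :
    ∑ i ∈ Finset.range (κ + l + 1), (t / q) ^ i * ∑ y ∈ Finset.range l,
        (if y + 1 ≤ i then 1 else X) * (t ^ (l - 1 - y) * q ^ (min κ (i - (y + 1)))) =
      X * q / (q - t) * ((1 - t ^ l) / (1 - t) - t ^ l * q⁻¹ * (q * (q⁻¹ ^ l - 1) / (1 - q))) +
        t ^ l * q⁻¹ * ((1 - t ^ κ) / (1 - t) + t ^ κ * q / (q - t)) *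
          (q * (q⁻¹ ^ l - 1) / (1 - q)) -
        t / (q - t) * (t ^ κ * t ^ l * q⁻¹ ^ l) * ((1 - t ^ l) / (1 - t)) := by
  have hqt : q - t ≠ 0 := by
    have := H.t_sub_q
    rwa [← neg_sub, neg_ne_zero]
  have hq := H.q_ne_zero
  have ht := H.t_ne_zero
  have t1 := H.one_sub_t
  simp only [Finset.mul_sum]
  have key : ∀ y ∈ Finset.range l, ∑ i ∈ Finset.range (κ + l + 1), (t / q) ^ i *
        ((if y + 1 ≤ i then 1 else X) * (t ^ (l - 1 - y) * q ^ (min κ (i - (y + 1))))) =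
      X * q / (q - t) * (t ^ (l - 1 - y) - t ^ l * q⁻¹ * q⁻¹ ^ y) +
        t ^ l * q⁻¹ * ((1 - t ^ κ) / (1 - t) + t ^ κ * q / (q - t)) * q⁻¹ ^ y -
        t / (q - t) * (t ^ κ * t ^ l * q⁻¹ ^ l) * t ^ (l - 1 - y) := by
    intro y hy
    rw [Finset.mem_range] at hy
    obtain ⟨d, rfl⟩ := Nat.exists_eq_add_of_lt hy
    rw [show y + d + 1 - 1 - y = d by omega,
      show κ + (y + d + 1) + 1 = (y + 1) + (0 + (κ + (d + 1))) by ring, Finset.sum_range_add]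
    have h1 : ∑ i ∈ Finset.range (y + 1),
        (t / q) ^ i * ((if y + 1 ≤ i then 1 else X) * (t ^ d * q ^ (min κ (i - (y + 1))))) =
        (1 - t ^ (y + 1) * q⁻¹ ^ (y + 1)) * q / (q - t) * (X * t ^ d) := by
      rw [← sum_ratio_pow hq hqt, Finset.sum_mul]
      refine Finset.sum_congr rfl fun i hi => ?_
      rw [Finset.mem_range] at hi
      rw [if_neg (by omega), show min κ (i - (y + 1)) = 0 by omega, pow_zero, mul_one]
    have h2 : ∑ i ∈ Finset.range (0 + (κ + (d + 1))), (t / q) ^ (y + 1 + i) *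
        ((if y + 1 ≤ y + 1 + i then 1 else X) *
          (t ^ d * q ^ (min κ (y + 1 + i - (y + 1))))) =
        (t / q) ^ (y + 1) * t ^ d * ∑ i ∈ Finset.range (0 + (κ + (d + 1))),
          (t / q) ^ i * q ^ (min κ (i - 0)) := by
      rw [Finset.mul_sum]
      refine Finset.sum_congr rfl fun i _ => ?_
      rw [if_pos (by omega), Nat.add_sub_cancel_left, pow_add, Nat.sub_zero]
      ring
    rw [h1, h2, sum_cluster_leg H]
    simp only [inv_pow, pow_add, pow_one, div_pow, pow_zero, mul_one, sub_self]
    field_simp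
    ring
  rw [Finset.sum_comm, Finset.sum_congr rfl key]
  simp only [Finset.sum_add_distrib, ← Finset.mul_sum, Finset.sum_sub_distrib,
    Finset.sum_range_reflect (fun i => t ^ i), sum_pow' H.one_sub_t, sum_inv_pow hq H.one_sub_q]

/-- The contribution of the cluster that is cut by the period. -/
lemma broken_cluster_identity {q t : F} (H : Independent q t) (κ l : ℕ) (X : F) :
    (1 - q * X) * ∑ i ∈ Finset.range (κ + l + 1), (t / q) ^ i * ∑ r ∈ Finset.range κ,
        (if r + 1 ≤ i then X else 1) * (q ^ r * t ^ (l - (i - (r + 1)))) +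
      (1 - t * X) * ∑ i ∈ Finset.range (κ + l + 1), (t / q) ^ i * ∑ y ∈ Finset.range l,
        (if y + 1 ≤ i then 1 else X) * (t ^ (l - 1 - y) * q ^ (min κ (i - (y + 1)))) =
    (1 - X) * squareSum q t (κ + l + 1) * X -
      ((1 - X) * triangleSum q t (κ + l + 1) -
        X * ∑ i ∈ Finset.range (κ + l + 1), (t / q) ^ i) * (X - q ^ κ * t ^ l) := by
  have hqt : q - t ≠ 0 := by
    have := H.t_sub_q
    rwa [← neg_sub, neg_ne_zero]
  have hq := H.q_ne_zero
  have ht := H.t_ne_zero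
  have q1 := H.one_sub_q
  have t1 := H.one_sub_t
  rw [broken_cluster_arm_eq H, broken_cluster_leg_eq H, triangleSum_eq H, squareSum,
    sum_ratio_pow hq hqt, sum_pow' q1, sum_pow' t1]
  simp only [pow_add, pow_one, inv_pow]
  have h1 : q ^ κ ≠ 0 := pow_ne_zero _ hq
  have h2 : q ^ l ≠ 0 := pow_ne_zero _ hq
  generalize q ^ κ = Q1 at *
  generalize q ^ l = Q2 at *
  generalize t ^ κ = T1 at *
  generalize t ^ l = T2 at *
  field_simp
  ring

end Cluster

section Arithmetic

lemma lt_residue_count {n a c r : ℕ} (hn : 0 < n) (hc : c < n) :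
    r < (a + n - 1 - c) / n ↔ c + n * r < a := by
  rw [← Nat.succ_le_iff, Nat.le_div_iff_mul_le hn, Nat.succ_eq_add_one, add_mul, one_mul,
    mul_comm r n]
  omega

lemma sum_range_by_residue {R : Type*} [AddCommMonoid R] {n : ℕ} (hn : 0 < n) (a : ℕ)
    (f : ℕ → R) :
    ∑ j ∈ Finset.range a, f j =
      ∑ c ∈ Finset.range n, ∑ r ∈ Finset.range ((a + n - 1 - c) / n), f (c + n * r) := by
  rw [Finset.sum_sigma']
  refine Finset.sum_nbij' (fun j => ⟨j % n, j / n⟩) (fun p => p.1 + n * p.2) ?_ ?_ ?_ ?_ ?_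
  · intro j hj
    rw [Finset.mem_range] at hj
    simp only [Finset.mem_sigma, Finset.mem_range]
    refine ⟨Nat.mod_lt _ hn, ?_⟩
    rw [lt_residue_count hn (Nat.mod_lt _ hn), Nat.mod_add_div]
    exact hj
  · rintro ⟨c, r⟩ h
    simp only [Finset.mem_sigma, Finset.mem_range] at h ⊢
    exact (lt_residue_count hn h.1).1 h.2
  · intro j _
    exact Nat.mod_add_div j n
  · rintro ⟨c, r⟩ h
    simp only [Finset.mem_sigma, Finset.mem_range] at h
    have h1 : (c + n * r) % n = c := by rw [Nat.add_mul_mod_self_left, Nat.mod_eq_of_lt h.1]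
    have h2 : (c + n * r) / n = r := by
      rw [Nat.add_mul_div_left _ _ hn, Nat.div_eq_of_lt h.1, zero_add]
    simp [h1, h2]
  · intro j _
    rw [Nat.mod_add_div]

lemma sum_range_of_residue {R : Type*} [AddCommMonoid R] {n c : ℕ} (hc : c < n) (b : ℕ)
    (g : ℕ → R) (hg : ∀ v, v % n ≠ c → g v = 0) :
    ∑ v ∈ Finset.range b, g v = ∑ r ∈ Finset.range ((b + n - 1 - c) / n), g (c + n * r) := by
  rw [sum_range_by_residue (n := n) (by omega) b g, Finset.sum_eq_single_of_mem c (Finset.mem_range.2 hc)]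
  intro c' hc' hne
  refine Finset.sum_eq_zero fun r _ => hg _ ?_
  rw [Nat.add_mul_mod_self_left, Nat.mod_eq_of_lt (Finset.mem_range.1 hc')]
  exact hne

lemma sum_range_ite_lt (R x : ℕ) :
    ∑ r ∈ Finset.range R, (if r < x then 1 else 0 : ℤ) = (min R x : ℕ) := by
  induction R with
  | zero => simp
  | succ R ih =>
    rw [Finset.sum_range_succ, ih]
    split_ifs <;> omega

lemma sum_range_ite_le (R x : ℕ) :
    ∑ r ∈ Finset.range R, (if x ≤ r then 1 else 0 : ℤ) = (R - x : ℕ) := by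
  induction R with
  | zero => simp
  | succ R ih =>
    rw [Finset.sum_range_succ, ih]
    split_ifs <;> omega

lemma ediv_eq_sub_one_ediv {n : ℕ} (hn : 0 < n) (y : ℤ) :
    y / n = (y - 1) / n + if (n : ℤ) ∣ y then 1 else 0 := by
  have hn' : (0 : ℤ) < n := by exact_mod_cast hn
  have h0 := Int.emod_nonneg (y - 1) hn'.ne'
  have h1 := Int.emod_lt_of_pos (y - 1) hn'
  have h2 := Int.emod_add_mul_ediv (y - 1) n
  split_ifs with h
  · obtain ⟨d, rfl⟩ := h
    rw [Int.mul_ediv_cancel_left _ hn'.ne',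
      show (n : ℤ) * d - 1 = (n - 1) + n * (d - 1) by ring, Int.add_mul_ediv_left _ _ hn'.ne',
      Int.ediv_eq_zero_of_lt (by omega) (by omega)]
    ring
  · have h3 : (y - 1) % n + 1 ≠ n := by
      intro h4
      apply h
      exact ⟨(y - 1) / n + 1, by linear_combination -h2 + h4⟩
    rw [show y = ((y - 1) % n + 1) + n * ((y - 1) / n) by linear_combination -h2,
      Int.add_mul_ediv_left _ _ hn'.ne', Int.ediv_eq_zero_of_lt (by omega) (by omega)]
    rw [show ((y - 1) % n + 1) + n * ((y - 1) / n) - 1 = y - 1 by linear_combination h2]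
    ring

lemma neg_ediv_eq {n : ℕ} (hn : 0 < n) (y : ℤ) : (-y) / n = -((y - 1) / n) - 1 := by
  have hn' : (0 : ℤ) < n := by exact_mod_cast hn
  have h0 := Int.emod_nonneg (y - 1) hn'.ne'
  have h1 := Int.emod_lt_of_pos (y - 1) hn'
  have h2 := Int.emod_add_mul_ediv (y - 1) n
  rw [show -y = (n - 1 - (y - 1) % n) + n * (-((y - 1) / n) - 1) by linear_combination h2,
    Int.add_mul_ediv_left _ _ hn'.ne', Int.ediv_eq_zero_of_lt (by omega) (by omega), zero_add]

lemma floor_div_add_pos {n : ℕ} (hn : 0 < n) (x : ℤ) {η : ℚ} (h0 : 0 ≤ η) (h1 : η * n < 1) :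
    ⌊(x : ℚ) / n + η⌋ = x / n := by
  have hn' : (0 : ℤ) < n := by exact_mod_cast hn
  have hnq : (0 : ℚ) < n := by exact_mod_cast hn
  have e0 := Int.emod_nonneg x hn'.ne'
  have e1 := Int.emod_lt_of_pos x hn'
  have e2 := Int.emod_add_mul_ediv x n
  have e3 : (x : ℚ) = (x % n : ℤ) + n * (x / n : ℤ) := by exact_mod_cast e2.symm
  have e4 : ((x % n : ℤ) : ℚ) + 1 ≤ n := by exact_mod_cast e1
  have e5 : (0 : ℚ) ≤ (x % n : ℤ) := by exact_mod_cast e0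
  have e6 : (x : ℚ) / n + η = (x / n : ℤ) + ((x % n : ℤ) + η * n) / n := by
    rw [e3]; field_simp; ring
  rw [e6, Int.floor_eq_iff]
  constructor
  · have : 0 ≤ (((x % n : ℤ) : ℚ) + η * n) / n := by positivity
    linarith
  · have : (((x % n : ℤ) : ℚ) + η * n) / n < 1 := by rw [div_lt_one hnq]; linarith
    linarith

lemma div_add_ne_int {n : ℕ} (hn : 0 < n) (x : ℤ) {η : ℚ} (h0 : η ≠ 0) (h1 : |η * n| < 1)
    (c : ℤ) : (x : ℚ) / n + η ≠ c := by
  have hnq : (0 : ℚ) < n := by exact_mod_cast hn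
  intro h
  have h2 : η * n = ((c * n - x : ℤ) : ℚ) := by
    push_cast
    rw [← h]; field_simp; ring
  rw [h2, ← Int.cast_abs] at h1
  have h3 : |c * (n : ℤ) - x| < 1 := by exact_mod_cast h1
  rw [Int.abs_lt_one_iff] at h3
  rw [h3, Int.cast_zero] at h2
  rcases mul_eq_zero.1 h2 with h4 | h4
  · exact h0 h4
  · exact hnq.ne' h4

lemma floor_div_add_neg {n : ℕ} (hn : 0 < n) (x : ℤ) {η : ℚ} (h0 : η < 0) (h1 : -1 < η * n) :
    ⌊(x : ℚ) / n + η⌋ = x / n - if (n : ℤ) ∣ x then 1 else 0 := by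
  have hnq : (0 : ℚ) < n := by exact_mod_cast hn
  have : (x : ℚ) / n + η = ((x - 1 : ℤ) : ℚ) / n + (1 / n + η) := by push_cast; field_simp; ring
  rw [this, floor_div_add_pos hn, ediv_eq_sub_one_ediv hn x]
  · ring
  · have : 0 ≤ (1 + η * n) / n := div_nonneg (by linarith) hnq.le
    calc (0 : ℚ) ≤ (1 + η * n) / n := this
      _ = 1 / n + η := by field_simp
  · rw [add_mul, one_div, inv_mul_cancel₀ hnq.ne']
    have := mul_neg_of_neg_of_pos h0 hnq
    linarith

/-- The heights of the lattice path below the line of slope `m / n`, read backwards, with the last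
`i₀` inner lattice points of the line moved down. -/
def height (k n : ℕ) (m : ℤ) (i₀ : ℕ) (i : ℤ) : ℤ :=
  m * i / n - if (n : ℤ) ∣ i ∧ ((k : ℤ) - i₀) * n ≤ i ∧ i < k * n then 1 else 0

/-- The lattice path is the integral part of a generic line. -/
lemma exists_generic_line (k n : ℕ) (m : ℤ) (i₀ : ℕ) (hn : 0 < n) (hk : i₀ < k)
    (hmn : IsCoprime m (n : ℤ)) :
    ∃ θ δ : ℚ, (∀ i : ℤ, 1 ≤ i → i < k * n → height k n m i₀ i = ⌊θ * i + δ⌋) ∧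
      (∀ s : ℤ, 1 ≤ s → s < k * n → ∀ c : ℤ, θ * s ≠ c) ∧
      (∀ i : ℤ, 1 ≤ i → i < k * n → ∀ c : ℤ, θ * i + δ ≠ c) ∧
      (∀ s : ℤ, -(k * n : ℤ) < s → s < k * n →
        ⌈θ * s⌉ = m * s / n + 1 - if (n : ℤ) ∣ s ∧ 0 ≤ s then 1 else 0) ∧
      (∀ s : ℤ, -(k * n : ℤ) < s → s < k * n →
        ⌊θ * s⌋ = m * s / n - if (n : ℤ) ∣ s ∧ 0 < s then 1 else 0) := by
  have hn' : (0 : ℤ) < n := by exact_mod_cast hn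
  have hnq : (0 : ℚ) < n := by exact_mod_cast hn
  have hkq : (0 : ℚ) < k := by exact_mod_cast (by omega : 0 < k)
  have hn1 : (1 : ℚ) ≤ n := by exact_mod_cast hn
  have hdvd : ∀ s : ℤ, (n : ℤ) ∣ m * s ↔ (n : ℤ) ∣ s := fun s =>
    ⟨fun h => hmn.symm.dvd_of_dvd_mul_left h, fun h => h.mul_left m⟩
  set ε : ℚ := 1 / (4 * n * (k * n)) with hε
  have hε0 : 0 < ε := by positivity
  have hεN : ε * (k * n) * n = 1 / 4 := by rw [hε]; field_simp
  set δ : ℚ := (((k : ℚ) - i₀) * n - 1 / 2) * ε with hδ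
  have hi₀ : (i₀ : ℚ) + 1 ≤ k := by exact_mod_cast hk
  have hi₀' : (0 : ℚ) ≤ i₀ := by positivity
  have small : ∀ s : ℚ, -(k * n : ℚ) < s → s < k * n → |(-(ε * s)) * n| < 1 := by
    intro s h1 h2
    rw [abs_lt]
    have e1 : ε * s * n < 1 / 4 := by
      rw [← hεN]
      gcongr
    have e2 : -(1 / 4) < ε * s * n := by
      rw [← hεN, ← neg_mul, ← mul_neg]
      gcongr
    constructor <;> linarith
  have hθs : ∀ s : ℤ, ((m : ℚ) / n - ε) * s = ((m * s : ℤ) : ℚ) / n + (-(ε * s)) := by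
    intro s; push_cast; ring
  have hfl : ∀ s : ℤ, -(k * n : ℤ) < s → s < k * n →
        ⌊((m : ℚ) / n - ε) * s⌋ = m * s / n - if (n : ℤ) ∣ s ∧ 0 < s then 1 else 0 := by
    intro s h1 h2
    have h3 := small s (by exact_mod_cast h1) (by exact_mod_cast h2)
    rw [abs_lt] at h3
    rw [hθs]
    rcases le_or_gt s 0 with hs | hs
    · have hs' : (s : ℚ) ≤ 0 := by exact_mod_cast hs
      rw [floor_div_add_pos hn _ (by
        rw [neg_nonneg]; exact mul_nonpos_of_nonneg_of_nonpos hε0.le hs') h3.2,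
        if_neg (by rintro ⟨-, h⟩; omega)]
      ring
    · have hs' : (0 : ℚ) < s := by exact_mod_cast hs
      rw [floor_div_add_neg hn _ (by rw [neg_lt_zero]; positivity) h3.1]
      simp only [hdvd, hs, and_true]
  have hni : ∀ s : ℤ, -(k * n : ℤ) < s → s < k * n → s ≠ 0 → ∀ c : ℤ,
      ((m : ℚ) / n - ε) * s ≠ c := by
    intro s h1 h2 h0 c
    rw [hθs]
    refine div_add_ne_int hn _ ?_ (small s (by exact_mod_cast h1) (by exact_mod_cast h2)) c
    have : (s : ℚ) ≠ 0 := by exact_mod_cast h0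
    exact neg_ne_zero.2 (mul_ne_zero hε0.ne' this)
  have hline : ∀ i : ℤ, ((m : ℚ) / n - ε) * i + δ =
      ((m * i : ℤ) : ℚ) / n + ((((k : ℚ) - i₀) * n - 1 / 2 - i) * ε) := by
    intro i; rw [hδ]; push_cast; ring
  have hsmall : ∀ i : ℤ, 1 ≤ i → i < k * n →
      |((((k : ℚ) - i₀) * n - 1 / 2 - i) * ε) * n| < 1 := by
    intro i h1 h2
    have h1' : (1 : ℚ) ≤ i := by exact_mod_cast h1
    have h2' : (i : ℚ) < k * n := by exact_mod_cast h2
    have := small (-(((k : ℚ) - i₀) * n - 1 / 2 - i)) (by nlinarith) (by nlinarith)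
    rwa [show -(ε * -(((k : ℚ) - i₀) * n - 1 / 2 - i)) = (((k : ℚ) - i₀) * n - 1 / 2 - i) * ε
      by ring] at this
  refine ⟨m / n - ε, δ, ?_, fun s h1 h2 => hni s (by omega) h2 (by omega), ?_, ?_, hfl⟩
  · intro i h1 h2
    have h3 := hsmall i h1 h2
    rw [abs_lt] at h3
    rw [hline, height]
    by_cases hd : (n : ℤ) ∣ i
    · obtain ⟨s, rfl⟩ := hd
      have hs : (s : ℤ) < k := by
        rw [mul_comm (k : ℤ)] at h2
        exact lt_of_mul_lt_mul_left h2 hn'.le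
      by_cases hc : ((k : ℤ) - i₀) ≤ s
      · rw [if_pos ⟨dvd_mul_right _ _, by rw [mul_comm]; exact mul_le_mul_of_nonneg_left hc hn'.le,
          h2⟩, floor_div_add_neg hn _ _ h3.1, if_pos ((dvd_mul_right _ _).mul_left m)]
        have hc' : (k : ℚ) - i₀ ≤ s := by exact_mod_cast hc
        refine mul_neg_of_neg_of_pos ?_ hε0
        push_cast
        nlinarith
      · rw [if_neg (by
          rintro ⟨-, h4, -⟩
          rw [mul_comm] at h4
          exact hc (le_of_mul_le_mul_left h4 hn')), floor_div_add_pos hn _ _ h3.2, sub_zero]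
        have hc' : (s : ℚ) + 1 ≤ (k : ℚ) - i₀ := by
          have : s + 1 ≤ (k : ℤ) - i₀ := by omega
          exact_mod_cast this
        refine mul_nonneg ?_ hε0.le
        push_cast
        nlinarith
    · rw [if_neg (fun h => hd h.1), sub_zero]
      rcases le_or_gt 0 ((((k : ℚ) - i₀) * n - 1 / 2 - i) * ε) with h5 | h5
      · rw [floor_div_add_pos hn _ h5 h3.2]
      · rw [floor_div_add_neg hn _ h5 h3.1, if_neg (fun h => hd ((hdvd i).1 h)), sub_zero]
  · intro i h1 h2 c
    rw [hline]
    refine div_add_ne_int hn _ (mul_ne_zero ?_ hε0.ne') (hsmall i h1 h2) c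
    intro h
    have h3 : (2 * (((k : ℤ) - i₀) * n - i) : ℤ) = 1 := by
      have : (2 * (((k : ℚ) - i₀) * n - i)) = 1 := by linarith
      exact_mod_cast this
    omega
  · intro s h1 h2
    rcases eq_or_ne s 0 with rfl | h0
    · simp
    · rw [ceil_eq_floor_add_one (hni s h1 h2 h0), hfl s h1 h2]
      have : (0 ≤ s) ↔ 0 < s := by omega
      simp only [this]
      ring

end Arithmetic

section Exponents

/-- `∑_{u=1}^a ⌊(m u + ρ) / n⌋`. -/
def armLevel (m : ℤ) (n a : ℕ) (ρ : ℤ) : ℤ := ∑ u ∈ Finset.range a, (m * (u + 1) + ρ) / n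

/-- `∑_{v=1}^b ⌊(ρ - m v) / n⌋`. -/
def legLevel (m : ℤ) (n b : ℕ) (ρ : ℤ) : ℤ := ∑ v ∈ Finset.range b, (ρ - m * (v + 1)) / n

lemma sum_ite_residue {n c : ℕ} (hc : c < n) (b : ℕ) (P p : ℕ → Prop) [DecidablePred P]
    [DecidablePred p] (h1 : ∀ v, P v → v % n = c) (h2 : ∀ y, P (c + n * y) ↔ p y) :
    ∑ v ∈ Finset.range b, (if P v then 1 else 0 : ℤ) =
      ∑ y ∈ Finset.range ((b + n - 1 - c) / n), if p y then 1 else 0 := by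
  rw [sum_range_of_residue hc b _ (fun v hv => if_neg fun h => hv (h1 v h))]
  simp only [h2]

lemma dvd_sub_iff_mod {n c : ℕ} (hc : c < n) (r v : ℕ) :
    (n : ℤ) ∣ (v : ℤ) - (c + n * r : ℕ) ↔ v % n = c := by
  rw [← Nat.modEq_iff_dvd, Nat.ModEq, Nat.add_mul_mod_self_left, Nat.mod_eq_of_lt hc, eq_comm]

lemma height_mul (k n : ℕ) (hn : 0 < n) (m : ℤ) (i₀ : ℕ) :
    height k n m i₀ (k * n) = m * k := by
  have hn' : (n : ℤ) ≠ 0 := by exact_mod_cast hn.ne'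
  rw [height, if_neg (by rintro ⟨-, -, h⟩; exact lt_irrefl _ h), ← mul_assoc,
    Int.mul_ediv_cancel _ hn', sub_zero]

lemma height_mul_sub (k n : ℕ) (hn : 0 < n) (m : ℤ) (i₀ : ℕ) {x : ℤ} (hx : 0 < x) :
    height k n m i₀ (k * n - x) =
      m * k + (-(m * x)) / n - if (n : ℤ) ∣ x ∧ x ≤ i₀ * n then 1 else 0 := by
  have hn' : (n : ℤ) ≠ 0 := by exact_mod_cast hn.ne'
  rw [height, show m * ((k : ℤ) * n - x) = -(m * x) + n * (m * k) by ring,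
    Int.add_mul_ediv_left _ _ hn', add_comm (m * (k : ℤ))]
  have h1 : (n : ℤ) ∣ k * n - x ↔ (n : ℤ) ∣ x :=
    (Int.dvd_iff_dvd_of_dvd_sub (by simp)).trans (dvd_neg (a := (n : ℤ)) (b := x))
  have h2 : ((k : ℤ) - i₀) * n ≤ k * n - x ↔ x ≤ i₀ * n := by
    rw [sub_mul]
    constructor <;> intro h <;> linarith
  have h3 : (k : ℤ) * n - x < k * n := by linarith
  simp only [h1, h2, h3, and_true]

variable {k n a b i₀ : ℕ} {m : ℤ} {θ : ℚ}

lemma arm_q_exponent (hn : 0 < n) (hab : a + b + 1 = k * n)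
    (hθ : ∀ s : ℤ, -(k * n : ℤ) < s → s < k * n →
        ⌈θ * s⌉ = m * s / n + 1 - if (n : ℤ) ∣ s ∧ 0 ≤ s then 1 else 0)
    {j : ℕ} (hj : j < a) {σ ρ : ℤ} (hρ : -(m * (j + 1)) = n * σ + ρ) (hρ0 : 0 ≤ ρ) (hρn : ρ < n) :
    (a : ℤ) * (height k n m i₀ (a + b + 1) - height k n m i₀ (a + b - j)) +
        ∑ u ∈ Finset.range a, ⌈θ * ((u : ℚ) - j)⌉ =
      ∑ u ∈ Finset.range a, ((m * (u + 1) + ρ) / n + 1 +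
        (if (n : ℤ) ∣ j + 1 ∧ (j + 1 : ℤ) ≤ i₀ * n then 1 else 0) -
        if (n : ℤ) ∣ (u : ℤ) - j ∧ j ≤ u then 1 else 0) := by
  have hn' : (n : ℤ) ≠ 0 := by exact_mod_cast hn.ne'
  have hab' : (a : ℤ) + b + 1 = k * n := by exact_mod_cast hab
  have ha : (a : ℤ) < k * n := by omega
  rw [hab', height_mul k n hn, show (a : ℤ) + b - j = k * n - (j + 1) by linear_combination hab',
    height_mul_sub k n hn m i₀ (by omega), hρ, add_comm ((n : ℤ) * σ),
    Int.add_mul_ediv_left _ _ hn', Int.ediv_eq_zero_of_lt hρ0 hρn]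
  have h1 : ∀ u ∈ Finset.range a, ⌈θ * ((u : ℚ) - j)⌉ = (m * (u + 1) + ρ) / n + 1 + σ -
      if (n : ℤ) ∣ (u : ℤ) - j ∧ j ≤ u then 1 else 0 := by
    intro u hu
    rw [Finset.mem_range] at hu
    have h2 := hθ ((u : ℤ) - j) (by omega) (by omega)
    push_cast at h2
    rw [h2, show m * ((u : ℤ) - j) = m * (u + 1) + ρ + n * σ by linear_combination hρ,
      Int.add_mul_ediv_left _ _ hn']
    have h3 : 0 ≤ (u : ℤ) - j ↔ j ≤ u := by omega
    simp only [h3]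
    ring
  rw [Finset.sum_congr rfl h1]
  simp only [Finset.sum_add_distrib, Finset.sum_sub_distrib, Finset.sum_const, Finset.card_range,
    nsmul_eq_mul]
  ring

lemma arm_t_exponent (hn : 0 < n) (hab : a + b + 1 = k * n)
    {j : ℕ} {σ ρ : ℤ} (hρ : -(m * (j + 1)) = n * σ + ρ) (hρ0 : 0 ≤ ρ) (hρn : ρ < n) :
    -dropSum (height k n m i₀) b (a + b - j) =
      ∑ v ∈ Finset.range b, ((ρ - m * (v + 1)) / n +
        (if (n : ℤ) ∣ j + 1 ∧ (j + 1 : ℤ) ≤ i₀ * n then 1 else 0) -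
        if (n : ℤ) ∣ j + 1 + (v + 1) ∧ (j + 1 + (v + 1) : ℤ) ≤ i₀ * n then 1 else 0) := by
  have hn' : (n : ℤ) ≠ 0 := by exact_mod_cast hn.ne'
  have hab' : (a : ℤ) + b + 1 = k * n := by exact_mod_cast hab
  rw [dropSum, ← Finset.sum_neg_distrib]
  refine Finset.sum_congr rfl fun v _ => ?_
  rw [show (a : ℤ) + b - j - (v + 1) = k * n - (j + 1 + (v + 1)) by linear_combination hab',
    show (a : ℤ) + b - j = k * n - (j + 1) by linear_combination hab',
    height_mul_sub k n hn m i₀ (by omega), height_mul_sub k n hn m i₀ (by omega), hρ,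
    show -(m * ((j : ℤ) + 1 + (v + 1))) = ρ - m * (v + 1) + n * σ by linear_combination hρ,
    add_comm ((n : ℤ) * σ), Int.add_mul_ediv_left _ _ hn', Int.add_mul_ediv_left _ _ hn',
    Int.ediv_eq_zero_of_lt hρ0 hρn]
  ring

lemma neg_ediv_of_eq (hn : 0 < n) {x τ ρ : ℤ} (hρ : x = n * τ + ρ) (hρ0 : 0 ≤ ρ) (hρn : ρ < n) :
    (-x) / n = -τ - 1 + if ρ = 0 then 1 else 0 := by
  have hn' : (n : ℤ) ≠ 0 := by exact_mod_cast hn.ne'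
  rw [neg_ediv_eq hn, hρ, show (n : ℤ) * τ + ρ - 1 = ρ - 1 + n * τ by ring,
    Int.add_mul_ediv_left _ _ hn']
  split_ifs with h
  · rw [h, show (0 : ℤ) - 1 = (n - 1) + n * (-1) by ring, Int.add_mul_ediv_left _ _ hn',
      Int.ediv_eq_zero_of_lt (by omega) (by omega)]
    ring
  · rw [Int.ediv_eq_zero_of_lt (by omega) (by omega)]
    ring

lemma leg_q_exponent (hn : 0 < n) (hab : a + b + 1 = k * n)
    {j : ℕ} {τ ρ : ℤ} (hρ : m * (j + 1) = n * τ + ρ) (hρ0 : 0 ≤ ρ) (hρn : ρ < n) :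
    (a : ℤ) + dropSum (height k n m i₀) a (a + b - j) =
      a + ∑ v ∈ Finset.range a, ((m * (v + 1) + (ρ - 1)) / n + (if ρ = 0 then 1 else 0) -
        (if (n : ℤ) ∣ j + 1 ∧ (j + 1 : ℤ) ≤ i₀ * n then 1 else 0) +
        if (n : ℤ) ∣ j + 1 + (v + 1) ∧ (j + 1 + (v + 1) : ℤ) ≤ i₀ * n then 1 else 0) := by
  have hn' : (n : ℤ) ≠ 0 := by exact_mod_cast hn.ne'
  have hab' : (a : ℤ) + b + 1 = k * n := by exact_mod_cast hab
  rw [dropSum]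
  congr 1
  refine Finset.sum_congr rfl fun v _ => ?_
  rw [show (a : ℤ) + b - j - (v + 1) = k * n - (j + 1 + (v + 1)) by linear_combination hab',
    show (a : ℤ) + b - j = k * n - (j + 1) by linear_combination hab',
    height_mul_sub k n hn m i₀ (by omega), height_mul_sub k n hn m i₀ (by omega),
    neg_ediv_of_eq hn hρ hρ0 hρn, neg_ediv_eq hn,
    show m * ((j : ℤ) + 1 + (v + 1)) - 1 = m * (v + 1) + (ρ - 1) + n * τ by
      linear_combination hρ, Int.add_mul_ediv_left _ _ hn']
  ring

lemma leg_t_exponent (hn : 0 < n) (hab : a + b + 1 = k * n)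
    (hθ : ∀ s : ℤ, -(k * n : ℤ) < s → s < k * n →
        ⌊θ * s⌋ = m * s / n - if (n : ℤ) ∣ s ∧ 0 < s then 1 else 0)
    {j : ℕ} (hj : j < b) {τ ρ : ℤ} (hρ : m * (j + 1) = n * τ + ρ) (hρ0 : 0 ≤ ρ) (hρn : ρ < n) :
    -((b : ℤ) * (height k n m i₀ (a + b + 1) - height k n m i₀ (a + b - j)) +
        ∑ u ∈ Finset.range b, ⌊θ * ((u : ℚ) - j)⌋) =
      ∑ u ∈ Finset.range b, ((ρ - 1 - m * (u + 1)) / n + (if ρ = 0 then 1 else 0) -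
        (if (n : ℤ) ∣ j + 1 ∧ (j + 1 : ℤ) ≤ i₀ * n then 1 else 0) +
        if (n : ℤ) ∣ (u : ℤ) - j ∧ j < u then 1 else 0) := by
  have hn' : (n : ℤ) ≠ 0 := by exact_mod_cast hn.ne'
  have hab' : (a : ℤ) + b + 1 = k * n := by exact_mod_cast hab
  have ha : (b : ℤ) < k * n := by omega
  rw [hab', height_mul k n hn, show (a : ℤ) + b - j = k * n - (j + 1) by linear_combination hab',
    height_mul_sub k n hn m i₀ (by omega), neg_ediv_of_eq hn hρ hρ0 hρn]
  have h1 : ∀ u ∈ Finset.range b, ⌊θ * ((u : ℚ) - j)⌋ = -((ρ - 1 - m * (u + 1)) / n) - 1 - τ -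
      if (n : ℤ) ∣ (u : ℤ) - j ∧ j < u then 1 else 0 := by
    intro u hu
    rw [Finset.mem_range] at hu
    have h2 := hθ ((u : ℤ) - j) (by omega) (by omega)
    push_cast at h2
    rw [h2, show m * ((u : ℤ) - j) = -(m * (j - u)) by ring, neg_ediv_eq hn,
      show m * ((j : ℤ) - u) - 1 = ρ - 1 - m * (u + 1) + n * τ by linear_combination hρ,
      Int.add_mul_ediv_left _ _ hn']
    have h3 : 0 < (u : ℤ) - j ↔ j < u := by omega
    simp only [h3]
    ring
  rw [Finset.sum_congr rfl h1]
  simp only [Finset.sum_add_distrib, Finset.sum_sub_distrib, Finset.sum_const, Finset.card_range,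
    nsmul_eq_mul, Finset.sum_neg_distrib]
  ring

end Exponents

section Exponents

variable {k n a b i₀ : ℕ} {m : ℤ} {θ : ℚ}

lemma sum_one_ite_residue {c : ℕ} (hc : c < n) (b : ℕ) (P : ℕ → Prop) [DecidablePred P]
    (h : ∀ v, P v ↔ v % n = c) :
    ∑ v ∈ Finset.range b, (if P v then 1 else 0 : ℤ) = ((b + n - 1 - c) / n : ℕ) := by
  rw [sum_ite_residue hc b P (fun _ => True) (fun v hv => (h v).1 hv)
    (fun y => by rw [h, Nat.add_mul_mod_self_left, Nat.mod_eq_of_lt hc]; simp)]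
  simp

lemma armLevel_shift {c : ℕ} (hc : c < n) {ρ : ℤ}
    (h : ∀ u : ℕ, (n : ℤ) ∣ m * (u + 1) + ρ ↔ u % n = c) :
    armLevel m n a ρ = armLevel m n a (ρ - 1) + ((a + n - 1 - c) / n : ℕ) := by
  rw [← sum_one_ite_residue hc a _ h, armLevel, armLevel, ← Finset.sum_add_distrib]
  refine Finset.sum_congr rfl fun u _ => ?_
  rw [ediv_eq_sub_one_ediv (by omega) (m * ((u : ℤ) + 1) + ρ), add_sub_assoc]

lemma legLevel_shift {c : ℕ} (hc : c < n) {ρ : ℤ}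
    (h : ∀ v : ℕ, (n : ℤ) ∣ ρ - m * (v + 1) ↔ v % n = c) :
    legLevel m n b ρ = legLevel m n b (ρ - 1) + ((b + n - 1 - c) / n : ℕ) := by
  rw [← sum_one_ite_residue hc b _ h, legLevel, legLevel, ← Finset.sum_add_distrib]
  refine Finset.sum_congr rfl fun u _ => ?_
  rw [ediv_eq_sub_one_ediv (by omega) (ρ - m * ((u : ℤ) + 1)), sub_right_comm]

lemma dvd_mul_coprime (hmn : IsCoprime m (n : ℤ)) (s : ℤ) : (n : ℤ) ∣ m * s ↔ (n : ℤ) ∣ s :=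
  ⟨fun h => hmn.symm.dvd_of_dvd_mul_left h, fun h => h.mul_left m⟩

lemma dvd_arm_residue (hmn : IsCoprime m (n : ℤ)) {c : ℕ} (hc : c < n) {σ ρ : ℤ}
    (hρ : -(m * (c + 1)) = n * σ + ρ) (u : ℕ) :
    (n : ℤ) ∣ m * (u + 1) + ρ ↔ u % n = c := by
  rw [← dvd_sub_iff_mod hc 0 u, ← dvd_mul_coprime hmn ((u : ℤ) - (c + n * 0 : ℕ))]
  rw [show m * ((u : ℤ) + 1) + ρ = m * ((u : ℤ) - (c + n * 0 : ℕ)) + n * (-σ) by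
    push_cast; linear_combination -hρ, Int.dvd_add_left (dvd_mul_right _ _)]

lemma dvd_leg_residue (hmn : IsCoprime m (n : ℤ)) {c : ℕ} (hc : c < n) {τ ρ : ℤ}
    (hρ : m * (c + 1) = n * τ + ρ) (v : ℕ) :
    (n : ℤ) ∣ ρ - m * (v + 1) ↔ v % n = c := by
  rw [← dvd_sub_iff_mod hc 0 v, ← dvd_mul_coprime hmn ((v : ℤ) - (c + n * 0 : ℕ)), ← dvd_neg]
  rw [show -(ρ - m * ((v : ℤ) + 1)) = m * ((v : ℤ) - (c + n * 0 : ℕ)) + n * τ by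
    push_cast; linear_combination hρ, Int.dvd_add_left (dvd_mul_right _ _)]

lemma sum_ite_dvd_le {c : ℕ} (hc : c < n) (a r : ℕ) :
    ∑ u ∈ Finset.range a,
      (if (n : ℤ) ∣ (u : ℤ) - (c + n * r : ℕ) ∧ c + n * r ≤ u then 1 else 0 : ℤ) =
      ((a + n - 1 - c) / n - r : ℕ) := by
  rw [sum_ite_residue hc a _ (fun y => r ≤ y), sum_range_ite_le]
  · rintro v ⟨h, -⟩
    exact (dvd_sub_iff_mod hc r v).1 h
  · intro y
    rw [dvd_sub_iff_mod hc, Nat.add_mul_mod_self_left, Nat.mod_eq_of_lt hc,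
      Nat.add_le_add_iff_left, Nat.mul_le_mul_left_iff (by omega)]
    simp

lemma sum_ite_dvd_lt {c : ℕ} (hc : c < n) (a r : ℕ) :
    ∑ u ∈ Finset.range a,
      (if (n : ℤ) ∣ (u : ℤ) - (c + n * r : ℕ) ∧ c + n * r < u then 1 else 0 : ℤ) =
      ((a + n - 1 - c) / n - (r + 1) : ℕ) := by
  rw [sum_ite_residue hc a _ (fun y => r + 1 ≤ y), sum_range_ite_le]
  · rintro v ⟨h, -⟩
    exact (dvd_sub_iff_mod hc r v).1 h
  · intro y
    rw [dvd_sub_iff_mod hc, Nat.add_mul_mod_self_left, Nat.mod_eq_of_lt hc,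
      Nat.add_lt_add_iff_left, Nat.mul_lt_mul_left (by omega), Nat.succ_le_iff]
    simp

lemma sum_ite_dvd_add {c c' s : ℕ} (hc : c < n) (h : c + c' + 2 = n * s) (a r : ℕ) :
    ∑ u ∈ Finset.range a,
      (if (n : ℤ) ∣ ((c' + n * r : ℕ) : ℤ) + 1 + (u + 1) ∧
        (((c' + n * r : ℕ) : ℤ) + 1 + (u + 1) : ℤ) ≤ i₀ * n then 1 else 0 : ℤ) =
      (min ((a + n - 1 - c) / n) (i₀ - (r + (s - 1))) : ℕ) := by
  have hn : 0 < n := by omega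
  have hs : 0 < s := by
    rcases Nat.eq_zero_or_pos s with rfl | h'
    · omega
    · exact h'
  have h' : (c : ℤ) + c' + 2 = n * s := by exact_mod_cast h
  rw [sum_ite_residue hc a _ (fun y => y < i₀ - (r + (s - 1))), sum_range_ite_lt]
  · rintro v ⟨h1, -⟩
    rw [← dvd_sub_iff_mod hc 0 v]
    have : ((c' + n * r : ℕ) : ℤ) + 1 + (v + 1) = ((v : ℤ) - (c + n * 0 : ℕ)) + n * (r + s) := by
      push_cast
      linear_combination h'
    rwa [this, Int.dvd_add_left (dvd_mul_right _ _)] at h1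
  · intro y
    have : ((c' + n * r : ℕ) : ℤ) + 1 + ((c + n * y : ℕ) + 1) = n * ((y + r + s : ℕ) : ℤ) := by
      push_cast
      linear_combination h'
    rw [this, mul_comm (i₀ : ℤ)]
    have e : (n : ℤ) * ((y + r + s : ℕ) : ℤ) ≤ n * i₀ ↔ y + r + s ≤ i₀ := by
      rw [mul_le_mul_iff_right₀ (by exact_mod_cast hn)]
      exact_mod_cast Iff.rfl
    rw [e]
    simp only [dvd_mul_right, true_and]
    omega

lemma ite_dvd_eq_zero {c : ℕ} (hc : c + 1 < n) (r : ℕ) :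
    (if (n : ℤ) ∣ ((c + n * r : ℕ) : ℤ) + 1 ∧ ((c + n * r : ℕ) + 1 : ℤ) ≤ i₀ * n
      then 1 else 0 : ℤ) = 0 := by
  rw [if_neg]
  rintro ⟨h, -⟩
  have h1 : n ∣ c + 1 + n * r := by
    rw [add_right_comm]
    exact_mod_cast h
  rw [Nat.dvd_add_left (dvd_mul_right _ _)] at h1
  exact absurd (Nat.le_of_dvd (by omega) h1) (by omega)

lemma ite_dvd_last (hn : 0 < n) (r : ℕ) :
    (if (n : ℤ) ∣ ((n - 1 + n * r : ℕ) : ℤ) + 1 ∧ ((n - 1 + n * r : ℕ) + 1 : ℤ) ≤ i₀ * n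
      then 1 else 0 : ℤ) = if r + 1 ≤ i₀ then 1 else 0 := by
  have e : ((n - 1 + n * r : ℕ) : ℤ) + 1 = n * ((r + 1 : ℕ) : ℤ) := by
    rw [show n - 1 + n * r = n * (r + 1) - 1 by rw [mul_add]; omega,
      Nat.cast_sub (Nat.mul_pos hn (by omega))]
    push_cast
    ring
  have e2 : (n : ℤ) * ((r + 1 : ℕ) : ℤ) ≤ i₀ * n ↔ r + 1 ≤ i₀ := by
    rw [mul_comm (i₀ : ℤ), mul_le_mul_iff_right₀ (by exact_mod_cast hn)]
    exact_mod_cast Iff.rfl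
  rw [e]
  simp only [e2, dvd_mul_right, true_and]

lemma last_residue (hn : 0 < n) : n - 1 < n := by omega

variable {F : Type*} [Field F] {q t : F}

/-- The summand of index `ρ` of the hook formula. -/
def levelTerm (q t : F) (m : ℤ) (n a b : ℕ) (ρ : ℤ) : F :=
  q ^ armLevel m n a ρ * t ^ legLevel m n b ρ

lemma arm_term (H : Independent q t) (hab : a + b + 1 = k * n) (hmn : IsCoprime m (n : ℤ))
    (hθ : ∀ s : ℤ, -(k * n : ℤ) < s → s < k * n →
        ⌈θ * s⌉ = m * s / n + 1 - if (n : ℤ) ∣ s ∧ 0 ≤ s then 1 else 0)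
    {c c' r : ℕ} (hc : c + c' + 2 = n) (hr : r < (a + n - 1 - c) / n) {σ ρ : ℤ}
    (hρ : -(m * (c + 1)) = n * σ + ρ) (hρ0 : 0 < ρ) (hρn : ρ < n) :
    q ^ ((a : ℤ) * (height k n m i₀ (a + b + 1) - height k n m i₀ (a + b - (c + n * r : ℕ))) +
        ∑ u ∈ Finset.range a, ⌈θ * ((u : ℚ) - (c + n * r : ℕ))⌉) *
      t ^ (-dropSum (height k n m i₀) b (a + b - (c + n * r : ℕ))) =
    q ^ a * levelTerm q t m n a b (ρ - 1) *
      (q ^ r * t ^ ((b + n - 1 - c') / n - (i₀ - r))) := by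
  have hn : 0 < n := by omega
  have hj : c + n * r < a := (lt_residue_count hn (by omega)).1 hr
  have hρ' : -(m * ((c + n * r : ℕ) + 1)) = n * (σ - m * r) + ρ := by
    push_cast; linear_combination hρ
  have hρ'' : m * (c' + 1) = n * (σ + m) + ρ := by
    have : (c : ℤ) + c' + 2 = n := by exact_mod_cast hc
    linear_combination hρ + m * this
  have e1 : (a : ℤ) * (height k n m i₀ (a + b + 1) - height k n m i₀ (a + b - (c + n * r : ℕ))) +
        ∑ u ∈ Finset.range a, ⌈θ * ((u : ℚ) - (c + n * r : ℕ))⌉ =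
      a + armLevel m n a (ρ - 1) + r := by
    rw [arm_q_exponent hn hab hθ hj hρ' hρ0.le hρn]
    simp only [Finset.sum_add_distrib, Finset.sum_sub_distrib, sum_ite_dvd_le (show c < n by omega),
      ite_dvd_eq_zero (show c + 1 < n by omega)]
    rw [← armLevel, armLevel_shift (by omega) (dvd_arm_residue hmn (by omega) hρ)]
    simp only [Finset.sum_const, Finset.card_range, nsmul_eq_mul, mul_one, mul_zero]
    omega
  have e2 : -dropSum (height k n m i₀) b (a + b - (c + n * r : ℕ)) =
      legLevel m n b (ρ - 1) + ((b + n - 1 - c') / n - (i₀ - r) : ℕ) := by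
    rw [arm_t_exponent hn hab hρ' hρ0.le hρn]
    simp only [Finset.sum_add_distrib, Finset.sum_sub_distrib,
      ite_dvd_eq_zero (show c + 1 < n by omega),
      sum_ite_dvd_add (s := 1) (show c' < n by omega) (show c' + c + 2 = n * 1 by omega)]
    rw [← legLevel, legLevel_shift (show c' < n by omega) (dvd_leg_residue hmn (by omega) hρ'')]
    simp only [Finset.sum_const, Finset.card_range, nsmul_eq_mul, mul_zero]
    omega
  rw [e1, e2, levelTerm, zpow_add₀ H.q_ne_zero, zpow_add₀ H.q_ne_zero, zpow_add₀ H.t_ne_zero]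
  simp only [zpow_natCast]
  ring

lemma leg_term (H : Independent q t) (hab : a + b + 1 = k * n)
    (hθ : ∀ s : ℤ, -(k * n : ℤ) < s → s < k * n →
        ⌊θ * s⌋ = m * s / n - if (n : ℤ) ∣ s ∧ 0 < s then 1 else 0)
    {c c' y : ℕ} (hc : c + c' + 2 = n) (hy : y < (b + n - 1 - c') / n) {σ ρ : ℤ}
    (hρ : -(m * (c + 1)) = n * σ + ρ) (hρ0 : 0 < ρ) (hρn : ρ < n) :
    q ^ ((a : ℤ) + dropSum (height k n m i₀) a (a + b - (c' + n * y : ℕ))) *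
      t ^ (-((b : ℤ) *
          (height k n m i₀ (a + b + 1) - height k n m i₀ (a + b - (c' + n * y : ℕ))) +
        ∑ u ∈ Finset.range b, ⌊θ * ((u : ℚ) - (c' + n * y : ℕ))⌋)) =
    q ^ a * levelTerm q t m n a b (ρ - 1) *
      (t ^ ((b + n - 1 - c') / n - 1 - y) * q ^ (min ((a + n - 1 - c) / n) (i₀ - y))) := by
  have hn : 0 < n := by omega
  have hj : c' + n * y < b := (lt_residue_count hn (by omega)).1 hy
  have hρ' : m * ((c' + n * y : ℕ) + 1) = n * (σ + m + m * y) + ρ := by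
    have : (c : ℤ) + c' + 2 = n := by exact_mod_cast hc
    push_cast
    linear_combination hρ + m * this
  have e1 : (a : ℤ) + dropSum (height k n m i₀) a (a + b - (c' + n * y : ℕ)) =
      a + armLevel m n a (ρ - 1) + (min ((a + n - 1 - c) / n) (i₀ - y) : ℕ) := by
    rw [leg_q_exponent hn hab hρ' hρ0.le hρn]
    simp only [Finset.sum_add_distrib, Finset.sum_sub_distrib,
      ite_dvd_eq_zero (show c' + 1 < n by omega),
      sum_ite_dvd_add (s := 1) (show c < n by omega) (show c + c' + 2 = n * 1 by omega)]
    rw [← armLevel, if_neg hρ0.ne']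
    simp only [Finset.sum_const, Finset.card_range, nsmul_eq_mul, mul_zero]
    omega
  have e2 : -((b : ℤ) *
          (height k n m i₀ (a + b + 1) - height k n m i₀ (a + b - (c' + n * y : ℕ))) +
        ∑ u ∈ Finset.range b, ⌊θ * ((u : ℚ) - (c' + n * y : ℕ))⌋) =
      legLevel m n b (ρ - 1) + ((b + n - 1 - c') / n - 1 - y : ℕ) := by
    rw [leg_t_exponent hn hab hθ hj hρ' hρ0.le hρn]
    simp only [Finset.sum_add_distrib, Finset.sum_sub_distrib,
      ite_dvd_eq_zero (show c' + 1 < n by omega), sum_ite_dvd_lt (show c' < n by omega)]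
    rw [← legLevel, if_neg hρ0.ne']
    simp only [Finset.sum_const, Finset.card_range, nsmul_eq_mul, mul_zero]
    omega
  rw [e1, e2, levelTerm, zpow_add₀ H.q_ne_zero, zpow_add₀ H.q_ne_zero, zpow_add₀ H.t_ne_zero]
  simp only [zpow_natCast]
  ring

lemma arm_term_last (H : Independent q t) (hab : a + b + 1 = k * n) (hn : 0 < n)
    (hθ : ∀ s : ℤ, -(k * n : ℤ) < s → s < k * n →
        ⌈θ * s⌉ = m * s / n + 1 - if (n : ℤ) ∣ s ∧ 0 ≤ s then 1 else 0)
    {r : ℕ} (hr : r < a / n) :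
    q ^ ((a : ℤ) * (height k n m i₀ (a + b + 1) - height k n m i₀ (a + b - (n - 1 + n * r : ℕ))) +
        ∑ u ∈ Finset.range a, ⌈θ * ((u : ℚ) - (n - 1 + n * r : ℕ))⌉) *
      t ^ (-dropSum (height k n m i₀) b (a + b - (n - 1 + n * r : ℕ))) =
    levelTerm q t m n a b 0 * (q ^ ((a : ℤ) - (a / n : ℕ)) * t ^ (-((b / n : ℕ) : ℤ))) *
      ((if r + 1 ≤ i₀ then q ^ a * t ^ b else 1) *
        (q ^ r * t ^ (b / n - (i₀ - (r + 1))))) := by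
  have hκ : (a + n - 1 - (n - 1)) / n = a / n := by congr 1; omega
  have hμ : (b + n - 1 - (n - 1)) / n = b / n := by congr 1; omega
  have hj : n - 1 + n * r < a := (lt_residue_count hn (by omega)).1 (by rwa [hκ])
  have hρ' : -(m * ((n - 1 + n * r : ℕ) + 1)) = n * (-m - m * r) + 0 := by
    rw [Nat.cast_add, Nat.cast_sub hn]
    push_cast
    ring
  have e1 : (a : ℤ) *
        (height k n m i₀ (a + b + 1) - height k n m i₀ (a + b - (n - 1 + n * r : ℕ))) +
        ∑ u ∈ Finset.range a, ⌈θ * ((u : ℚ) - (n - 1 + n * r : ℕ))⌉ =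
      armLevel m n a 0 + (a - (a / n : ℕ)) + a * (if r + 1 ≤ i₀ then 1 else 0) + r := by
    rw [arm_q_exponent hn hab hθ hj hρ' le_rfl (by exact_mod_cast hn)]
    simp only [Finset.sum_add_distrib, Finset.sum_sub_distrib, sum_ite_dvd_le (last_residue hn),
      ite_dvd_last hn, hκ]
    rw [← armLevel]
    simp only [Finset.sum_const, Finset.card_range, nsmul_eq_mul]
    rw [Nat.cast_sub hr.le]
    ring
  have e2 : -dropSum (height k n m i₀) b (a + b - (n - 1 + n * r : ℕ)) =
      legLevel m n b 0 + (-(b / n : ℕ)) + b * (if r + 1 ≤ i₀ then 1 else 0) +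
        (b / n - (i₀ - (r + 1)) : ℕ) := by
    rw [arm_t_exponent hn hab hρ' le_rfl (by exact_mod_cast hn)]
    simp only [Finset.sum_add_distrib, Finset.sum_sub_distrib,
      ite_dvd_last hn, hμ,
      sum_ite_dvd_add (s := 2) (last_residue hn) (show n - 1 + (n - 1) + 2 = n * 2 by omega)]
    rw [← legLevel]
    simp only [Finset.sum_const, Finset.card_range, nsmul_eq_mul]
    have : ((b / n - (i₀ - (r + 1)) : ℕ) : ℤ) =
        (b / n : ℕ) - (min (b / n) (i₀ - (r + (2 - 1))) : ℕ) := by omega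
    rw [this]
    ring
  rw [e1, e2, levelTerm]
  simp only [zpow_add₀ H.q_ne_zero, zpow_add₀ H.t_ne_zero]
  split_ifs <;> simp only [zpow_natCast, mul_one, mul_zero, zpow_zero] <;> ring

lemma leg_term_last (H : Independent q t) (hab : a + b + 1 = k * n) (hn : 0 < n)
    (hmn : IsCoprime m (n : ℤ))
    (hθ : ∀ s : ℤ, -(k * n : ℤ) < s → s < k * n →
        ⌊θ * s⌋ = m * s / n - if (n : ℤ) ∣ s ∧ 0 < s then 1 else 0)
    {y : ℕ} (hy : y < b / n) :
    q ^ ((a : ℤ) + dropSum (height k n m i₀) a (a + b - (n - 1 + n * y : ℕ))) *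
      t ^ (-((b : ℤ) *
          (height k n m i₀ (a + b + 1) - height k n m i₀ (a + b - (n - 1 + n * y : ℕ))) +
        ∑ u ∈ Finset.range b, ⌊θ * ((u : ℚ) - (n - 1 + n * y : ℕ))⌋)) =
    levelTerm q t m n a b 0 * (q ^ ((a : ℤ) - (a / n : ℕ)) * t ^ (-((b / n : ℕ) : ℤ))) *
      ((if y + 1 ≤ i₀ then 1 else q ^ a * t ^ b) *
        (t ^ (b / n - 1 - y) * q ^ (min (a / n) (i₀ - (y + 1))))) := by
  have hκ : (a + n - 1 - (n - 1)) / n = a / n := by congr 1; omega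
  have hμ : (b + n - 1 - (n - 1)) / n = b / n := by congr 1; omega
  have hj : n - 1 + n * y < b := (lt_residue_count hn (by omega)).1 (by rwa [hμ])
  have hc1 : (((n - 1 : ℕ) : ℤ) + 1) = n := by rw [Nat.cast_sub hn]; push_cast; ring
  have hρ' : m * ((n - 1 + n * y : ℕ) + 1) = n * (m + m * y) + 0 := by
    rw [Nat.cast_add]
    push_cast
    linear_combination m * hc1
  have s1 := armLevel_shift (a := a) (last_residue hn) (dvd_arm_residue hmn (σ := -m) (ρ := 0)
    (last_residue hn) (by rw [hc1]; ring))
  have s2 := legLevel_shift (b := b) (last_residue hn) (dvd_leg_residue hmn (τ := m) (ρ := 0)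
    (last_residue hn) (by rw [hc1]; ring))
  rw [hκ] at s1
  rw [hμ] at s2
  have e1 : (a : ℤ) + dropSum (height k n m i₀) a (a + b - (n - 1 + n * y : ℕ)) =
      armLevel m n a 0 + (a - (a / n : ℕ)) + a * (1 - (if y + 1 ≤ i₀ then 1 else 0)) +
        (min (a / n) (i₀ - (y + 1)) : ℕ) := by
    rw [leg_q_exponent hn hab hρ' le_rfl (by exact_mod_cast hn)]
    simp only [Finset.sum_add_distrib, Finset.sum_sub_distrib, ite_dvd_last hn, hκ,
      sum_ite_dvd_add (s := 2) (last_residue hn) (show n - 1 + (n - 1) + 2 = n * 2 by omega)]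
    rw [← armLevel, s1]
    simp only [Finset.sum_const, Finset.card_range, nsmul_eq_mul, if_true, Nat.reduceSub]
    ring
  have e2 : -((b : ℤ) *
          (height k n m i₀ (a + b + 1) - height k n m i₀ (a + b - (n - 1 + n * y : ℕ))) +
        ∑ u ∈ Finset.range b, ⌊θ * ((u : ℚ) - (n - 1 + n * y : ℕ))⌋) =
      legLevel m n b 0 + (-(b / n : ℕ)) + b * (1 - (if y + 1 ≤ i₀ then 1 else 0)) +
        (b / n - 1 - y : ℕ) := by
    rw [leg_t_exponent hn hab hθ hj hρ' le_rfl (by exact_mod_cast hn)]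
    simp only [Finset.sum_add_distrib, Finset.sum_sub_distrib, ite_dvd_last hn, hμ,
      sum_ite_dvd_lt (last_residue hn)]
    rw [← legLevel, s2]
    simp only [Finset.sum_const, Finset.card_range, nsmul_eq_mul, if_true]
    rw [show b / n - (y + 1) = b / n - 1 - y by omega]
    ring
  rw [e1, e2, levelTerm]
  simp only [zpow_add₀ H.q_ne_zero, zpow_add₀ H.t_ne_zero]
  split_ifs <;> simp only [zpow_natCast, mul_one, mul_zero, zpow_zero, sub_zero, sub_self] <;> ring

end Exponents

section FinalSum

lemma div_add_div_of_add_eq {n x y k : ℕ} (hn : 0 < n) (h : x + y + 1 = n * (k + 1)) :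
    x / n + y / n = k := by
  have h1 := Nat.mod_add_div x n
  have h2 := Nat.mod_add_div y n
  have h3 := Nat.mod_lt x hn
  have h4 := Nat.mod_lt y hn
  have h5 : n * (x / n + y / n) < n * (k + 1) := by rw [mul_add]; omega
  have h6 : n * k < n * (x / n + y / n + 1) := by
    rw [mul_add, mul_add]
    rw [mul_add] at h
    omega
  have h7 := Nat.lt_of_mul_lt_mul_left h5
  have h8 := Nat.lt_of_mul_lt_mul_left h6
  omega

lemma sum_residue_reindex {R : Type*} [AddCommMonoid R] {n' : ℕ} {m : ℤ}
    (hmn : IsCoprime m ((n' + 1 : ℕ) : ℤ)) (f : ℤ → R) :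
    ∑ c ∈ Finset.range n', f ((-(m * (c + 1))) % (n' + 1 : ℕ) - 1) =
      ∑ i ∈ Finset.range n', f i := by
  have hn' : (0 : ℤ) < (n' + 1 : ℕ) := by exact_mod_cast Nat.succ_pos n'
  have hpos : ∀ c ∈ Finset.range n', 0 < (-(m * (c + 1))) % (n' + 1 : ℕ) := by
    intro c hc
    rw [Finset.mem_range] at hc
    refine lt_of_le_of_ne (Int.emod_nonneg _ hn'.ne') fun h => ?_
    have h1 := Int.dvd_of_emod_eq_zero h.symm
    rw [dvd_neg, dvd_mul_coprime hmn] at h1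
    have h2 : n' + 1 ∣ c + 1 := by exact_mod_cast h1
    have := Nat.le_of_dvd (Nat.succ_pos c) h2
    omega
  have hlt : ∀ c : ℕ, (-(m * (c + 1))) % (n' + 1 : ℕ) < n' + 1 := fun c => by
    have := Int.emod_lt_of_pos (-(m * (c + 1))) hn'
    push_cast at this ⊢
    exact this
  have hmaps : ∀ c ∈ Finset.range n',
      ((-(m * (c + 1))) % (n' + 1 : ℕ) - 1).toNat ∈ Finset.range n' := by
    intro c hc
    have h1 := hpos c hc
    have h2 := hlt c
    rw [Finset.mem_range]
    omega
  have hinj : Set.InjOn (fun c : ℕ => ((-(m * (c + 1))) % (n' + 1 : ℕ) - 1).toNat)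
      (Finset.range n') := by
    intro c hc d hd h
    have h1 := hpos c hc
    have h2 := hpos d hd
    have h3 : (-(m * (c + 1))) % (n' + 1 : ℕ) = (-(m * (d + 1))) % (n' + 1 : ℕ) := by
      simp only at h
      omega
    have h5 := Int.ModEq.dvd h3
    rw [show -(m * ((d : ℤ) + 1)) - -(m * (c + 1)) = m * (c - d) by ring,
      dvd_mul_coprime hmn] at h5
    rw [Finset.mem_coe, Finset.mem_range] at hc hd
    have h6 := Int.eq_zero_of_abs_lt_dvd h5 (by rw [abs_lt]; omega)
    omega
  refine Finset.sum_nbij (fun c : ℕ => ((-(m * (c + 1))) % (n' + 1 : ℕ) - 1).toNat) hmaps hinj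
    (Finset.surjOn_of_injOn_of_card_le _ hmaps hinj le_rfl) fun c hc => ?_
  have h1 := hpos c hc
  congr 1
  omega

variable {k n a b : ℕ} {m : ℤ} {F : Type*} [Field F] {q t : F}

lemma armStep_height (H : Independent q t) {n' : ℕ} (hab : a + b + 1 = k * (n' + 1)) (i₀ : ℕ)
    (hmn : IsCoprime m ((n' + 1 : ℕ) : ℤ)) {θ : ℚ}
    (hθ : ∀ s : ℤ, -(k * (n' + 1 : ℕ) : ℤ) < s → s < k * (n' + 1 : ℕ) → ⌈θ * s⌉ =
      m * s / (n' + 1 : ℕ) + 1 - if ((n' + 1 : ℕ) : ℤ) ∣ s ∧ 0 ≤ s then 1 else 0)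
    {ρ : ℕ → ℤ} (hρ : ∀ c, ρ c = (-(m * (c + 1))) % (n' + 1 : ℕ))
    (hρ0 : ∀ c ∈ Finset.range n', 0 < ρ c) :
    armStep q t (height k (n' + 1) m i₀) θ a b =
      ∑ c ∈ Finset.range n', q ^ a * levelTerm q t m (n' + 1) a b (ρ c - 1) *
        ∑ r ∈ Finset.range ((a + n' - c) / (n' + 1)),
          q ^ r * t ^ ((b + 1 + c) / (n' + 1) - (i₀ - r)) +
      levelTerm q t m (n' + 1) a b 0 * (q ^ ((a : ℤ) - (a / (n' + 1) : ℕ)) *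
          t ^ (-((b / (n' + 1) : ℕ) : ℤ))) *
        ∑ r ∈ Finset.range (a / (n' + 1)), (if r + 1 ≤ i₀ then q ^ a * t ^ b else 1) *
          (q ^ r * t ^ (b / (n' + 1) - (i₀ - (r + 1)))) := by
  have hn : 0 < n' + 1 := Nat.succ_pos n'
  rw [armStep, sum_range_by_residue hn a, Finset.sum_range_succ]
  congr 1
  · refine Finset.sum_congr rfl fun c hc => ?_
    have hc' := Finset.mem_range.1 hc
    rw [Finset.mul_sum]
    have e : (b + 1 + c) / (n' + 1) = (b + (n' + 1) - 1 - (n' - 1 - c)) / (n' + 1) := by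
      congr 1; omega
    refine Finset.sum_congr (by congr 1) fun r hr => ?_
    rw [e]
    refine arm_term (σ := (-(m * (c + 1))) / (n' + 1 : ℕ)) H hab hmn hθ (by omega)
      (Finset.mem_range.1 hr) ?_ (hρ0 c hc) ?_
    · rw [hρ]
      exact (Int.mul_ediv_add_emod _ _).symm
    · rw [hρ]
      exact Int.emod_lt_of_pos _ (by exact_mod_cast hn)
  · rw [Finset.mul_sum]
    have e : (a + (n' + 1) - 1 - n') / (n' + 1) = a / (n' + 1) := by congr 1; omega
    rw [e]
    exact Finset.sum_congr rfl fun r hr => arm_term_last H hab hn hθ (Finset.mem_range.1 hr)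

lemma legStep_height (H : Independent q t) {n' : ℕ} (hab : a + b + 1 = k * (n' + 1)) (i₀ : ℕ)
    (hmn : IsCoprime m ((n' + 1 : ℕ) : ℤ)) {θ : ℚ}
    (hθ : ∀ s : ℤ, -(k * (n' + 1 : ℕ) : ℤ) < s → s < k * (n' + 1 : ℕ) → ⌊θ * s⌋ =
      m * s / (n' + 1 : ℕ) - if ((n' + 1 : ℕ) : ℤ) ∣ s ∧ 0 < s then 1 else 0)
    {ρ : ℕ → ℤ} (hρ : ∀ c, ρ c = (-(m * (c + 1))) % (n' + 1 : ℕ))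
    (hρ0 : ∀ c ∈ Finset.range n', 0 < ρ c) :
    legStep q t (height k (n' + 1) m i₀) θ a b =
      ∑ c ∈ Finset.range n', q ^ a * levelTerm q t m (n' + 1) a b (ρ c - 1) *
        ∑ y ∈ Finset.range ((b + 1 + c) / (n' + 1)),
          t ^ ((b + 1 + c) / (n' + 1) - 1 - y) * q ^ min ((a + n' - c) / (n' + 1)) (i₀ - y) +
      levelTerm q t m (n' + 1) a b 0 * (q ^ ((a : ℤ) - (a / (n' + 1) : ℕ)) *
          t ^ (-((b / (n' + 1) : ℕ) : ℤ))) *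
        ∑ y ∈ Finset.range (b / (n' + 1)), (if y + 1 ≤ i₀ then 1 else q ^ a * t ^ b) *
          (t ^ (b / (n' + 1) - 1 - y) * q ^ min (a / (n' + 1)) (i₀ - (y + 1))) := by
  have hn : 0 < n' + 1 := Nat.succ_pos n'
  rw [legStep, sum_range_by_residue hn b, Finset.sum_range_succ]
  congr 1
  · rw [← Finset.sum_range_reflect]
    refine Finset.sum_congr rfl fun c hc => ?_
    have hc' := Finset.mem_range.1 hc
    rw [Finset.mul_sum]
    have e : (b + 1 + c) / (n' + 1) = (b + (n' + 1) - 1 - (n' - 1 - c)) / (n' + 1) := by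
      congr 1; omega
    rw [e]
    refine Finset.sum_congr rfl fun y hy => ?_
    refine leg_term (σ := (-(m * (c + 1))) / (n' + 1 : ℕ)) H hab hθ (by omega)
      (Finset.mem_range.1 hy) ?_ (hρ0 c hc) ?_
    · rw [hρ]
      exact (Int.mul_ediv_add_emod _ _).symm
    · rw [hρ]
      exact Int.emod_lt_of_pos _ (by exact_mod_cast hn)
  · rw [Finset.mul_sum]
    have e : (b + (n' + 1) - 1 - n') / (n' + 1) = b / (n' + 1) := by congr 1; omega
    rw [e]
    exact Finset.sum_congr rfl fun r hr => leg_term_last H hab hn hmn hθ (Finset.mem_range.1 hr)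

lemma levelTerm_shift (H : Independent q t) {n' : ℕ} (hmn : IsCoprime m ((n' + 1 : ℕ) : ℤ))
    {c : ℕ} (hc : c < n') {ρ : ℤ} (hρ : ρ = (-(m * (c + 1))) % (n' + 1 : ℕ)) :
    levelTerm q t m (n' + 1) a b ρ =
      q ^ ((a + n' - c) / (n' + 1)) * t ^ ((b + 1 + c) / (n' + 1)) *
        levelTerm q t m (n' + 1) a b (ρ - 1) := by
  have h1 : -(m * (c + 1)) = (n' + 1 : ℕ) * ((-(m * (c + 1))) / (n' + 1 : ℕ)) + ρ := by
    rw [hρ]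
    exact (Int.mul_ediv_add_emod _ _).symm
  have h2 : m * ((n' - 1 - c : ℕ) + 1) =
      (n' + 1 : ℕ) * ((-(m * (c + 1))) / (n' + 1 : ℕ) + m) + ρ := by
    have : ((n' - 1 - c : ℕ) : ℤ) + c + 2 = (n' + 1 : ℕ) := by omega
    linear_combination h1 + m * this
  have e : (b + 1 + c) / (n' + 1) = (b + (n' + 1) - 1 - (n' - 1 - c)) / (n' + 1) := by
    congr 1; omega
  rw [levelTerm, levelTerm, armLevel_shift (c := c) (by omega) (dvd_arm_residue hmn (by omega) h1),
    legLevel_shift (c := n' - 1 - c) (by omega) (dvd_leg_residue hmn (by omega) h2),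
    zpow_add₀ H.q_ne_zero, zpow_add₀ H.t_ne_zero, e]
  simp only [zpow_natCast]
  rw [show a + (n' + 1) - 1 - c = a + n' - c by omega]
  ring

lemma levelTerm_last (H : Independent q t) {n' : ℕ} (hmn : IsCoprime m ((n' + 1 : ℕ) : ℤ)) :
    levelTerm q t m (n' + 1) a b 0 * (q ^ ((a : ℤ) - (a / (n' + 1) : ℕ)) *
          t ^ (-((b / (n' + 1) : ℕ) : ℤ))) * t ^ b =
      levelTerm q t m (n' + 1) a b n' := by
  have hn : 0 < n' + 1 := Nat.succ_pos n'
  have hn0 : ((n' + 1 : ℕ) : ℤ) ≠ 0 := by exact_mod_cast hn.ne'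
  have s1 := armLevel_shift (a := a) (c := n') (ρ := 0) (by omega)
    (dvd_arm_residue hmn (σ := -m) (ρ := 0) (by omega) (by push_cast; ring))
  have s2 := legLevel_shift (b := b) (c := n') (ρ := 0) (by omega)
    (dvd_leg_residue hmn (τ := m) (ρ := 0) (by omega) (by push_cast; ring))
  rw [show a + (n' + 1) - 1 - n' = a by omega] at s1
  rw [show b + (n' + 1) - 1 - n' = b by omega] at s2
  have s3 : armLevel m (n' + 1) a n' = armLevel m (n' + 1) a (0 - 1) + a := by
    rw [armLevel, armLevel, ← mul_one (a : ℤ), ← nsmul_eq_mul,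
      ← Finset.card_range a, ← Finset.sum_const, Finset.card_range, ← Finset.sum_add_distrib]
    refine Finset.sum_congr rfl fun u _ => ?_
    rw [show m * ((u : ℤ) + 1) + n' = m * (u + 1) + (0 - 1) + (n' + 1 : ℕ) * 1 by push_cast; ring,
      Int.add_mul_ediv_left _ _ hn0]
  have s4 : legLevel m (n' + 1) b n' = legLevel m (n' + 1) b (0 - 1) + b := by
    rw [legLevel, legLevel, ← mul_one (b : ℤ), ← nsmul_eq_mul,
      ← Finset.card_range b, ← Finset.sum_const, Finset.card_range, ← Finset.sum_add_distrib]
    refine Finset.sum_congr rfl fun u _ => ?_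
    rw [show n' - m * ((u : ℤ) + 1) = 0 - 1 - m * (u + 1) + (n' + 1 : ℕ) * 1 by push_cast; ring,
      Int.add_mul_ediv_left _ _ hn0]
  rw [levelTerm, levelTerm, s1, s2, s3, s4]
  simp only [sub_eq_add_neg (a : ℤ), zpow_add₀ H.q_ne_zero, zpow_add₀ H.t_ne_zero, zpow_neg,
    zpow_natCast]
  have := pow_ne_zero (a / (n' + 1)) H.q_ne_zero
  have := pow_ne_zero (b / (n' + 1)) H.t_ne_zero
  field_simp

lemma sum_steps (H : Independent q t) (hn : 0 < n) (hab : a + b + 1 = k * n)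
    (hmn : IsCoprime m (n : ℤ)) (θ : ℕ → ℚ)
    (hθ : ∀ i₀ < k, ∀ s : ℤ, -(k * n : ℤ) < s → s < k * n →
      ⌈θ i₀ * s⌉ = m * s / n + 1 - if (n : ℤ) ∣ s ∧ 0 ≤ s then 1 else 0)
    (hθ' : ∀ i₀ < k, ∀ s : ℤ, -(k * n : ℤ) < s → s < k * n →
      ⌊θ i₀ * s⌋ = m * s / n - if (n : ℤ) ∣ s ∧ 0 < s then 1 else 0) :
    ∑ i₀ ∈ Finset.range k, (t / q) ^ i₀ *
        ((1 - q * (q ^ a * t ^ b)) * armStep q t (height k n m i₀) (θ i₀) a b +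
          (1 - t * (q ^ a * t ^ b)) * legStep q t (height k n m i₀) (θ i₀) a b) =
      (1 - q ^ a * t ^ b) * q ^ a * squareSum q t k *
        ∑ i ∈ Finset.range n, levelTerm q t m n a b i := by
  obtain ⟨n', rfl⟩ : ∃ n', n = n' + 1 := ⟨n - 1, by omega⟩
  obtain ⟨ρ, hρ⟩ : ∃ ρ : ℕ → ℤ, ∀ c, ρ c = (-(m * (c + 1))) % (n' + 1 : ℕ) := ⟨_, fun _ => rfl⟩
  have hρ0 : ∀ c ∈ Finset.range n', 0 < ρ c := by
    intro c hc
    rw [Finset.mem_range] at hc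
    rw [hρ]
    refine lt_of_le_of_ne (Int.emod_nonneg _ (by exact_mod_cast hn.ne')) fun h => ?_
    have h1 := Int.dvd_of_emod_eq_zero h.symm
    rw [dvd_neg, dvd_mul_coprime hmn] at h1
    have h2 : n' + 1 ∣ c + 1 := by exact_mod_cast h1
    have := Nat.le_of_dvd (Nat.succ_pos c) h2
    omega
  set X := q ^ a * t ^ b with hX
  set T := levelTerm q t m (n' + 1) a b with hT
  set C := q ^ ((a : ℤ) - (a / (n' + 1) : ℕ)) * t ^ (-((b / (n' + 1) : ℕ) : ℤ)) with hC
  set W := (1 - X) * triangleSum q t k - X * ∑ i ∈ Finset.range k, (t / q) ^ i with hW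
  have hsum : ∀ c < n', (a + n' - c) / (n' + 1) + (b + 1 + c) / (n' + 1) = k := by
    intro c hc
    apply div_add_div_of_add_eq hn
    rw [mul_add, mul_comm (n' + 1) k, ← hab]
    omega
  have hsum0 : a / (n' + 1) + b / (n' + 1) + 1 = k := by
    have hk : 0 < k := by
      rcases Nat.eq_zero_or_pos k with rfl | h
      · omega
      · exact h
    obtain ⟨k', rfl⟩ : ∃ k', k = k' + 1 := ⟨k - 1, by omega⟩
    rw [div_add_div_of_add_eq (k := k') hn (by rw [hab, mul_comm])]
  have hcl : ∀ c < n', (1 - q * X) * ∑ i ∈ Finset.range k, (t / q) ^ i *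
        ∑ r ∈ Finset.range ((a + n' - c) / (n' + 1)),
          q ^ r * t ^ ((b + 1 + c) / (n' + 1) - (i - r)) +
      (1 - t * X) * ∑ i ∈ Finset.range k, (t / q) ^ i *
        ∑ y ∈ Finset.range ((b + 1 + c) / (n' + 1)),
          t ^ ((b + 1 + c) / (n' + 1) - 1 - y) * q ^ min ((a + n' - c) / (n' + 1)) (i - y) =
      (1 - X) * squareSum q t k +
        (q ^ ((a + n' - c) / (n' + 1)) * t ^ ((b + 1 + c) / (n' + 1)) - 1) * W := by
    intro c hc
    have := cluster_identity H ((a + n' - c) / (n' + 1)) ((b + 1 + c) / (n' + 1)) X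
    rwa [hsum c hc] at this
  have hbr := broken_cluster_identity H (a / (n' + 1)) (b / (n' + 1)) X
  rw [hsum0, ← hW] at hbr
  have hshift : ∀ c < n', q ^ ((a + n' - c) / (n' + 1)) * t ^ ((b + 1 + c) / (n' + 1)) *
      T (ρ c - 1) = T (ρ c) := fun c hc => (levelTerm_shift H hmn hc (hρ c)).symm
  have hre1 : ∑ c ∈ Finset.range n', T (ρ c - 1) = ∑ i ∈ Finset.range n', T i := by
    simp only [hρ]
    exact sum_residue_reindex hmn T
  have hre2 : ∑ c ∈ Finset.range n', T (ρ c) = ∑ i ∈ Finset.range n', T (i + 1) := by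
    have := sum_residue_reindex hmn (fun x => T (x + 1))
    simpa only [← hρ, sub_add_cancel] using this
  have htel : ∑ i ∈ Finset.range n', T (i + 1) = ∑ i ∈ Finset.range n', T i + T n' - T 0 := by
    rw [← Finset.sum_range_succ (fun i : ℕ => T i), Finset.sum_range_succ']
    push_cast
    ring
  have hlast : T 0 * C * t ^ b = T n' := levelTerm_last H hmn
  have hfirst : C * (q ^ (a / (n' + 1)) * t ^ (b / (n' + 1))) = q ^ a := by
    rw [hC, sub_eq_add_neg, zpow_add₀ H.q_ne_zero, zpow_neg, zpow_neg]
    simp only [zpow_natCast]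
    have := pow_ne_zero (a / (n' + 1)) H.q_ne_zero
    have := pow_ne_zero (b / (n' + 1)) H.t_ne_zero
    field_simp
  have hstep : ∀ i₀ ∈ Finset.range k, (t / q) ^ i₀ *
        ((1 - q * X) * armStep q t (height k (n' + 1) m i₀) (θ i₀) a b +
          (1 - t * X) * legStep q t (height k (n' + 1) m i₀) (θ i₀) a b) =
      (∑ c ∈ Finset.range n', q ^ a * T (ρ c - 1) * ((1 - q * X) * ((t / q) ^ i₀ *
          ∑ r ∈ Finset.range ((a + n' - c) / (n' + 1)),
            q ^ r * t ^ ((b + 1 + c) / (n' + 1) - (i₀ - r))) +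
        (1 - t * X) * ((t / q) ^ i₀ *
          ∑ y ∈ Finset.range ((b + 1 + c) / (n' + 1)),
            t ^ ((b + 1 + c) / (n' + 1) - 1 - y) * q ^ min ((a + n' - c) / (n' + 1)) (i₀ - y)))) +
      T 0 * C * ((1 - q * X) * ((t / q) ^ i₀ * ∑ r ∈ Finset.range (a / (n' + 1)),
          (if r + 1 ≤ i₀ then X else 1) * (q ^ r * t ^ (b / (n' + 1) - (i₀ - (r + 1))))) +
        (1 - t * X) * ((t / q) ^ i₀ * ∑ y ∈ Finset.range (b / (n' + 1)),
          (if y + 1 ≤ i₀ then 1 else X) *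
            (t ^ (b / (n' + 1) - 1 - y) * q ^ min (a / (n' + 1)) (i₀ - (y + 1))))) := by
    intro i₀ hi₀
    rw [Finset.mem_range] at hi₀
    rw [armStep_height H hab i₀ hmn (hθ i₀ hi₀) hρ hρ0,
      legStep_height H hab i₀ hmn (hθ' i₀ hi₀) hρ hρ0]
    simp only [mul_add, Finset.sum_add_distrib, Finset.mul_sum (Finset.range n')]
    rw [← hT, ← hC, ← hX]
    have e1 : ∀ x y z w : F, x = y → z = w → x + z = y + w := fun _ _ _ _ h h' => by rw [h, h']
    rw [add_add_add_comm]
    refine e1 _ _ _ _ (e1 _ _ _ _ ?_ ?_) (e1 _ _ _ _ ?_ ?_)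
    · exact Finset.sum_congr rfl fun c _ => by ring
    · exact Finset.sum_congr rfl fun c _ => by ring
    · ring
    · ring
  rw [Finset.sum_congr rfl hstep, Finset.sum_add_distrib, Finset.sum_comm]
  simp only [← Finset.mul_sum (Finset.range k), Finset.sum_add_distrib (s := Finset.range k)]
  rw [hbr, Finset.sum_congr rfl fun c hc => by rw [hcl c (Finset.mem_range.1 hc)]]
  have hmain : ∀ c ∈ Finset.range n', q ^ a * T (ρ c - 1) * ((1 - X) * squareSum q t k +
        (q ^ ((a + n' - c) / (n' + 1)) * t ^ ((b + 1 + c) / (n' + 1)) - 1) * W) =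
      q ^ a * ((1 - X) * squareSum q t k) * T (ρ c - 1) +
        (q ^ a * W * T (ρ c) - q ^ a * W * T (ρ c - 1)) := by
    intro c hc
    rw [← hshift c (Finset.mem_range.1 hc)]
    ring
  rw [Finset.sum_congr rfl hmain, Finset.sum_add_distrib, Finset.sum_sub_distrib,
    ← Finset.mul_sum, ← Finset.mul_sum, ← Finset.mul_sum, hre1, hre2, htel,
    Finset.sum_range_succ, ← hlast]
  have hX' : X = q ^ a * t ^ b := hX
  linear_combination (W * T 0) * hfirst +
    (T 0 * C * ((1 - X) * squareSum q t k - W)) * hX'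

end FinalSum

section HasValueAt

variable {N : ℕ} {R S : RatFun N} {x : Fin N → K} {u v : K}

lemma algebraMap_ne_zero_of_eval {b : MvPolynomial (Fin N) K} (hb : MvPolynomial.eval x b ≠ 0) :
    algebraMap _ (RatFun N) b ≠ 0 := by
  rw [Ne, FaithfulSMul.algebraMap_eq_zero_iff]
  rintro rfl
  simp at hb

lemma hasValueAt_algebraMap (a : MvPolynomial (Fin N) K) :
    HasValueAt (algebraMap _ (RatFun N) a) x (MvPolynomial.eval x a) :=
  ⟨a, 1, by simp, by simp, by simp⟩

lemma hasValueAt_const (c : K) : HasValueAt (const N c) x c := by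
  have := hasValueAt_algebraMap (x := x) (MvPolynomial.C c)
  rw [MvPolynomial.eval_C] at this
  rwa [const, IsScalarTower.algebraMap_apply K (MvPolynomial (Fin N) K) (RatFun N)]

lemma hasValueAt_one : HasValueAt (1 : RatFun N) x 1 := by
  simpa using hasValueAt_algebraMap (x := x) 1

lemma hasValueAt_zero : HasValueAt (0 : RatFun N) x 0 := by
  simpa using hasValueAt_algebraMap (x := x) 0

lemma HasValueAt.add (hR : HasValueAt R x u) (hS : HasValueAt S x v) :
    HasValueAt (R + S) x (u + v) := by
  obtain ⟨a, b, rfl, hb, rfl⟩ := hR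
  obtain ⟨c, d, rfl, hd, rfl⟩ := hS
  refine ⟨a * d + b * c, b * d, ?_, by simp [hb, hd], ?_⟩
  · rw [div_add_div _ _ (algebraMap_ne_zero_of_eval hb) (algebraMap_ne_zero_of_eval hd)]
    simp only [map_add, map_mul]
  · rw [div_add_div _ _ hb hd]
    simp only [map_add, map_mul]

lemma HasValueAt.mul (hR : HasValueAt R x u) (hS : HasValueAt S x v) :
    HasValueAt (R * S) x (u * v) := by
  obtain ⟨a, b, rfl, hb, rfl⟩ := hR
  obtain ⟨c, d, rfl, hd, rfl⟩ := hS
  refine ⟨a * c, b * d, ?_, by simp [hb, hd], ?_⟩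
  · rw [div_mul_div_comm]
    simp only [map_mul]
  · rw [div_mul_div_comm]
    simp only [map_mul]

lemma HasValueAt.neg (hR : HasValueAt R x u) : HasValueAt (-R) x (-u) := by
  obtain ⟨a, b, rfl, hb, rfl⟩ := hR
  exact ⟨-a, b, by rw [map_neg, neg_div], hb, by rw [map_neg, neg_div]⟩

lemma HasValueAt.sub (hR : HasValueAt R x u) (hS : HasValueAt S x v) :
    HasValueAt (R - S) x (u - v) := by
  rw [sub_eq_add_neg, sub_eq_add_neg]
  exact hR.add hS.neg

lemma HasValueAt.inv (hR : HasValueAt R x u) (hu : u ≠ 0) : HasValueAt R⁻¹ x u⁻¹ := by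
  obtain ⟨a, b, rfl, hb, rfl⟩ := hR
  refine ⟨b, a, inv_div _ _, fun h => hu ?_, inv_div _ _⟩
  rw [h, zero_div]

lemma HasValueAt.div (hR : HasValueAt R x u) (hS : HasValueAt S x v) (hv : v ≠ 0) :
    HasValueAt (R / S) x (u / v) := by
  rw [div_eq_mul_inv, div_eq_mul_inv]
  exact hR.mul (hS.inv hv)

lemma HasValueAt.sum {ι : Type*} {s : Finset ι} {f : ι → RatFun N} {g : ι → K}
    (h : ∀ i ∈ s, HasValueAt (f i) x (g i)) : HasValueAt (∑ i ∈ s, f i) x (∑ i ∈ s, g i) := by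
  classical
  induction s using Finset.induction_on with
  | empty => simpa using hasValueAt_zero
  | insert i s hi ih =>
    rw [Finset.sum_insert hi, Finset.sum_insert hi]
    exact (h i (Finset.mem_insert_self i s)).add
      (ih fun j hj => h j (Finset.mem_insert_of_mem hj))

lemma HasValueAt.prod {ι : Type*} {s : Finset ι} {f : ι → RatFun N} {g : ι → K}
    (h : ∀ i ∈ s, HasValueAt (f i) x (g i)) : HasValueAt (∏ i ∈ s, f i) x (∏ i ∈ s, g i) := by
  classical
  induction s using Finset.induction_on with
  | empty => simpa using hasValueAt_one
  | insert i s hi ih =>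
    rw [Finset.prod_insert hi, Finset.prod_insert hi]
    exact (h i (Finset.mem_insert_self i s)).mul
      (ih fun j hj => h j (Finset.mem_insert_of_mem hj))

lemma HasValueAt.pow (hR : HasValueAt R x u) (d : ℕ) : HasValueAt (R ^ d) x (u ^ d) := by
  rw [← Finset.card_range d, ← Finset.prod_const, ← Finset.prod_const]
  exact HasValueAt.prod fun _ _ => hR

lemma HasValueAt.zpow (hR : HasValueAt R x u) (hu : u ≠ 0) (d : ℤ) :
    HasValueAt (R ^ d) x (u ^ d) := by
  obtain ⟨d, rfl | rfl⟩ := d.eq_nat_or_neg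
  · simpa only [zpow_natCast] using hR.pow d
  · simpa only [zpow_neg, zpow_natCast] using (hR.pow d).inv (pow_ne_zero d hu)

lemma HasValueAt.permute (σ : Equiv.Perm (Fin N)) (hR : HasValueAt R (x ∘ σ) u) :
    HasValueAt (permute N σ R) x u := by
  obtain ⟨a, b, rfl, hb, rfl⟩ := hR
  have h : ∀ c : MvPolynomial (Fin N) K, PieriShuffle.permute N σ (algebraMap _ (RatFun N) c) =
      algebraMap _ (RatFun N) (MvPolynomial.rename σ c) := by
    intro c
    rw [PieriShuffle.permute, IsFractionRing.ringEquivOfRingEquiv_algebraMap]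
    rfl
  refine ⟨MvPolynomial.rename σ a, MvPolynomial.rename σ b, ?_, ?_, ?_⟩
  · rw [map_div₀, h, h]
  · rwa [MvPolynomial.eval_rename]
  · rw [MvPolynomial.eval_rename, MvPolynomial.eval_rename]

lemma hasValueAt_z (j : ℕ) : HasValueAt (z N (j + 1)) x (extendOne x j) := by
  rw [z, extendOne]
  by_cases h : j < N
  · rw [dif_pos ⟨by omega, h⟩, dif_pos h]
    simpa using hasValueAt_algebraMap (x := x) (MvPolynomial.X ⟨j, h⟩)
  · rw [dif_neg (by omega), dif_neg h]
    exact hasValueAt_one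

lemma HasValueAt.omega (hR : HasValueAt R x u) (h1 : 1 - u ≠ 0) (h2 : t - u * q ≠ 0) :
    HasValueAt (omega N R) x (omegaVal q t u) :=
  ((hasValueAt_one.sub (hR.mul (hasValueAt_const q))).mul ((hasValueAt_const t).sub hR)).div
    ((hasValueAt_one.sub hR).mul ((hasValueAt_const t).sub (hR.mul (hasValueAt_const q))))
    (mul_ne_zero h1 h2)

end HasValueAt

section ShuffleElement

lemma monomial_eq_imp {i j i' j' : ℕ}
    (h : (MvPolynomial.X 0 ^ i * MvPolynomial.X 1 ^ j : MvPolynomial (Fin 2) ℚ) =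
      MvPolynomial.X 0 ^ i' * MvPolynomial.X 1 ^ j') : i = i' ∧ j = j' := by
  have h2 : (2 : ℚ) ^ i = 2 ^ i' := by
    simpa using congrArg (MvPolynomial.eval ![2, 1]) h
  have h3 : (2 : ℚ) ^ j = 2 ^ j' := by
    simpa using congrArg (MvPolynomial.eval ![1, 2]) h
  exact ⟨pow_right_injective₀ (by norm_num) (by norm_num) h2,
    pow_right_injective₀ (by norm_num) (by norm_num) h3⟩

lemma independent_q_t : Independent q t := by
  have hq : q ≠ 0 := by
    rw [q, Ne, FaithfulSMul.algebraMap_eq_zero_iff]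
    exact MvPolynomial.X_ne_zero 0
  have ht : t ≠ 0 := by
    rw [t, Ne, FaithfulSMul.algebraMap_eq_zero_iff]
    exact MvPolynomial.X_ne_zero 1
  have hinj : ∀ i j i' j' : ℕ, q ^ i * t ^ j = q ^ i' * t ^ j' → i = i' ∧ j = j' := by
    intro i j i' j' h
    apply monomial_eq_imp
    apply FaithfulSMul.algebraMap_injective (MvPolynomial (Fin 2) ℚ) K
    simpa only [map_mul, map_pow, q, t] using h
  refine ⟨hq, ht, fun i j h => ?_⟩
  have h1 : q ^ (i.toNat) * t ^ (j.toNat) = q ^ ((-i).toNat) * t ^ ((-j).toNat) := by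
    have e1 : (i.toNat : ℤ) = i + (-i).toNat := by omega
    have e2 : (j.toNat : ℤ) = j + (-j).toNat := by omega
    rw [← zpow_natCast q, ← zpow_natCast t, e1, e2, zpow_add₀ hq, zpow_add₀ ht, zpow_natCast,
      zpow_natCast]
    linear_combination (q ^ (-i).toNat * t ^ (-j).toNat) * h
  have := hinj _ _ _ _ h1
  omega

variable {F : Type*} [Field F]

lemma prod_pow_ite_dvd {n i₀ M : ℕ} (hn : 0 < n) (hM : i₀ * n < M) (g : ℕ → F) :
    ∏ x ∈ Finset.range M, g x ^ (if (n ∣ x ∧ x ≤ i₀ * n) ∧ 0 < x then 1 else 0 : ℤ) =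
      ∏ a ∈ Finset.Icc 1 i₀, g (a * n) := by
  have h1 : ∀ x ∈ Finset.range M,
      g x ^ (if (n ∣ x ∧ x ≤ i₀ * n) ∧ 0 < x then 1 else 0 : ℤ) =
      if (n ∣ x ∧ x ≤ i₀ * n) ∧ 0 < x then g x else 1 := by
    intro x _
    split_ifs <;> simp
  rw [Finset.prod_congr rfl h1, ← Finset.prod_filter]
  symm
  refine Finset.prod_nbij (fun a => a * n) ?_ ?_ ?_ (fun _ _ => rfl)
  · intro a ha
    rw [Finset.mem_Icc] at ha
    have h2 : a * n ≤ i₀ * n := Nat.mul_le_mul_right n ha.2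
    rw [Finset.mem_filter, Finset.mem_range]
    exact ⟨by omega, ⟨dvd_mul_left n a, h2⟩, Nat.mul_pos (by omega) hn⟩
  · intro a _ b _ h
    exact Nat.eq_of_mul_eq_mul_right hn h
  · intro x hx
    rw [Finset.mem_coe, Finset.mem_filter] at hx
    obtain ⟨-, ⟨⟨d, rfl⟩, h2⟩, h3⟩ := hx
    refine ⟨d, ?_, mul_comm d n⟩
    rw [Finset.mem_coe, Finset.mem_Icc]
    rw [mul_comm] at h2
    exact ⟨Nat.pos_of_mul_pos_left h3, Nat.le_of_mul_le_mul_right h2 hn⟩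

lemma ceil_mul_div (n : ℕ) (m i : ℤ) : ⌈((m * i : ℤ) : ℚ) / n⌉ = -((-(m * i)) / n) := by
  have := Rat.floor_intCast_div_natCast (-(m * i)) n
  rw [← this, Int.cast_neg, neg_div, Int.floor_neg, neg_neg]

lemma expo_succ (m : ℤ) (n i : ℕ) :
    expo m n (i + 1) = (-(m * i)) / n - (-(m * (i + 1))) / n := by
  have h1 := ceil_mul_div n m (i + 1)
  have h2 := ceil_mul_div n m i
  rw [expo]
  push_cast at h1 h2 ⊢
  rw [h1, add_sub_cancel_right, h2]
  ring

lemma height_sub_height {k n : ℕ} (hn : 0 < n) (m : ℤ) (i₀ : ℕ) {i : ℕ} (hi : i < k * n) :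
    height k n m i₀ ((k * n - 1 - i : ℕ) + 1) - height k n m i₀ (k * n - 1 - i : ℕ) =
      expo m n (i + 1) + (if (n ∣ i + 1 ∧ i + 1 ≤ i₀ * n) ∧ 0 < i + 1 then 1 else 0 : ℤ) -
        (if (n ∣ i ∧ i ≤ i₀ * n) ∧ 0 < i then 1 else 0 : ℤ) := by
  have e0 : ((k * n - 1 - i : ℕ) : ℤ) = k * n - (i + 1) := by
    rw [Nat.cast_sub (by omega), Nat.cast_sub (by omega)]
    push_cast
    ring
  have c1 : ((n : ℤ) ∣ (i : ℤ) + 1 ∧ (i : ℤ) + 1 ≤ i₀ * n) ↔ (n ∣ i + 1 ∧ i + 1 ≤ i₀ * n) := by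
    exact_mod_cast Iff.rfl
  rw [e0, height_mul_sub k n hn m i₀ (by omega), expo_succ]
  simp only [c1, Nat.succ_pos, and_true]
  rcases Nat.eq_zero_or_pos i with rfl | hi0
  · rw [show (k : ℤ) * n - ((0 : ℕ) + 1) + 1 = k * n by push_cast; ring, height_mul k n hn]
    simp only [Nat.cast_zero, mul_zero, neg_zero, Int.zero_ediv, lt_irrefl, and_false, if_false]
    ring
  · have c2 : ((n : ℤ) ∣ (i : ℤ) ∧ (i : ℤ) ≤ i₀ * n) ↔ (n ∣ i ∧ i ≤ i₀ * n) := by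
      exact_mod_cast Iff.rfl
    rw [show (k : ℤ) * n - (i + 1) + 1 = k * n - i by ring,
      height_mul_sub k n hn m i₀ (by omega)]
    simp only [c2, hi0, and_true]
    ring

lemma prod_Icc_one (N : ℕ) (g : ℕ → F) :
    ∏ i ∈ Finset.Icc 1 N, g i = ∏ i ∈ Finset.range N, g (i + 1) := by
  rw [Finset.range_eq_Ico, Finset.prod_Ico_add' g 0 N 1]
  rfl

lemma prod_expo_mul {k n : ℕ} (hn : 0 < n) (m : ℤ) {i₀ : ℕ} (hi₀ : i₀ < k) (w : ℕ → F)
    (hw : ∀ i, w i ≠ 0) :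
    (∏ i ∈ Finset.range (k * n), w i ^ expo m n (i + 1)) *
        ((∏ a ∈ Finset.Icc 1 i₀, w (a * n - 1)) / ∏ a ∈ Finset.Icc 1 i₀, w (a * n)) =
      ∏ i ∈ Finset.range (k * n), w i ^ (height k n m i₀ ((k * n - 1 - i : ℕ) + 1) -
        height k n m i₀ (k * n - 1 - i : ℕ)) := by
  have hM : i₀ * n < k * n := Nat.mul_lt_mul_of_pos_right hi₀ hn
  rw [← prod_pow_ite_dvd hn hM w,
    ← prod_pow_ite_dvd hn (show i₀ * n < k * n + 1 by omega) (fun x => w (x - 1)),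
    Finset.prod_range_succ']
  simp only [lt_irrefl, and_false, if_false, zpow_zero, mul_one, Nat.add_sub_cancel]
  rw [← Finset.prod_div_distrib, ← Finset.prod_mul_distrib]
  refine Finset.prod_congr rfl fun i hi => ?_
  rw [height_sub_height hn m i₀ (Finset.mem_range.1 hi), zpow_sub₀ (hw i), zpow_add₀ (hw i),
    mul_div_assoc]

end ShuffleElement

section Evaluation

variable {N : ℕ}

lemma hasValueAt_z_of_pos {x : Fin N → K} {j : ℕ} (hj : 1 ≤ j) :
    HasValueAt (z N j) x (extendOne x (j - 1)) := by
  obtain ⟨i, rfl⟩ : ∃ i, j = i + 1 := ⟨j - 1, by omega⟩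
  exact hasValueAt_z i

lemma extendOne_ne_zero {F : Type*} [Field F] {w : Fin N → F} (hw : ∀ i, w i ≠ 0) (j : ℕ) :
    extendOne w j ≠ 0 := by
  rw [extendOne]
  split_ifs
  · exact hw _
  · exact one_ne_zero

lemma extendOne_apply {F : Type*} [Field F] (w : Fin N → F) {j : ℕ} (hj : j < N) :
    extendOne w j = w ⟨j, hj⟩ :=
  dif_pos hj

lemma prod_Icc_add_two {F : Type*} [Field F] (i N : ℕ) (g : ℕ → F) :
    ∏ j ∈ Finset.Icc (i + 1 + 1) N, g (j - 1) = ∏ j ∈ Finset.Ico (i + 1) N, g j := by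
  have := Finset.prod_Ico_add' (fun j => g (j - 1)) (i + 1) N 1
  simp only [Nat.add_sub_cancel] at this
  rw [this]
  rfl

/-- The value of the summand that the shuffle element symmetrizes. -/
lemma hasValueAt_summand {k n : ℕ} (hk : 0 < k) (hn : 0 < n) (m : ℤ) {w : Fin (k * n) → K}
    (hw0 : ∀ i, w i ≠ 0) (hinj : Function.Injective w) (hw : ∀ i j, q * w i ≠ t * w j) :
    HasValueAt
      (((∏ i ∈ Finset.Icc 1 (k * n), z (k * n) i ^ expo m n i) *
          (∑ i ∈ Finset.range k,
            (const (k * n) t ^ i * ∏ a ∈ Finset.Icc 1 i, z (k * n) (a * n)) /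
              (const (k * n) q ^ i * ∏ a ∈ Finset.Icc 1 i, z (k * n) (a * n + 1)))) /
        ((1 - const (k * n) t ^ k) *
          ∏ i ∈ Finset.Icc 1 (k * n - 1),
            (1 - (const (k * n) t * z (k * n) i) / (const (k * n) q * z (k * n) (i + 1)))) *
        ∏ i ∈ Finset.Icc 1 (k * n), ∏ j ∈ Finset.Icc (i + 1) (k * n),
          omega (k * n) (z (k * n) i / z (k * n) j)) w
      (∑ i₀ ∈ Finset.range k, (t / q) ^ i₀ / (1 - t ^ k) *
        seqWeight q t (fun j => height k n m i₀ (j + 1) - height k n m i₀ j) (k * n)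
          (extendOne w)) := by
  have H := independent_q_t
  have hW0 := extendOne_ne_zero hw0
  have hlink : ∀ i ∈ Finset.Icc 1 (k * n - 1),
      1 - (t * extendOne w (i - 1)) / (q * extendOne w (i + 1 - 1)) ≠ 0 := by
    intro i hi
    rw [Finset.mem_Icc] at hi
    rw [extendOne_apply w (show i - 1 < k * n by omega),
      extendOne_apply w (show i + 1 - 1 < k * n by omega), sub_ne_zero]
    intro h
    rw [eq_comm, div_eq_one_iff_eq (mul_ne_zero H.q_ne_zero (hw0 _))] at h
    exact hw _ _ h.symm
  have hval := ((HasValueAt.prod (x := w) fun i (hi : i ∈ Finset.Icc 1 (k * n)) =>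
      (hasValueAt_z_of_pos (Finset.mem_Icc.1 hi).1).zpow (hW0 _) (expo m n i)).mul
    (HasValueAt.sum fun i (_ : i ∈ Finset.range k) =>
      (((hasValueAt_const t).pow i).mul (HasValueAt.prod fun a (ha : a ∈ Finset.Icc 1 i) =>
          hasValueAt_z_of_pos (Nat.mul_pos (Finset.mem_Icc.1 ha).1 hn))).div
        (((hasValueAt_const q).pow i).mul (HasValueAt.prod fun a (_ : a ∈ Finset.Icc 1 i) =>
          hasValueAt_z (a * n)))
        (mul_ne_zero (pow_ne_zero i H.q_ne_zero)
          (Finset.prod_ne_zero_iff.2 fun _ _ => hW0 _)))).div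
    ((hasValueAt_one.sub ((hasValueAt_const t).pow k)).mul
      (HasValueAt.prod fun i (hi : i ∈ Finset.Icc 1 (k * n - 1)) =>
        hasValueAt_one.sub (((hasValueAt_const t).mul
            (hasValueAt_z_of_pos (Finset.mem_Icc.1 hi).1)).div
          ((hasValueAt_const q).mul (hasValueAt_z_of_pos (show 1 ≤ i + 1 by omega)))
          (mul_ne_zero H.q_ne_zero (hW0 _)))))
    (mul_ne_zero (H.one_sub_t_pow hk.ne') (Finset.prod_ne_zero_iff.2 hlink))
  have homega : HasValueAt (∏ i ∈ Finset.Icc 1 (k * n), ∏ j ∈ Finset.Icc (i + 1) (k * n),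
      omega (k * n) (z (k * n) i / z (k * n) j)) w
      (∏ i ∈ Finset.Icc 1 (k * n), ∏ j ∈ Finset.Icc (i + 1) (k * n),
        omegaVal q t (extendOne w (i - 1) / extendOne w (j - 1))) := by
    refine HasValueAt.prod fun i hi => HasValueAt.prod fun j hj => ?_
    rw [Finset.mem_Icc] at hi hj
    refine HasValueAt.omega ((hasValueAt_z_of_pos hi.1).div
      (hasValueAt_z_of_pos (show 1 ≤ j by omega)) (hW0 _)) ?_ ?_
    · rw [extendOne_apply w (show i - 1 < k * n by omega),
        extendOne_apply w (show j - 1 < k * n by omega), sub_ne_zero]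
      intro h
      rw [eq_comm, div_eq_one_iff_eq (hw0 _)] at h
      have := congrArg Fin.val (hinj h)
      simp only at this
      omega
    · rw [extendOne_apply w (show i - 1 < k * n by omega),
        extendOne_apply w (show j - 1 < k * n by omega), sub_ne_zero]
      intro h
      rw [div_mul_eq_mul_div, eq_div_iff (hw0 _), mul_comm (w _) q] at h
      exact hw _ _ h.symm
  convert hval.mul homega using 1
  rw [prod_Icc_one, prod_Icc_one, prod_Icc_one]
  have e : ∀ i, ∏ j ∈ Finset.Icc (i + 1 + 1) (k * n),
        omegaVal q t (extendOne w i / extendOne w (j - 1)) =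
      ∏ j ∈ Finset.Ico (i + 1) (k * n), omegaVal q t (extendOne w i / extendOne w j) :=
    fun i => prod_Icc_add_two i (k * n) (fun j => omegaVal q t (extendOne w i / extendOne w j))
  simp only [Nat.add_sub_cancel, e]
  rw [Finset.mul_sum, Finset.sum_div, Finset.sum_mul]
  refine Finset.sum_congr rfl fun i₀ hi₀ => ?_
  rw [seqWeight, ← prod_expo_mul hn m (Finset.mem_range.1 hi₀) _ hW0]
  simp only [link]
  rw [Finset.prod_inv_distrib, div_pow]
  generalize ∏ i ∈ Finset.range (k * n - 1), (1 - _) = A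
  generalize ∏ i ∈ Finset.range (k * n), extendOne w i ^ expo m n (i + 1) = B
  simp only [div_eq_mul_inv, mul_inv]
  ring

lemma sum_perm_seqWeight_one {F : Type*} [Field F] [DecidableEq F] (q t : F) (e : ℕ → ℤ) {M : ℕ}
    (hN : N = M + 1) {v : Fin N → F} (hv : Function.Injective v) :
    ∑ σ : Equiv.Perm (Fin N), seqWeight q t e N (extendOne (v ∘ σ)) =
      orderSum q t e M (fun _ => 1) (Finset.univ.image v) := by
  subst hN
  simpa using sum_perm_seqWeight q t e M (fun _ => 1) v hv

open Classical in
/-- The value of the shuffle element at a point with generic coordinates. -/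
lemma hasValueAt_P {k n M : ℕ} (hk : 0 < k) (hn : 0 < n) (hM : k * n = M + 1) (m : ℤ)
    {x : Fin (k * n) → K} (hx0 : ∀ i, x i ≠ 0) (hinj : Function.Injective x)
    (hx : ∀ i j, q * x i ≠ t * x j) :
    HasValueAt (P k m n) x
      ((((1 - t) * (1 - q)) / (t - q)) ^ (k * n) *
        ∑ i₀ ∈ Finset.range k, (t / q) ^ i₀ / (1 - t ^ k) *
          orderSum q t (fun j => height k n m i₀ (j + 1) - height k n m i₀ j) M (fun _ => 1)
            (Finset.univ.image x)) := by
  rw [P]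
  refine ((hasValueAt_const _).pow _).mul ?_
  rw [Sym]
  convert HasValueAt.sum (s := Finset.univ) fun (σ : Equiv.Perm (Fin (k * n))) (_ : σ ∈ Finset.univ) =>
    (hasValueAt_summand hk hn m (w := x ∘ σ) (fun i => hx0 _) (hinj.comp σ.injective)
      (fun i j => hx _ _)).permute σ using 1
  rw [Finset.sum_comm]
  refine Finset.sum_congr rfl fun i₀ _ => ?_
  rw [← Finset.mul_sum, sum_perm_seqWeight_one q t _ hM hinj]

end Evaluation

section HookDiagram

variable {F : Type*} [Field F] {q t : F}

lemma sum_orderSum_hookSet [DecidableEq F] (H : Independent q t) {k n a b : ℕ} (hn : 0 < n)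
    (hab : a + b + 1 = k * n) {m : ℤ} (hmn : IsCoprime m (n : ℤ)) :
    ∑ i₀ ∈ Finset.range k, (t / q) ^ i₀ *
        orderSum q t (fun j => height k n m i₀ (j + 1) - height k n m i₀ j) (a + b) (fun _ => 1)
          (hookSet q t a b) =
      hookConst q t a b * q ^ a * squareSum q t k *
        ∑ i ∈ Finset.range n, levelTerm q t m n a b i := by
  rcases eq_or_ne (a + b) 0 with h0 | h0
  · obtain ⟨rfl, rfl⟩ : a = 0 ∧ b = 0 := by omega
    have hkn : k * n = 1 := by omega
    obtain ⟨rfl, rfl⟩ : k = 1 ∧ n = 1 :=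
      ⟨Nat.eq_one_of_mul_eq_one_right hkn, Nat.eq_one_of_mul_eq_one_left hkn⟩
    have := H.q_ne_zero
    simp [orderSum, hookSet_zero_zero, hookConst, squareSum, levelTerm, armLevel, legLevel, this]
  · have hX : 1 - q ^ a * t ^ b ≠ 0 := H.one_sub_ne (by omega)
    have hab' : (a : ℤ) + b + 1 = k * n := by exact_mod_cast hab
    choose! θ δ h1 h2 h3 h4 h5 using fun i₀ (hi₀ : i₀ < k) =>
      exists_generic_line k n m i₀ hn hi₀ hmn
    have hs := sum_steps H hn hab hmn θ h4 h5
    have e : ∀ i₀ ∈ Finset.range k, (t / q) ^ i₀ *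
        orderSum q t (fun j => height k n m i₀ (j + 1) - height k n m i₀ j) (a + b) (fun _ => 1)
          (hookSet q t a b) =
        hookConst q t a b / (1 - q ^ a * t ^ b) * ((t / q) ^ i₀ *
        ((1 - q * (q ^ a * t ^ b)) * armStep q t (height k n m i₀) (θ i₀) a b +
          (1 - t * (q ^ a * t ^ b)) * legStep q t (height k n m i₀) (θ i₀) a b)) := by
      intro i₀ hi₀
      rw [Finset.mem_range] at hi₀
      rw [orderSum_hookSet_total H (height k n m i₀) (θ i₀) (δ i₀) a b
        (fun i hi hi' => h1 i₀ hi₀ i hi (by omega)) (fun i hi hi' => h2 i₀ hi₀ i hi (by omega))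
        (fun i hi hi' => h3 i₀ hi₀ i hi (by omega)) h0]
      ring
    rw [Finset.sum_congr rfl e, ← Finset.mul_sum, hs]
    field_simp

lemma hookConst_normalize (H : Independent q t) {k : ℕ} (hk : 0 < k) (a b : ℕ) :
    (((1 - t) * (1 - q)) / (t - q)) ^ (a + b + 1) / (1 - t ^ k) *
        (hookConst q t a b * q ^ a * squareSum q t k) =
      ((1 - q ^ (-(k : ℤ))) / (1 - t * q⁻¹)) *
        (∏ i ∈ Finset.range a,
          (1 - q ^ (-((i + 1 : ℕ) : ℤ))) / (1 - q ^ (-((i + 1 : ℕ) : ℤ) - 1) * t)) *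
        (∏ i ∈ Finset.range b, (1 - t ^ (i + 1)) / (1 - t ^ (i + 1 + 1) * q⁻¹)) := by
  have hq := H.q_ne_zero
  have q1 := H.one_sub_q
  have t1 := H.one_sub_t
  have tq := H.t_sub_q
  have tk := H.one_sub_t_pow hk.ne'
  have q1' : q - 1 ≠ 0 := by rw [← neg_sub, neg_ne_zero]; exact q1
  have tq' : q - t ≠ 0 := by rw [← neg_sub, neg_ne_zero]; exact tq
  induction a with
  | zero =>
    induction b with
    | zero =>
      rw [squareSum, sum_pow' q1, sum_pow' t1]
      simp only [hookConst, Finset.range_zero, Finset.prod_empty, zpow_neg, zpow_natCast, inv_pow,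
        zero_add, pow_one, pow_zero, mul_one, one_mul]
      have := pow_ne_zero k hq
      rw [show 1 - t * q⁻¹ = -((t - q) / q) by field_simp; ring]
      field_simp
      ring
    | succ b ih =>
      rw [hookConst_succ_right, Finset.prod_range_succ (n := b), ← mul_assoc _ (∏ _ ∈ _, _), ← ih,
        show 0 + (b + 1) + 1 = 0 + b + 1 + 1 by ring, pow_succ _ (0 + b + 1)]
      have e := H.t_pow_sub_q (b + 2)
      have e' : q - t ^ (b + 2) ≠ 0 := by rw [← neg_sub, neg_ne_zero]; exact e
      have key : (((1 - t) * (1 - q)) / (t - q)) *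
          (((t - q) * (1 - t ^ (b + 1))) / ((1 - t) * (t ^ (b + 2) - q) * (1 - q⁻¹))) =
          (1 - t ^ (b + 1)) / (1 - t ^ (b + 1 + 1) * q⁻¹) := by
        rw [show b + 1 + 1 = b + 2 by ring]
        generalize t ^ (b + 2) = A at *
        field_simp
        ring
      rw [← key]
      ring
  | succ a ih =>
    rw [hookConst_succ_left, Finset.prod_range_succ (n := a),
      show a + 1 + b + 1 = a + b + 1 + 1 by ring, pow_succ _ (a + b + 1), pow_succ q a]
    have e := H.t_sub_q_pow (a + 2)
    have e' : q ^ (a + 2) - t ≠ 0 := by rw [← neg_sub, neg_ne_zero]; exact e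
    have key : (((1 - t) * (1 - q)) / (t - q)) *
        (((t - q) * (1 - q ^ (a + 1))) / ((1 - q) * (t - q ^ (a + 2)) * (1 - t))) * q =
        (1 - q ^ (-((a + 1 : ℕ) : ℤ))) / (1 - q ^ (-((a + 1 : ℕ) : ℤ) - 1) * t) := by
      rw [show -((a + 1 : ℕ) : ℤ) - 1 = -((a + 2 : ℕ) : ℤ) by push_cast; ring, zpow_neg, zpow_neg,
        zpow_natCast, zpow_natCast]
      have h1 := pow_ne_zero (a + 1) hq
      rw [show a + 2 = a + 1 + 1 by ring, pow_succ q (a + 1)] at *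
      generalize q ^ (a + 1) = A at *
      rw [show 1 - (A * q)⁻¹ * t = -((t - A * q) / (A * q)) by field_simp; ring]
      field_simp
      ring
    rw [← key]
    linear_combination (((1 - t) * (1 - q)) / (t - q) *
      (((t - q) * (1 - q ^ (a + 1))) / ((1 - q) * (t - q ^ (a + 2)) * (1 - t))) * q) * ih

end HookDiagram

section HookDiagram

lemma mem_hook {N l : ℕ} (hl : 1 ≤ l) {c : ℕ × ℕ} :
    c ∈ hook N l ↔ (c.1 = 0 ∧ c.2 ≤ N - l) ∨ (c.2 = 0 ∧ c.1 ≤ l - 1) := by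
  obtain ⟨y, x⟩ := c
  rw [hook, YoungDiagram.mem_ofRowLens]
  cases y with
  | zero => simp; omega
  | succ y => simp; omega

lemma card_hook {N l : ℕ} (hl : 1 ≤ l) (hl' : l ≤ N) : (hook N l).card = N := by
  have h : (hook N l).cells = (Finset.range (N - l + 1)).image (fun x => ((0 : ℕ), x)) ∪
      (Finset.range (l - 1)).image (fun y => (y + 1, (0 : ℕ))) := by
    ext ⟨y, x⟩
    rw [YoungDiagram.mem_cells, mem_hook hl]
    simp only [Finset.mem_union, Finset.mem_image, Finset.mem_range, Prod.mk.injEq]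
    constructor
    · rintro (⟨h1, h2⟩ | ⟨h1, h2⟩)
      · exact Or.inl ⟨x, by omega, h1.symm, rfl⟩
      · rcases Nat.eq_zero_or_pos y with h3 | h3
        · exact Or.inl ⟨x, by omega, h3.symm, rfl⟩
        · exact Or.inr ⟨y - 1, by omega, by omega, h1.symm⟩
    · rintro (⟨x', h1, h2, h3⟩ | ⟨y', h1, h2, h3⟩)
      · exact Or.inl ⟨h2.symm, by omega⟩
      · exact Or.inr ⟨h3.symm, by omega⟩
  rw [YoungDiagram.card, h, Finset.card_union_of_disjoint,
    Finset.card_image_of_injective _ (fun _ _ h => (Prod.mk.inj h).2),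
    Finset.card_image_of_injective _ (fun _ _ h => by simpa using h), Finset.card_range,
    Finset.card_range]
  · omega
  · rw [Finset.disjoint_left]
    intro c h1 h2
    simp only [Finset.mem_image, Finset.mem_range] at h1 h2
    obtain ⟨x, -, rfl⟩ := h1
    obtain ⟨y, -, h3⟩ := h2
    simp at h3

lemma weight_ne_zero (c : ℕ × ℕ) : weight c ≠ 0 :=
  mul_ne_zero (pow_ne_zero _ independent_q_t.q_ne_zero) (zpow_ne_zero _ independent_q_t.t_ne_zero)

lemma q_t_zpow_injective {i j i' j' : ℤ} (h : q ^ i * t ^ j = q ^ i' * t ^ j') :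
    i = i' ∧ j = j' := by
  have H := independent_q_t
  have := H.eq_zero (i - i') (j - j') (by
    rw [zpow_sub₀ H.q_ne_zero, zpow_sub₀ H.t_ne_zero, div_mul_div_comm, h, div_self]
    exact mul_ne_zero (zpow_ne_zero _ H.q_ne_zero) (zpow_ne_zero _ H.t_ne_zero))
  omega

lemma weight_injective : Function.Injective weight := by
  rintro ⟨y, x⟩ ⟨y', x'⟩ h
  simp only [weight, ← zpow_natCast q] at h
  have := q_t_zpow_injective h
  rw [Prod.mk.injEq]
  omega

lemma q_mul_weight_ne {N l : ℕ} (hl : 1 ≤ l) (c : ℕ × ℕ) {c' : ℕ × ℕ} (hc : c' ∈ hook N l) :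
    q * weight c ≠ t * weight c' := by
  have H := independent_q_t
  intro h
  have h1 : q ^ ((c.2 : ℤ) + 1) * t ^ (-(c.1 : ℤ)) = q ^ (c'.2 : ℤ) * t ^ (1 + -(c'.1 : ℤ)) := by
    rw [zpow_add₀ H.q_ne_zero, zpow_add₀ H.t_ne_zero]
    simp only [weight, zpow_natCast, zpow_one] at h ⊢
    linear_combination h
  have h2 := q_t_zpow_injective h1
  rw [mem_hook hl] at hc
  omega

open Classical in
lemma image_weight_hook {N l : ℕ} (hl : 1 ≤ l) (e : Fin N ≃ {c // c ∈ (hook N l).cells}) :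
    Finset.univ.image (fun i => weight (e i).1) = hookSet q t (N - l) (l - 1) := by
  ext v
  rw [mem_hookSet, Finset.mem_image]
  constructor
  · rintro ⟨i, -, rfl⟩
    have h := (e i).2
    rw [YoungDiagram.mem_cells, mem_hook hl] at h
    rcases h with ⟨h1, h2⟩ | ⟨h1, h2⟩
    · exact Or.inl ⟨_, h2, by simp [weight, h1]⟩
    · exact Or.inr ⟨_, h2, by simp [weight, h1]⟩
  · rintro (⟨x, hx, rfl⟩ | ⟨y, hy, rfl⟩)
    · refine ⟨e.symm ⟨(0, x), ?_⟩, Finset.mem_univ _, by simp [weight]⟩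
      rw [YoungDiagram.mem_cells, mem_hook hl]
      exact Or.inl ⟨rfl, hx⟩
    · refine ⟨e.symm ⟨(y, 0), ?_⟩, Finset.mem_univ _, by simp [weight]⟩
      rw [YoungDiagram.mem_cells, mem_hook hl]
      exact Or.inr ⟨rfl, hy⟩

lemma sum_Icc_one {R : Type*} [AddCommMonoid R] (N : ℕ) (g : ℕ → R) :
    ∑ i ∈ Finset.Icc 1 N, g i = ∑ i ∈ Finset.range N, g (i + 1) := by
  rw [Finset.range_eq_Ico, Finset.sum_Ico_add' g 0 N 1]
  rfl

lemma armLevel_eq_sum_floor (m : ℤ) (n a : ℕ) (i : ℤ) :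
    armLevel m n a i = ∑ j ∈ Finset.Icc 1 a, ⌊((m * j + i : ℤ) : ℚ) / n⌋ := by
  rw [sum_Icc_one, armLevel]
  refine Finset.sum_congr rfl fun u _ => ?_
  rw [Rat.floor_intCast_div_natCast]
  push_cast
  rfl

lemma legLevel_eq_sum_ceil (m : ℤ) (n b : ℕ) (i : ℤ) :
    legLevel m n b i = -∑ j ∈ Finset.Icc 1 b, ⌈((m * j - i : ℤ) : ℚ) / n⌉ := by
  rw [sum_Icc_one, legLevel, ← Finset.sum_neg_distrib]
  refine Finset.sum_congr rfl fun v _ => ?_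
  rw [← Int.floor_neg, ← neg_div, ← Int.cast_neg, Rat.floor_intCast_div_natCast]
  push_cast
  rw [neg_sub]

end HookDiagram

end PieriShuffle

open PieriShuffle in
theorem mainTheorem6 (k n l : ℕ) (m : ℤ) (hk : 0 < k) (hn : 0 < n)
    (hmn : IsCoprime m (n : ℤ)) (hl : 1 ≤ l) (hl' : l ≤ k * n) :
    HasValueAtDiagram (P k m n) (hook (k * n) l)
      ((∑ i ∈ Finset.range n,
          q ^ (∑ j ∈ Finset.Icc 1 (n * k - l), ⌊((m * j + i : ℤ) : ℚ) / n⌋) *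
            t ^ (-∑ j ∈ Finset.Icc 1 (l - 1), ⌈((m * j - i : ℤ) : ℚ) / n⌉)) *
        ((1 - q ^ (-(k : ℤ))) / (1 - t * q⁻¹)) *
        (∏ i ∈ Finset.Icc 1 (n * k - l),
          (1 - q ^ (-(i : ℤ))) / (1 - q ^ (-(i : ℤ) - 1) * t)) *
        (∏ i ∈ Finset.Icc 1 (l - 1), (1 - t ^ i) / (1 - t ^ (i + 1) * q⁻¹))) := by
  classical
  have H := independent_q_t
  have hl0 : l ≤ n * k := by rwa [mul_comm]
  have hab : n * k - l + (l - 1) + 1 = k * n := by rw [mul_comm k n]; omega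
  refine ⟨card_hook hl hl', fun e => ?_⟩
  have hval := hasValueAt_P (x := fun i => weight (e i).1) hk hn hab.symm m
    (fun i => weight_ne_zero _)
    (fun i j h => e.injective (Subtype.ext (weight_injective h)))
    (fun i j => q_mul_weight_ne hl _ ((YoungDiagram.mem_cells _).1 (e j).2))
  convert hval using 1
  rw [show (∑ i₀ ∈ Finset.range k, (t / q) ^ i₀ / (1 - t ^ k) *
        orderSum q t (fun j => height k n m i₀ (j + 1) - height k n m i₀ j)
          (n * k - l + (l - 1)) (fun _ => 1) (Finset.univ.image fun i => weight (e i).1)) =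
      (∑ i₀ ∈ Finset.range k, (t / q) ^ i₀ *
        orderSum q t (fun j => height k n m i₀ (j + 1) - height k n m i₀ j)
          (n * k - l + (l - 1)) (fun _ => 1) (hookSet q t (n * k - l) (l - 1))) / (1 - t ^ k) by
    rw [Finset.sum_div, image_weight_hook hl e, mul_comm k n]
    exact Finset.sum_congr rfl fun i₀ _ => by ring]
  rw [sum_orderSum_hookSet H hn hab hmn]
  have hc := hookConst_normalize H hk (n * k - l) (l - 1)
  rw [hab] at hc
  rw [prod_Icc_one, prod_Icc_one]
  simp only [levelTerm, armLevel_eq_sum_floor, legLevel_eq_sum_ceil]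
  linear_combination (-∑ i ∈ Finset.range n,
    q ^ (∑ j ∈ Finset.Icc 1 (n * k - l), ⌊((m * j + i : ℤ) : ℚ) / n⌋) *
      t ^ (-∑ j ∈ Finset.Icc 1 (l - 1), ⌈((m * j - i : ℤ) : ℚ) / n⌉)) * hc
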